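/- **Setting.** Let $d\ge 1$, $P\ge 0$ and $K\ge 0$ be integers, let $\varepsilon>0$, and let $C_E,C_p$ be real constants. For an open set $U\subset\mathbb{R}^d$ and $k\in\mathbb{N}_0$ let $W^{k,2}(U)$ be the Sobolev space with norm $\bigl(\sum_{|\alpha|\le k}\|\partial^\alpha u\|_{L^2(U)}^2\bigr)^{1/2}$, and let $W^{-k,2}(U):=W^{k,2}(U)'$ be its dual (not the dual of $W^{k,2}_0(U)$) with the operator norm; $f\in L^2(U)$ is identified with the functional $\varphi\mapsto\int_U f\varphi\,dx$. *Finite element space.* Let $\zeta(x)=\prod_{j=1}^d\zeta_1(x_j)$, where $\zeta_1(t)=c\,e^{-1/(1-4t^2)}$ for $|t|<\tfrac12$ and $\zeta_1(t)=0$ otherwise, with $c$ such that $\int_{\mathbb{R}}\zeta_1=1$. For $\sigma>0$ and $i\in\mathbb{Z}^d$ put $\zeta_\sigma(x)=\sigma^{-d}\zeta(x/\sigma)$, $\omega_i=\prod_j\bigl((i_j-\tfrac12)\sigma,(i_j+\tfrac12)\sigma\bigr)$ and $\varphi_i(x)=\int_{\omega_i}\zeta_\sigma(x-y)\,dy$.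 The space $V_\sigma^P(U)$ consists of the restrictions to $U$ of the elements of $\operatorname{span}\{\varphi_i v \mid i\in\mathbb{Z}^d,\ v\text{ a polynomial of degree at most }P\}$. *Elements.* Put $Q_i=\prod_j(i_j\sigma,(i_j+1)\sigma)$. For an open set $\Omega\subset\mathbb{R}^d$ call $Q_i$ active if $Q_i\cap\Omega$ has positive measure; an active element is uncut if $Q_i\subset\Omega$ and cut otherwise. Let $\Omega_\sigma$ be the interior of the union of the closures of the active elements. Two elements are neighbours if they share at least one grid point (corner). *Bilinear form.* Put $$A(u,v)=\int_\Omega uv\,dx+\varepsilon\,\sigma^{2(P+1)}\sum_{Q_i\text{ cut}}\ \sum_{|\alpha|=P+1}\int_{Q_i}\partial^\alpha u\,\partial^\alpha v\,dx .$$ **Theorem (Optimality).** There are constants $C>0$ and $\sigma_0>0$, depending only on $d,P,K,\varepsilon,C_E,C_p$, such that the following holds. Let $\Omega\subset\mathbb{R}^d$ be an open set for which there is a bounded linear extension operator $W^{P+1,2}(\Omega)\to W^{P+1,2}(\mathbb{R}^d)$ of norm at most $C_E$. Let $0<\sigma\le\sigma_0$ and $h=\sigma^2$ (that is, $\sigma=\sqrt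 h$), and suppose that every cut element is the first member of a sequence of at most $K$ cut elements in which consecutive members are neighbours and whose last member has an uncut neighbour. Let $u\in W^{P+1,2}(\Omega)$, and let $u_h\in W^{-(P+1),2}(\Omega)$ satisfy $$\|u_h-u\|_{W^{-(P+1),2}(\Omega)}\le C_p\,h^{P+1}\,\|u\|_{W^{P+1,2}(\Omega)} .$$ Then the problem of finding $u_\sigma\in V_\sigma^P(\Omega_\sigma)$ with $$A(u_\sigma,v_\sigma)=\langle u_h,v_\sigma\rangle\qquad\text{for all } v_\sigma\in V_\sigma^P(\Omega_\sigma)$$ has at most one solution, it has a solution if $\Omega$ is bounded, and every solution satisfies $$\|u_\sigma-u\|_{W^{-(P+1),2}(\Omega)}\le C\,h^{P+1}\,\|u\|_{W^{P+1,2}(\Omega)} .$$ -/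

import Mathlib

open MeasureTheory
open scoped ContDiff

namespace SmoothPUFEM

/-! ### Partial derivatives and Sobolev spaces -/

/-- `ℝ^d` with the Euclidean norm. -/
abbrev Space (d : ℕ) : Type := EuclideanSpace ℝ (Fin d)

/-- The partial derivative `∂_j f`. -/
noncomputable def partialDeriv {d : ℕ} (j : Fin d) (f : Space d → ℝ) : Space d → ℝ :=
  fun x => fderiv ℝ f x (EuclideanSpace.single j 1)

/-- The derivative `∂^α f` for a multi-index `α` (only applied to smooth functions). -/
noncomputable def multiDeriv {d : ℕ} (α : Fin d → ℕ) (f : Space d → ℝ) : Space d → ℝ :=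
  (List.finRange d).foldr (fun j g => (partialDeriv j)^[α j] g) f

/-- The multi-indices with `|α| = k`. -/
def multiIndicesEq (d k : ℕ) : Finset (Fin d → ℕ) :=
  Finset.piAntidiag Finset.univ k

/-- The multi-indices with `|α| ≤ k`. -/
def multiIndices (d k : ℕ) : Finset (Fin d → ℕ) :=
  (Finset.range (k + 1)).biUnion (multiIndicesEq d)

theorem mem_multiIndices {d k : ℕ} {α : Fin d → ℕ} :
    α ∈ multiIndices d k ↔ ∑ j, α j ≤ k := by
  simp [multiIndices, multiIndicesEq]

/-- Smooth functions on `ℝ^d` with compact support. -/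
def IsSmoothCompact {d : ℕ} (f : Space d → ℝ) : Prop :=
  ContDiff ℝ ∞ f ∧ HasCompactSupport f

/-- Test functions on `Ω`: the elements of `C_c^∞(Ω)`, extended by zero. -/
def IsTest {d : ℕ} (Ω : Set (Space d)) (φ : Space d → ℝ) : Prop :=
  IsSmoothCompact φ ∧ tsupport φ ⊆ Ω

section SmoothCompact

variable {d : ℕ}

theorem contDiff_partialDeriv {f : Space d → ℝ} (hf : ContDiff ℝ ∞ f) (j : Fin d) :
    ContDiff ℝ ∞ (partialDeriv j f) :=
  (hf.fderiv_right (m := ∞) (by simp)).clm_apply contDiff_const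

theorem tsupport_partialDeriv_subset (f : Space d → ℝ) (j : Fin d) :
    tsupport (partialDeriv j f) ⊆ tsupport f := by
  refine (closure_mono ?_).trans (tsupport_fderiv_subset ℝ (f := f))
  intro x hx
  simp only [Function.mem_support, partialDeriv] at hx ⊢
  intro h
  exact hx (by rw [h]; rfl)

theorem IsSmoothCompact.partialDeriv {f : Space d → ℝ} (hf : IsSmoothCompact f) (j : Fin d) :
    IsSmoothCompact (partialDeriv j f) :=
  ⟨contDiff_partialDeriv hf.1 j,
    hf.2.of_isClosed_subset (isClosed_tsupport _) (tsupport_partialDeriv_subset f j)⟩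

theorem IsTest.partialDeriv {Ω : Set (Space d)} {f : Space d → ℝ} (hf : IsTest Ω f)
    (j : Fin d) : IsTest Ω (partialDeriv j f) :=
  ⟨hf.1.partialDeriv j, (tsupport_partialDeriv_subset f j).trans hf.2⟩

theorem IsTest.iterate {Ω : Set (Space d)} {f : Space d → ℝ} (hf : IsTest Ω f)
    (j : Fin d) (n : ℕ) : IsTest Ω ((SmoothPUFEM.partialDeriv j)^[n] f) := by
  induction n with
  | zero => exact hf
  | succ n ih => rw [Function.iterate_succ_apply']; exact ih.partialDeriv j

theorem IsTest.foldr {Ω : Set (Space d)} {f : Space d → ℝ} (hf : IsTest Ω f)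
    (α : Fin d → ℕ) (l : List (Fin d)) :
    IsTest Ω (l.foldr (fun j g => (SmoothPUFEM.partialDeriv j)^[α j] g) f) := by
  induction l with
  | nil => exact hf
  | cons j l ih => exact ih.iterate j _

theorem IsTest.multiDeriv {Ω : Set (Space d)} {f : Space d → ℝ} (hf : IsTest Ω f)
    (α : Fin d → ℕ) : IsTest Ω (multiDeriv α f) :=
  hf.foldr α _

theorem IsSmoothCompact.isTest {f : Space d → ℝ} (hf : IsSmoothCompact f) :
    IsTest Set.univ f := ⟨hf, Set.subset_univ _⟩

theorem IsSmoothCompact.multiDeriv {f : Space d → ℝ} (hf : IsSmoothCompact f)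
    (α : Fin d → ℕ) : IsSmoothCompact (multiDeriv α f) :=
  (hf.isTest.multiDeriv α).1

theorem IsSmoothCompact.memLp {f : Space d → ℝ} (hf : IsSmoothCompact f)
    (Ω : Set (Space d)) : MemLp f 2 (volume.restrict Ω) :=
  (hf.1.continuous.memLp_of_hasCompactSupport hf.2).restrict Ω

theorem integrable_mul_test {Ω : Set (Space d)} (f : Lp ℝ 2 (volume.restrict Ω))
    {φ : Space d → ℝ} (hφ : IsSmoothCompact φ) :
    Integrable (fun x => f x * φ x) (volume.restrict Ω) :=
  (Lp.memLp f).integrable_mul (hφ.memLp Ω)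

theorem partialDeriv_comm {f : Space d → ℝ} (hf : ContDiff ℝ ∞ f) (i j : Fin d) :
    partialDeriv i (partialDeriv j f) = partialDeriv j (partialDeriv i f) := by
  have hd : Differentiable ℝ (fderiv ℝ f) :=
    (hf.fderiv_right (m := ∞) (by simp)).differentiable (by simp)
  have key : ∀ (a b : Fin d) (x : Space d), partialDeriv a (partialDeriv b f) x =
      fderiv ℝ (fderiv ℝ f) x (EuclideanSpace.single a 1) (EuclideanSpace.single b 1) := by
    intro a b x
    unfold partialDeriv
    rw [fderiv_clm_apply (hd x) (differentiableAt_const _)]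
    simp
  funext x
  rw [key, key]
  have hs : IsSymmSndFDerivAt ℝ f x :=
    hf.contDiffAt.isSymmSndFDerivAt (by
      simp only [minSmoothness_of_isRCLikeNormedField]
      exact WithTop.coe_le_coe.2 (le_top : (2 : ℕ∞) ≤ ⊤))
  exact hs _ _

theorem iterate_comm {f : Space d → ℝ} (hf : IsSmoothCompact f) (i j : Fin d) (n : ℕ) :
    partialDeriv i ((partialDeriv j)^[n] f) = (partialDeriv j)^[n] (partialDeriv i f) := by
  induction n with
  | zero => rfl
  | succ n ih =>
    rw [Function.iterate_succ_apply', Function.iterate_succ_apply', ← ih]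
    exact partialDeriv_comm (hf.isTest.iterate j n).1.1 i j

theorem foldr_comm {f : Space d → ℝ} (hf : IsSmoothCompact f) (α : Fin d → ℕ)
    (l : List (Fin d)) (i : Fin d) (n : ℕ) :
    l.foldr (fun j g => (partialDeriv j)^[α j] g) ((partialDeriv i)^[n] f) =
      (partialDeriv i)^[n] (l.foldr (fun j g => (partialDeriv j)^[α j] g) f) := by
  have one : ∀ {g : Space d → ℝ}, IsSmoothCompact g → ∀ l : List (Fin d),
      l.foldr (fun j g => (partialDeriv j)^[α j] g) (partialDeriv i g) =
      partialDeriv i (l.foldr (fun j g => (partialDeriv j)^[α j] g) g) := by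
    intro g hg l
    induction l with
    | nil => rfl
    | cons j l ih =>
      simp only [List.foldr_cons]
      rw [ih, iterate_comm (hg.isTest.foldr α l).1]
  induction n with
  | zero => rfl
  | succ n ih =>
    rw [Function.iterate_succ_apply', Function.iterate_succ_apply', ← ih]
    exact one (hf.isTest.iterate i n).1 l

theorem integral_mul_partialDeriv {f g : Space d → ℝ} (hf : IsSmoothCompact f)
    (hg : IsSmoothCompact g) (j : Fin d) :
    ∫ x, f x * partialDeriv j g x = -∫ x, partialDeriv j f x * g x := by
  have hint : ∀ {a b : Space d → ℝ}, IsSmoothCompact a → IsSmoothCompact b →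
      Integrable (fun x => a x * b x) := by
    intro a b ha hb
    exact (ha.1.continuous.mul hb.1.continuous).integrable_of_hasCompactSupport hb.2.mul_left
  exact integral_mul_fderiv_eq_neg_fderiv_mul_of_integrable
    (hint (hf.partialDeriv j) hg) (hint hf (hg.partialDeriv j)) (hint hf hg)
    (fun x _ => hf.1.differentiable (by simp) x) (fun x _ => hg.1.differentiable (by simp) x)

theorem integral_mul_iterate {f g : Space d → ℝ} (hf : IsSmoothCompact f)
    (hg : IsSmoothCompact g) (j : Fin d) (n : ℕ) :
    ∫ x, f x * (partialDeriv j)^[n] g x =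
      (-1) ^ n * ∫ x, (partialDeriv j)^[n] f x * g x := by
  induction n generalizing g with
  | zero => simp
  | succ n ih =>
    rw [Function.iterate_succ_apply, ih (hg.partialDeriv j),
      integral_mul_partialDeriv (hf.isTest.iterate j n).1 hg, Function.iterate_succ_apply']
    ring

theorem integral_mul_foldr {f g : Space d → ℝ} (hf : IsSmoothCompact f)
    (hg : IsSmoothCompact g) (α : Fin d → ℕ) (l : List (Fin d)) :
    ∫ x, f x * l.foldr (fun j g => (partialDeriv j)^[α j] g) g x =
      (-1) ^ (l.map α).sum *
        ∫ x, l.foldr (fun j g => (partialDeriv j)^[α j] g) f x * g x := by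
  induction l generalizing f with
  | nil => simp
  | cons j l ih =>
    simp only [List.foldr_cons, List.map_cons, List.sum_cons]
    rw [integral_mul_iterate hf (hg.isTest.foldr α l).1, ih (hf.isTest.iterate j _).1,
      foldr_comm hf, pow_add, mul_assoc]

theorem setIntegral_mul_multiDeriv {Ω : Set (Space d)} {f φ : Space d → ℝ}
    (hf : IsSmoothCompact f) (hφ : IsTest Ω φ) (α : Fin d → ℕ) :
    ∫ x in Ω, f x * multiDeriv α φ x =
      (-1) ^ (∑ j, α j) * ∫ x in Ω, multiDeriv α f x * φ x := by
  have hz : ∀ {ψ : Space d → ℝ}, IsTest Ω ψ → ∀ a : Space d → ℝ,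
      ∫ x in Ω, a x * ψ x = ∫ x, a x * ψ x := by
    intro ψ hψ a
    refine setIntegral_eq_integral_of_forall_compl_eq_zero fun x hx => ?_
    rw [image_eq_zero_of_notMem_tsupport (fun h => hx (hψ.2 h)), mul_zero]
  rw [hz (hφ.multiDeriv α), hz hφ]
  have h := integral_mul_foldr hf hφ.1 α (List.finRange d)
  have hs : ((List.finRange d).map α).sum = ∑ j, α j := by
    rw [← List.ofFn_eq_map, List.sum_ofFn]
  rw [hs] at h
  exact h

end SmoothCompact

/-- `L²(Ω)`. -/
abbrev L2 {d : ℕ} (Ω : Set (Space d)) : Type := Lp ℝ 2 ((volume : Measure (Space d)).restrict Ω)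

/-- The multi-index `0`. -/
def zeroIdx (d k : ℕ) : multiIndices d k :=
  ⟨0, mem_multiIndices.2 (by simp)⟩

/-- The Sobolev space `W^{k,2}(Ω)`. A function `u` is represented by the family `(∂^α u)_{|α| ≤ k}`
of its weak derivatives in `L²(Ω)`, with `u` itself as the component at `α = 0`; the norm is
`(∑_{|α| ≤ k} ‖∂^α u‖²)^{1/2}`. -/
def sobolev {d : ℕ} (k : ℕ) (Ω : Set (Space d)) :
    Submodule ℝ (PiLp 2 (fun _ : multiIndices d k => L2 Ω)) where
  carrier := {w | ∀ (α : multiIndices d k) (φ : Space d → ℝ), IsTest Ω φ →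
    ∫ x in Ω, w (zeroIdx d k) x * multiDeriv α.1 φ x =
      (-1) ^ (∑ j, α.1 j) * ∫ x in Ω, w α x * φ x}
  zero_mem' := by
    intro α φ _
    have h0 : ∀ (ψ : Space d → ℝ), ∫ x in Ω, (0 : L2 Ω) x * ψ x = 0 := by
      intro ψ
      rw [← integral_zero (Space d) ℝ (μ := volume.restrict Ω)]
      refine integral_congr_ae ?_
      filter_upwards [Lp.coeFn_zero ℝ 2 ((volume : Measure (Space d)).restrict Ω)] with x hx
      rw [hx, Pi.zero_apply, zero_mul]
    simp only [PiLp.zero_apply, h0, mul_zero]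
  add_mem' := by
    intro v w hv hw α φ hφ
    have hadd : ∀ (f g : L2 Ω) {ψ : Space d → ℝ}, IsSmoothCompact ψ →
        ∫ x in Ω, (f + g) x * ψ x = (∫ x in Ω, f x * ψ x) + ∫ x in Ω, g x * ψ x := by
      intro f g ψ hψ
      rw [← integral_add (integrable_mul_test f hψ) (integrable_mul_test g hψ)]
      refine integral_congr_ae ?_
      filter_upwards [Lp.coeFn_add f g] with x hx
      rw [hx, Pi.add_apply, add_mul]
    simp only [PiLp.add_apply]
    rw [hadd _ _ (hφ.multiDeriv α.1).1, hadd _ _ hφ.1, hv α φ hφ, hw α φ hφ, mul_add]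
  smul_mem' := by
    intro c w hw α φ hφ
    have hsmul : ∀ (f : L2 Ω) (ψ : Space d → ℝ),
        ∫ x in Ω, (c • f) x * ψ x = c * ∫ x in Ω, f x * ψ x := by
      intro f ψ
      rw [← integral_const_mul]
      refine integral_congr_ae ?_
      filter_upwards [Lp.coeFn_smul c f] with x hx
      rw [hx, Pi.smul_apply, smul_eq_mul, mul_assoc]
    simp only [PiLp.smul_apply]
    rw [hsmul, hsmul, hw α φ hφ]
    ring

/-- The bounded embedding `W^{k,2}(Ω) → L²(Ω)`, which forgets the weak derivatives. -/
noncomputable def toL2 {d : ℕ} (k : ℕ) (Ω : Set (Space d)) : sobolev k Ω →L[ℝ] L2 Ω :=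
  (PiLp.proj (𝕜 := ℝ) 2 (fun _ : multiIndices d k => L2 Ω) (zeroIdx d k)).comp
    (sobolev k Ω).subtypeL

/-- `W^{-k,2}(Ω)`: the dual of `W^{k,2}(Ω)` (not of `W₀^{k,2}(Ω)`), with the operator norm. -/
abbrev NegSobolev {d : ℕ} (k : ℕ) (Ω : Set (Space d)) : Type := sobolev k Ω →L[ℝ] ℝ

/-- `f ∈ L²(Ω)` as an element of `W^{-k,2}(Ω)`: the functional `φ ↦ ∫_Ω f φ`. -/
noncomputable def toNeg {d : ℕ} (k : ℕ) {Ω : Set (Space d)} (f : L2 Ω) : NegSobolev k Ω :=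
  (innerSL ℝ f).comp (toL2 k Ω)

theorem toNeg_apply {d k : ℕ} {Ω : Set (Space d)} (f : L2 Ω) (φ : sobolev k Ω) :
    toNeg k f φ = ∫ x in Ω, f x * toL2 k Ω φ x := by
  change inner ℝ f (toL2 k Ω φ) = _
  rw [L2.inner_def]
  refine integral_congr_ae (Filter.Eventually.of_forall fun x => ?_)
  simp [mul_comm]

/-- The restriction to `Ω` of a smooth compactly supported function, as an element of
`W^{k,2}(Ω)`; its weak derivatives are the classical ones. -/
noncomputable def smoothToSobolev {d : ℕ} (k : ℕ) (Ω : Set (Space d)) {f : Space d → ℝ}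
    (hf : IsSmoothCompact f) : sobolev k Ω :=
  ⟨WithLp.toLp 2 fun α => ((hf.multiDeriv α.1).memLp Ω).toLp _, by
    have hc : ∀ {g : Space d → ℝ} (hg : MemLp g 2 (volume.restrict Ω)) (ψ : Space d → ℝ),
        ∫ x in Ω, hg.toLp g x * ψ x = ∫ x in Ω, g x * ψ x := by
      intro g hg ψ
      refine integral_congr_ae ?_
      filter_upwards [hg.coeFn_toLp] with x hx
      simp [hx]
    have h0 : multiDeriv (0 : Fin d → ℕ) f = f := by
      unfold multiDeriv
      induction List.finRange d with
      | nil => rfl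
      | cons j l ih => simp
    intro α φ hφ
    simp only [zeroIdx]
    rw [hc, hc, h0]
    exact setIntegral_mul_multiDeriv hf hφ α.1⟩

/-- There is a bounded linear extension operator `W^{k,2}(Ω) → W^{k,2}(ℝ^d)` of norm at
most `C`. -/
def HasExtension {d : ℕ} (k : ℕ) (Ω : Set (Space d)) (C : ℝ) : Prop :=
  ∃ T : sobolev k Ω →L[ℝ] sobolev k (Set.univ : Set (Space d)), ‖T‖ ≤ C ∧
    ∀ u, toL2 k Set.univ (T u) =ᵐ[volume.restrict Ω] toL2 k Ω u

/-! ### The smooth partition of unity and the finite element space -/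

/-- The one-dimensional Friedrichs mollifier before normalization. -/
noncomputable def friedrichsBump (x : ℝ) : ℝ :=
  if 1 / 2 ≤ |x| then 0 else Real.exp (-(1 / (1 - 4 * x ^ 2)))

/-- The one-dimensional Friedrichs mollifier, normalized to have integral one. -/
noncomputable def friedrichs (x : ℝ) : ℝ :=
  (∫ t, friedrichsBump t)⁻¹ * friedrichsBump x

/-- The Friedrichs mollifier on `ℝ^d`: the product of the one-dimensional ones. -/
noncomputable def mollifier {d : ℕ} (x : Space d) : ℝ :=
  ∏ j, friedrichs (x j)

/-- The scaled mollifier `ζ_σ(x) = σ^{-d} ζ(x / σ)`. -/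
noncomputable def scaledMollifier {d : ℕ} (σ : ℝ) (x : Space d) : ℝ :=
  (σ ^ d)⁻¹ * mollifier (σ⁻¹ • x)

/-- The patch core `ω_i`: the open cube of side `σ` centred at the grid point `σ i`. -/
def patchCore {d : ℕ} (σ : ℝ) (i : Fin d → ℤ) : Set (Space d) :=
  {x | ∀ j, ((i j : ℝ) - 1 / 2) * σ < x j ∧ x j < ((i j : ℝ) + 1 / 2) * σ}

/-- The partition of unity function `φ_i`, the mollified indicator function of `ω_i`. -/
noncomputable def pou {d : ℕ} (σ : ℝ) (i : Fin d → ℤ) (x : Space d) : ℝ :=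
  ∫ y in patchCore σ i, scaledMollifier σ (x - y)

/-- Polynomial functions of total degree at most `P`: the span of the `x^α` with `|α| ≤ P`. -/
def polySpace (d P : ℕ) : Submodule ℝ (Space d → ℝ) :=
  Submodule.span ℝ {f | ∃ α ∈ multiIndices d P, f = fun x => ∏ j, x j ^ α j}

/-- The smooth partition of unity space with grid size `σ`: the span of the `φ_i v_i` with `v_i`
polynomial of degree at most `P`. Its elements are kept as functions on all of `ℝ^d`; the space
`V_σ^P(U)` on an open set `U` consists of their restrictions to `U`. -/
def pufem (d P : ℕ) (σ : ℝ) : Submodule ℝ (Space d → ℝ) :=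
  Submodule.span ℝ {f | ∃ i : Fin d → ℤ, ∃ v ∈ polySpace d P, f = fun x => pou σ i x * v x}

theorem friedrichsBump_eq (x : ℝ) : friedrichsBump x = expNegInvGlue (1 - 4 * x ^ 2) := by
  have hiff : 1 / 2 ≤ |x| ↔ 1 - 4 * x ^ 2 ≤ 0 := by
    rw [← sq_abs x]
    constructor
    · intro h; nlinarith [abs_nonneg x]
    · intro h; by_contra! hlt; nlinarith [abs_nonneg x]
  unfold friedrichsBump expNegInvGlue
  by_cases h : 1 / 2 ≤ |x|
  · rw [if_pos h, if_pos (hiff.1 h)]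
  · rw [if_neg h, if_neg (fun h' => h (hiff.2 h')), one_div]

theorem contDiff_friedrichs : ContDiff ℝ ∞ friedrichs := by
  have h : friedrichs = fun x => (∫ t, friedrichsBump t)⁻¹ * expNegInvGlue (1 - 4 * x ^ 2) := by
    funext x; rw [friedrichs, friedrichsBump_eq]
  rw [h]
  exact contDiff_const.mul (expNegInvGlue.contDiff.comp (by fun_prop))

theorem isSmoothCompact_scaledMollifier {d : ℕ} {σ : ℝ} (hσ : 0 < σ) :
    IsSmoothCompact (scaledMollifier (d := d) σ) := by
  constructor
  · unfold scaledMollifier mollifier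
    refine contDiff_const.mul (contDiff_prod fun j _ => contDiff_friedrichs.comp ?_)
    have : ContDiff ℝ ∞ (fun x : Space d => σ⁻¹ * x j) := by fun_prop
    simpa using this
  · refine HasCompactSupport.of_support_subset_isCompact
      (K := WithLp.toLp 2 '' Set.univ.pi fun _ : Fin d => Set.Icc (-σ) σ) ?_ ?_
    · exact (isCompact_univ_pi fun _ => isCompact_Icc).image (PiLp.continuous_toLp 2 _)
    · intro x hx
      refine ⟨x.ofLp, fun j _ => ?_, rfl⟩
      have hj : friedrichs ((σ⁻¹ • x) j) ≠ 0 := by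
        intro h0
        refine hx ?_
        unfold scaledMollifier mollifier
        rw [Finset.prod_eq_zero (Finset.mem_univ j) h0, mul_zero]
      have hlt : |σ⁻¹ * x j| < 1 / 2 := by
        by_contra! hge
        refine hj ?_
        rw [friedrichs, friedrichsBump, if_pos (by simpa using hge), mul_zero]
      rw [abs_mul, abs_of_pos (inv_pos.2 hσ), inv_mul_lt_iff₀ hσ] at hlt
      exact abs_le.1 (by linarith)

theorem isSmoothCompact_pou {d : ℕ} {σ : ℝ} (hσ : 0 < σ) (i : Fin d → ℤ) :
    IsSmoothCompact (pou σ i) := by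
  have hms : MeasurableSet (patchCore (d := d) σ i) := by
    unfold patchCore
    measurability
  have hK : IsCompact (WithLp.toLp 2 '' Set.univ.pi fun j : Fin d =>
      Set.Icc (((i j : ℝ) - 1 / 2) * σ) (((i j : ℝ) + 1 / 2) * σ) : Set (Space d)) :=
    (isCompact_univ_pi fun _ => isCompact_Icc).image (PiLp.continuous_toLp 2 _)
  have hsub : patchCore (d := d) σ i ⊆ WithLp.toLp 2 '' Set.univ.pi fun j : Fin d =>
      Set.Icc (((i j : ℝ) - 1 / 2) * σ) (((i j : ℝ) + 1 / 2) * σ) :=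
    fun x hx => ⟨x.ofLp, fun j _ => ⟨(hx j).1.le, (hx j).2.le⟩, rfl⟩
  have hconv : pou σ i = MeasureTheory.convolution
      ((patchCore (d := d) σ i).indicator fun _ => (1 : ℝ)) (scaledMollifier σ)
      (ContinuousLinearMap.mul ℝ ℝ) volume := by
    funext x
    rw [pou, ← integral_indicator hms]
    unfold MeasureTheory.convolution
    refine integral_congr_ae (Filter.Eventually.of_forall fun y => ?_)
    by_cases hy : y ∈ patchCore σ i <;> simp [hy]
  have hm := isSmoothCompact_scaledMollifier (d := d) hσ
  rw [hconv]
  constructor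
  · refine hm.2.contDiff_convolution_right _ ?_ hm.1
    refine Integrable.locallyIntegrable ?_
    rw [integrable_indicator_iff hms]
    have hfin : volume (patchCore (d := d) σ i) ≠ ⊤ :=
      ne_top_of_le_ne_top hK.measure_lt_top.ne (measure_mono hsub)
    exact integrableOn_const hfin
  · have hcs : HasCompactSupport ((patchCore (d := d) σ i).indicator fun _ => (1 : ℝ)) :=
      HasCompactSupport.of_support_subset_isCompact hK
        (Set.support_indicator_subset.trans hsub)
    exact HasCompactSupport.convolution (L := ContinuousLinearMap.mul ℝ ℝ) hcs hm.2

theorem contDiff_of_mem_polySpace {d P : ℕ} {v : Space d → ℝ} (hv : v ∈ polySpace d P) :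
    ContDiff ℝ ∞ v := by
  unfold polySpace at hv
  induction hv using Submodule.span_induction with
  | mem f hf => obtain ⟨α, _, rfl⟩ := hf; fun_prop
  | zero => exact contDiff_const
  | add f g _ _ hf hg => exact hf.add hg
  | smul c f _ hf => exact contDiff_const.smul hf

theorem isSmoothCompact_of_mem_pufem {d P : ℕ} {σ : ℝ} (hσ : 0 < σ) {v : Space d → ℝ}
    (hv : v ∈ pufem d P σ) : IsSmoothCompact v := by
  unfold pufem at hv
  induction hv using Submodule.span_induction with
  | mem f hf =>
    obtain ⟨i, p, hp, rfl⟩ := hf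
    exact ⟨(isSmoothCompact_pou hσ i).1.mul (contDiff_of_mem_polySpace hp),
      (isSmoothCompact_pou hσ i).2.mul_right⟩
  | zero => exact ⟨contDiff_const, HasCompactSupport.zero⟩
  | add f g _ _ hf hg => exact ⟨hf.1.add hg.1, hf.2.add hg.2⟩
  | smul c f _ hf => exact ⟨contDiff_const.smul hf.1, hf.2.smul_left (f := fun _ => c)⟩

/-- The restriction to `Ω` of a finite element function, as an element of `W^{k,2}(Ω)`. -/
noncomputable def pufemToSobolev {d P : ℕ} {σ : ℝ} (hσ : 0 < σ) (k : ℕ) (Ω : Set (Space d))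
    (v : pufem d P σ) : sobolev k Ω :=
  smoothToSobolev k Ω (isSmoothCompact_of_mem_pufem hσ v.2)

/-! ### Elements, the fictitious domain and the stabilized bilinear form -/

/-- The element `Q_i` of the Cartesian grid: the open cube `∏_j (i_j σ, (i_j + 1) σ)`. -/
def element {d : ℕ} (σ : ℝ) (i : Fin d → ℤ) : Set (Space d) :=
  {x | ∀ j, (i j : ℝ) * σ < x j ∧ x j < ((i j : ℝ) + 1) * σ}

/-- The indices of the elements that intersect `Ω` in a set of positive measure. -/
def activeElements {d : ℕ} (σ : ℝ) (Ω : Set (Space d)) : Set (Fin d → ℤ) :=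
  {i | 0 < volume (element σ i ∩ Ω)}

/-- The fictitious domain `Ω_σ`. An element is contained in it precisely if it is active. -/
def fictitiousDomain {d : ℕ} (σ : ℝ) (Ω : Set (Space d)) : Set (Space d) :=
  interior (⋃ i ∈ activeElements σ Ω, closure (element σ i))

/-- The indices of the cut elements, which make up `Ω_σ^Γ`. -/
def cutElements {d : ℕ} (σ : ℝ) (Ω : Set (Space d)) : Set (Fin d → ℤ) :=
  {i | i ∈ activeElements σ Ω ∧ ¬ element σ i ⊆ Ω}

/-- The indices of the uncut elements, which make up `Ω_σ^∘`. -/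
def uncutElements {d : ℕ} (σ : ℝ) (Ω : Set (Space d)) : Set (Fin d → ℤ) :=
  {i | i ∈ activeElements σ Ω ∧ element σ i ⊆ Ω}

/-- The grid point with index `n` is a node (a corner) of the element `Q_i`. -/
def IsNode {d : ℕ} (n i : Fin d → ℤ) : Prop := ∀ j, n j = i j ∨ n j = i j + 1

/-- Two elements are neighbours if they share at least one grid point. -/
def Neighbors {d : ℕ} (i i' : Fin d → ℤ) : Prop := ∃ n, IsNode n i ∧ IsNode n i'

/-- From every cut element one reaches a neighbour of an uncut element through a sequence of at
most `K` successively neighbouring cut elements (`q 0, …, q L` with `L + 1 ≤ K`). -/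
def ReachableFromUncut {d : ℕ} (σ : ℝ) (Ω : Set (Space d)) (K : ℕ) : Prop :=
  ∀ i ∈ cutElements σ Ω, ∃ (L : ℕ) (q : ℕ → Fin d → ℤ), L + 1 ≤ K ∧ q 0 = i ∧
    (∀ l ≤ L, q l ∈ cutElements σ Ω) ∧ (∀ l < L, Neighbors (q l) (q (l + 1))) ∧
    ∃ i' ∈ uncutElements σ Ω, Neighbors (q L) i'

/-- The stabilization form `j`, for smooth compactly supported functions (for which only finitely
many summands are nonzero). -/
noncomputable def stab {d : ℕ} (P : ℕ) (σ : ℝ) (Ω : Set (Space d)) (u v : Space d → ℝ) : ℝ :=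
  σ ^ (2 * (P + 1)) * ∑' i : cutElements σ Ω, ∑ α ∈ multiIndicesEq d (P + 1),
    ∫ x in element σ i.1, multiDeriv α u x * multiDeriv α v x

/-- The stabilized bilinear form `A(u, v) = ∫_Ω u v + ε j(u, v)`. -/
noncomputable def bilinA {d : ℕ} (P : ℕ) (σ ε : ℝ) (Ω : Set (Space d)) (u v : Space d → ℝ) : ℝ :=
  (∫ x in Ω, u x * v x) + ε * stab P σ Ω u v

/-- `w` solves the regularization problem with data `uh ∈ W^{-(P+1),2}(Ω)`:
`A(w, v) = ⟨uh, v⟩` for all finite element functions `v`. -/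
def IsSmoothed {d P : ℕ} {σ : ℝ} (hσ : 0 < σ) (ε : ℝ) {Ω : Set (Space d)}
    (uh : NegSobolev (P + 1) Ω) (w : pufem d P σ) : Prop :=
  ∀ v : pufem d P σ, bilinA P σ ε Ω w v = uh (pufemToSobolev hσ (P + 1) Ω v)

end SmoothPUFEM

open SmoothPUFEM

namespace SmoothPUFEM

variable {d : ℕ}

/-! Put `t = σ ^ (P + 1)`, so that `h ^ (P + 1) = t ^ 2`, and let `a(v) ^ 2 = A(v, v)`. Two facts
carry the error estimate, with constants independent of `σ` and of the shape of `Ω`.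

(1) Stability (`norm_sq_pufemToSobolev_le`): `t * ‖v‖ ≤ c * a(v)` for finite element functions `v`,
with the `W^{P+1,2}(Ω)` norm on the left. (2) Approximation (`exists_pufem_approx`): every Sobolev
function `φ` has a finite element approximation `q` with `L²` error `O(t‖φ‖)`, Sobolev norm `O(‖φ‖)`
and stabilization seminorm `O(t‖φ‖)`.

The rest is a duality argument in Hilbert space (`abstract_error_estimate`). The data error is of
size `t ^ 2` in the negative norm; testing it with the difference between the solution and an
approximation of `u` costs one factor `t` by (1), so the energy of this difference is `O(t‖u‖)`. For
arbitrary `φ` with approximation `q`, the product `(u_σ - u, φ)` splits into `-(u_σ - u, q - φ)`,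
the data error at `q`, and `-ε j(u_σ, q)`. Each is `O(t ^ 2 ‖u‖ ‖φ‖)`: two are products of two
quantities of order `t`, and for the data error the Sobolev bound on `q` in (2) loses nothing.

For (1), the part of a cut element inside `Ω` may be too thin to control `v`. Control is carried
over from a neighbour instead: if `v` vanishes on the neighbour and its derivatives of order `P + 1`
vanish on the element, Taylor expansion at a common corner gives `v = 0` there. Finite
dimensionality and scaling turn this into `ghost_estimate`; chains of length at most `K` then reach
an uncut element (`activeUnion_estimate`), and an inverse inequality finishes.

For (2), `u` is extended to the whole space, replaced by a smooth compactly supported function, and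
approximated by averaged Taylor-type local polynomials glued with the partition of unity
(`quasi_interpolation`).

Uniqueness follows because zero energy forces `v = 0` on every active element. For bounded `Ω` only
finitely many basis functions matter, and existence is the Riesz theorem in finite dimensions. -/

/-! ### Partial derivatives along words -/

/-- The iterated partial derivative along a word of coordinate directions. -/
noncomputable def wordDeriv (l : List (Fin d)) (f : Space d → ℝ) : Space d → ℝ :=
  l.foldr partialDeriv f

/-- The word in which the letter `j` occurs `α j` times. -/
def idxWord (α : Fin d → ℕ) : List (Fin d) :=
  (List.finRange d).flatMap fun j => List.replicate (α j) j

theorem wordDeriv_append (l l' : List (Fin d)) (f : Space d → ℝ) :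
    wordDeriv (l ++ l') f = wordDeriv l (wordDeriv l' f) := by
  simp [wordDeriv]

theorem wordDeriv_replicate (n : ℕ) (j : Fin d) (f : Space d → ℝ) :
    wordDeriv (List.replicate n j) f = (partialDeriv j)^[n] f := by
  induction n with
  | zero => rfl
  | succ n ih =>
    rw [Function.iterate_succ_apply', ← ih]; rfl

theorem multiDeriv_eq_wordDeriv (α : Fin d → ℕ) (f : Space d → ℝ) :
    multiDeriv α f = wordDeriv (idxWord α) f := by
  unfold multiDeriv idxWord
  induction List.finRange d with
  | nil => rfl
  | cons j l ih =>
    rw [List.foldr_cons, List.flatMap_cons, wordDeriv_append, wordDeriv_replicate, ih]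

theorem length_idxWord (α : Fin d → ℕ) : (idxWord α).length = ∑ j, α j := by
  rw [idxWord, List.length_flatMap]
  simp [← List.ofFn_eq_map, List.sum_ofFn]

theorem count_idxWord (α : Fin d → ℕ) (j : Fin d) : (idxWord α).count j = α j := by
  rw [idxWord, List.count_flatMap]
  have : ((List.finRange d).map (List.count j ∘ fun j => List.replicate (α j) j)).sum
      = ∑ i, if i = j then α i else 0 := by
    rw [← List.sum_ofFn, List.ofFn_eq_map]
    congr 1
    refine List.map_congr_left fun i _ => ?_
    simp [List.count_replicate]
  rw [this]; simp

theorem contDiff_wordDeriv {f : Space d → ℝ} (hf : ContDiff ℝ ∞ f) (l : List (Fin d)) :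
    ContDiff ℝ ∞ (wordDeriv l f) := by
  induction l with
  | nil => exact hf
  | cons j l ih => exact contDiff_partialDeriv ih j

theorem contDiff_multiDeriv {f : Space d → ℝ} (hf : ContDiff ℝ ∞ f) (α : Fin d → ℕ) :
    ContDiff ℝ ∞ (multiDeriv α f) := by
  rw [multiDeriv_eq_wordDeriv]; exact contDiff_wordDeriv hf _

/-- Adjacent transpositions generate all permutations, and each of them is the symmetry of second
derivatives. Words allow inductions that add one derivative at a time; this lemma leads back to
multi-indices. -/
theorem wordDeriv_perm {f : Space d → ℝ} (hf : ContDiff ℝ ∞ f) {l l' : List (Fin d)}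
    (h : l.Perm l') : wordDeriv l f = wordDeriv l' f := by
  induction h with
  | nil => rfl
  | cons j _ ih => exact congrArg (partialDeriv j) ih
  | swap i j l => exact partialDeriv_comm (contDiff_wordDeriv hf l) j i
  | trans _ _ h₁ h₂ => exact h₁.trans h₂

theorem wordDeriv_eq_multiDeriv {f : Space d → ℝ} (hf : ContDiff ℝ ∞ f) (l : List (Fin d)) :
    wordDeriv l f = multiDeriv (fun j => l.count j) f := by
  rw [multiDeriv_eq_wordDeriv]
  refine wordDeriv_perm hf (List.perm_iff_count.2 fun j => ?_)
  rw [count_idxWord]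

theorem mem_multiIndicesEq {k : ℕ} {α : Fin d → ℕ} :
    α ∈ multiIndicesEq d k ↔ ∑ j, α j = k := by
  simp [multiIndicesEq]

theorem count_mem_multiIndicesEq (l : List (Fin d)) :
    (fun j => l.count j) ∈ multiIndicesEq d l.length := by
  rw [mem_multiIndicesEq]
  induction l with
  | nil => simp
  | cons i l ih => simp [List.count_cons, Finset.sum_add_distrib, ih]

theorem partialDeriv_add {f g : Space d → ℝ} (hf : ContDiff ℝ ∞ f) (hg : ContDiff ℝ ∞ g)
    (j : Fin d) : partialDeriv j (f + g) = partialDeriv j f + partialDeriv j g := by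
  funext x
  simp only [partialDeriv, Pi.add_apply]
  rw [fderiv_add (hf.differentiable (by simp) x) (hg.differentiable (by simp) x)]
  rfl

theorem partialDeriv_const_smul {f : Space d → ℝ} (hf : ContDiff ℝ ∞ f) (c : ℝ)
    (j : Fin d) : partialDeriv j (c • f) = c • partialDeriv j f := by
  funext x
  simp only [partialDeriv, Pi.smul_apply]
  rw [fderiv_const_smul (hf.differentiable (by simp) x)]
  rfl

theorem wordDeriv_add {f g : Space d → ℝ} (hf : ContDiff ℝ ∞ f) (hg : ContDiff ℝ ∞ g)
    (l : List (Fin d)) : wordDeriv l (f + g) = wordDeriv l f + wordDeriv l g := by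
  induction l with
  | nil => rfl
  | cons j l ih =>
    change partialDeriv j (wordDeriv l _) = _
    rw [ih, partialDeriv_add (contDiff_wordDeriv hf l) (contDiff_wordDeriv hg l)]; rfl

theorem wordDeriv_const_smul {f : Space d → ℝ} (hf : ContDiff ℝ ∞ f) (c : ℝ)
    (l : List (Fin d)) : wordDeriv l (c • f) = c • wordDeriv l f := by
  induction l with
  | nil => rfl
  | cons j l ih =>
    change partialDeriv j (wordDeriv l _) = _
    rw [ih, partialDeriv_const_smul (contDiff_wordDeriv hf l)]; rfl

theorem multiDeriv_add {f g : Space d → ℝ} (hf : ContDiff ℝ ∞ f) (hg : ContDiff ℝ ∞ g)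
    (α : Fin d → ℕ) : multiDeriv α (f + g) = multiDeriv α f + multiDeriv α g := by
  simp only [multiDeriv_eq_wordDeriv, wordDeriv_add hf hg]

theorem multiDeriv_const_smul {f : Space d → ℝ} (hf : ContDiff ℝ ∞ f) (c : ℝ)
    (α : Fin d → ℕ) : multiDeriv α (c • f) = c • multiDeriv α f := by
  simp only [multiDeriv_eq_wordDeriv, wordDeriv_const_smul hf]

theorem multiDeriv_sub {f g : Space d → ℝ} (hf : ContDiff ℝ ∞ f) (hg : ContDiff ℝ ∞ g)
    (α : Fin d → ℕ) : multiDeriv α (f - g) = multiDeriv α f - multiDeriv α g := by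
  have : f - g = f + (-1 : ℝ) • g := by funext x; simp [sub_eq_add_neg]
  rw [this, multiDeriv_add (g := (-1 : ℝ) • g) hf (hg.const_smul (-1 : ℝ)), multiDeriv_const_smul hg]
  funext x; simp [sub_eq_add_neg]

theorem multiDeriv_zero (f : Space d → ℝ) : multiDeriv 0 f = f := by
  rw [multiDeriv_eq_wordDeriv]
  have : idxWord (0 : Fin d → ℕ) = [] := by
    rw [← List.length_eq_zero_iff, length_idxWord]; simp
  rw [this]; rfl

theorem wordDeriv_congr_of_isOpen {f g : Space d → ℝ} {U : Set (Space d)} (hU : IsOpen U)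
    (h : Set.EqOn f g U) (l : List (Fin d)) : Set.EqOn (wordDeriv l f) (wordDeriv l g) U := by
  induction l with
  | nil => exact h
  | cons j l ih =>
    intro x hx
    change fderiv ℝ (wordDeriv l f) x _ = fderiv ℝ (wordDeriv l g) x _
    rw [(ih.eventuallyEq_of_mem (hU.mem_nhds hx)).fderiv_eq]

theorem multiDeriv_congr_of_isOpen {f g : Space d → ℝ} {U : Set (Space d)} (hU : IsOpen U)
    (h : Set.EqOn f g U) (α : Fin d → ℕ) : Set.EqOn (multiDeriv α f) (multiDeriv α g) U := by
  simp only [multiDeriv_eq_wordDeriv]; exact wordDeriv_congr_of_isOpen hU h _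

theorem multiDeriv_zero_fun (α : Fin d → ℕ) : multiDeriv α (0 : Space d → ℝ) = 0 := by
  have := multiDeriv_const_smul (contDiff_const (c := (0 : ℝ)) : ContDiff ℝ ∞ (0 : Space d → ℝ)) 0 α
  simpa using this

theorem partialDeriv_comp_affine {f : Space d → ℝ} (hf : ContDiff ℝ ∞ f) (σ : ℝ) (c : Space d)
    (j : Fin d) : partialDeriv j (fun y => f (σ • (y + c))) =
      fun y => σ * partialDeriv j f (σ • (y + c)) := by
  funext y
  have h1 : HasFDerivAt (fun y : Space d => σ • (y + c))
      (σ • ContinuousLinearMap.id ℝ (Space d)) y :=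
    ((hasFDerivAt_id y).add_const c).const_smul σ
  have h2 := (hf.differentiable (by simp) (σ • (y + c))).hasFDerivAt.comp y h1
  simp only [partialDeriv]
  rw [show (fun y => f (σ • (y + c))) = f ∘ (fun y : Space d => σ • (y + c)) from rfl, h2.fderiv]
  simp

theorem wordDeriv_comp_affine {f : Space d → ℝ} (hf : ContDiff ℝ ∞ f) (σ : ℝ) (c : Space d)
    (l : List (Fin d)) : wordDeriv l (fun y => f (σ • (y + c))) =
      fun y => σ ^ l.length * wordDeriv l f (σ • (y + c)) := by
  induction l with
  | nil => simp [wordDeriv]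
  | cons j l ih =>
    change partialDeriv j (wordDeriv l _) = _
    rw [ih]
    have hs : ContDiff ℝ ∞ (fun y => wordDeriv l f (σ • (y + c))) :=
      (contDiff_wordDeriv hf l).comp (by fun_prop)
    have := partialDeriv_const_smul hs (σ ^ l.length) j
    rw [partialDeriv_comp_affine (contDiff_wordDeriv hf l)] at this
    refine Eq.trans this ?_
    funext y
    simp only [Pi.smul_apply, smul_eq_mul, List.length_cons, wordDeriv, List.foldr_cons]
    ring

theorem multiDeriv_comp_affine {f : Space d → ℝ} (hf : ContDiff ℝ ∞ f) (σ : ℝ) (c : Space d)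
    (α : Fin d → ℕ) : multiDeriv α (fun y => f (σ • (y + c))) =
      fun y => σ ^ (∑ j, α j) * multiDeriv α f (σ • (y + c)) := by
  simp only [multiDeriv_eq_wordDeriv, wordDeriv_comp_affine hf, length_idxWord]

/-! ### Polynomials -/

theorem polySpace_mono {P P' : ℕ} (h : P ≤ P') : polySpace d P ≤ polySpace d P' := by
  refine Submodule.span_mono ?_
  rintro f ⟨α, hα, rfl⟩
  exact ⟨α, mem_multiIndices.2 ((mem_multiIndices.1 hα).trans h), rfl⟩

theorem const_mem_polySpace (P : ℕ) (c : ℝ) : (fun _ : Space d => c) ∈ polySpace d P := by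
  have : (fun _ : Space d => c) = c • fun x : Space d => ∏ j, x j ^ (0 : Fin d → ℕ) j := by
    funext x; simp
  rw [this]
  exact Submodule.smul_mem _ _ (Submodule.subset_span ⟨0, mem_multiIndices.2 (by simp), rfl⟩)

theorem coord_mem_polySpace (j : Fin d) : (fun x : Space d => x j) ∈ polySpace d 1 := by
  refine Submodule.subset_span ⟨Pi.single j 1, mem_multiIndices.2 (by simp), ?_⟩
  funext x
  rw [Finset.prod_eq_single j] <;> simp +contextual

theorem mul_mem_polySpace {a b : ℕ} {f g : Space d → ℝ} (hf : f ∈ polySpace d a)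
    (hg : g ∈ polySpace d b) : (fun x => f x * g x) ∈ polySpace d (a + b) := by
  unfold polySpace at hf hg
  induction hf, hg using Submodule.span_induction₂ with
  | mem_mem f g hf hg =>
    obtain ⟨α, hα, rfl⟩ := hf
    obtain ⟨β, hβ, rfl⟩ := hg
    refine Submodule.subset_span ⟨α + β, mem_multiIndices.2 ?_, ?_⟩
    · simp only [Pi.add_apply, Finset.sum_add_distrib]
      exact add_le_add (mem_multiIndices.1 hα) (mem_multiIndices.1 hβ)
    · funext x; simp [pow_add, Finset.prod_mul_distrib]
  | zero_left g => simpa using const_mem_polySpace _ 0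
  | zero_right g => simpa using const_mem_polySpace _ 0
  | add_left f f' g _ _ _ h h' =>
    simp only [Pi.add_apply, add_mul]; exact Submodule.add_mem _ h h'
  | add_right f g g' _ _ _ h h' =>
    simp only [Pi.add_apply, mul_add]; exact Submodule.add_mem _ h h'
  | smul_left c f g _ _ h =>
    simp only [Pi.smul_apply, smul_eq_mul, mul_assoc]; exact Submodule.smul_mem _ c h
  | smul_right c f g _ _ h =>
    simp only [Pi.smul_apply, smul_eq_mul, mul_left_comm _ c]; exact Submodule.smul_mem _ c h

theorem prod_mem_polySpace {ι : Type*} (s : Finset ι) {a : ι → ℕ} {f : ι → Space d → ℝ}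
    (hf : ∀ i ∈ s, f i ∈ polySpace d (a i)) :
    (fun x => ∏ i ∈ s, f i x) ∈ polySpace d (∑ i ∈ s, a i) := by
  classical
  induction s using Finset.induction_on with
  | empty => simpa using const_mem_polySpace 0 1
  | insert i s hi ih =>
    simp only [Finset.prod_insert hi, Finset.sum_insert hi]
    exact mul_mem_polySpace (hf i (Finset.mem_insert_self i s))
      (ih fun j hj => hf j (Finset.mem_insert_of_mem hj))

theorem affine_mem_polySpace (j : Fin d) (a b : ℝ) :
    (fun x : Space d => a * x j + b) ∈ polySpace d 1 :=
  Submodule.add_mem _ (Submodule.smul_mem _ a (coord_mem_polySpace j)) (const_mem_polySpace 1 b)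

theorem comp_affine_mem_polySpace {P : ℕ} {f : Space d → ℝ} (hf : f ∈ polySpace d P) (σ : ℝ)
    (c : Space d) : (fun y => f (σ • (y + c))) ∈ polySpace d P := by
  unfold polySpace at hf
  induction hf using Submodule.span_induction with
  | mem f hf =>
    obtain ⟨α, hα, rfl⟩ := hf
    refine polySpace_mono (mem_multiIndices.1 hα) (prod_mem_polySpace _ fun j _ => ?_)
    have := prod_mem_polySpace (Finset.range (α j)) (a := fun _ => 1)
      (fun i _ => affine_mem_polySpace j σ (σ * c j))
    simpa [mul_add] using this
  | zero => exact const_mem_polySpace _ 0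
  | add f g _ _ hf hg => exact Submodule.add_mem _ hf hg
  | smul a f _ hf => exact Submodule.smul_mem _ a hf

theorem hasDerivAt_along {f : Space d → ℝ} (hf : Differentiable ℝ f) (x v : Space d) (t : ℝ) :
    HasDerivAt (fun s : ℝ => f (x + s • v)) (fderiv ℝ f (x + t • v) v) t := by
  have h1 : HasDerivAt (fun s : ℝ => x + s • v) v t := by
    simpa using ((hasDerivAt_id t).smul_const v).const_add x
  exact (hf (x + t • v)).hasFDerivAt.comp_hasDerivAt t h1

/-- The subtraction of exponents is truncated. For `α j = 0` the monomial on the right is the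
original one, but its coefficient is zero. -/
theorem partialDeriv_monomial (α : Fin d → ℕ) (j : Fin d) :
    partialDeriv j (fun x : Space d => ∏ i, x i ^ α i) =
      fun x => (α j : ℝ) * ∏ i, x i ^ (α - Pi.single j 1 : Fin d → ℕ) i := by
  funext x
  have hd : Differentiable ℝ (fun x : Space d => ∏ i, x i ^ α i) := by fun_prop
  have h1 := hasDerivAt_along hd x (EuclideanSpace.single j 1) 0
  have h2 : HasDerivAt (fun s : ℝ => ∏ i, (x + s • EuclideanSpace.single j (1 : ℝ)) i ^ α i)
      ((α j : ℝ) * ∏ i, x i ^ (α - Pi.single j 1 : Fin d → ℕ) i) 0 := by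
    have e : (fun s : ℝ => ∏ i, (x + s • EuclideanSpace.single j (1 : ℝ)) i ^ α i) =
        fun s : ℝ => (x j + s) ^ α j * ∏ i ∈ Finset.univ.erase j, x i ^ α i := by
      funext s
      rw [← Finset.mul_prod_erase _ _ (Finset.mem_univ j)]
      congr 1
      · simp
      · refine Finset.prod_congr rfl fun i hi => ?_
        simp [(Finset.mem_erase.1 hi).1]
    rw [e, ← Finset.mul_prod_erase _ _ (Finset.mem_univ j)]
    have e2 : ∏ i ∈ Finset.univ.erase j, x i ^ (α - Pi.single j 1 : Fin d → ℕ) i =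
        ∏ i ∈ Finset.univ.erase j, x i ^ α i := by
      refine Finset.prod_congr rfl fun i hi => ?_
      simp [(Finset.mem_erase.1 hi).1]
    rw [e2, ← mul_assoc]
    have h3 := (((hasDerivAt_id (0 : ℝ)).const_add (x j)).pow (α j)).mul_const
      (∏ i ∈ Finset.univ.erase j, x i ^ α i)
    simpa using h3
  have := h1.unique h2
  simpa [partialDeriv] using this

/-- Polynomials of degree less than `k`. -/
def polyLT (d k : ℕ) : Submodule ℝ (Space d → ℝ) :=
  Submodule.span ℝ {f | ∃ α : Fin d → ℕ, ∑ j, α j < k ∧ f = fun x => ∏ j, x j ^ α j}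

/-- The strict bound makes room for `polyLT d 0 = ⊥`. Thus "derivatives of order `k` kill degree
less than `k`" and approximation to order `k` hold from `k = 0` on. -/
theorem polyLT_succ (k : ℕ) : polyLT d (k + 1) = polySpace d k := by
  simp [polyLT, polySpace, mem_multiIndices]

theorem polyLT_zero : polyLT d 0 = ⊥ := by
  simp [polyLT]

theorem polyLT_mono {k k' : ℕ} (h : k ≤ k') : polyLT d k ≤ polyLT d k' := by
  refine Submodule.span_mono ?_
  rintro f ⟨α, hα, rfl⟩
  exact ⟨α, hα.trans_le h, rfl⟩

theorem contDiff_of_mem_polyLT {k : ℕ} {f : Space d → ℝ} (hf : f ∈ polyLT d k) :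
    ContDiff ℝ ∞ f := by
  have := polyLT_mono (Nat.le_succ k) hf
  rw [polyLT_succ] at this
  exact contDiff_of_mem_polySpace this

theorem partialDeriv_mem_polyLT {k : ℕ} {f : Space d → ℝ} (hf : f ∈ polyLT d (k + 1))
    (j : Fin d) : partialDeriv j f ∈ polyLT d k := by
  unfold polyLT at hf
  induction hf using Submodule.span_induction with
  | mem f hf =>
    obtain ⟨α, hα, rfl⟩ := hf
    rw [partialDeriv_monomial]
    rcases Nat.eq_zero_or_pos (α j) with h0 | h0
    · simp only [h0, Nat.cast_zero, zero_mul]; exact (polyLT d k).zero_mem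
    · refine Submodule.smul_mem _ (α j : ℝ) (Submodule.subset_span ⟨_, ?_, rfl⟩)
      have : ∑ i, (α - Pi.single j 1 : Fin d → ℕ) i < ∑ i, α i := by
        refine Finset.sum_lt_sum (fun i _ => Nat.sub_le _ _) ⟨j, Finset.mem_univ j, ?_⟩
        simp; omega
      omega
  | zero =>
    have : partialDeriv j (0 : Space d → ℝ) = 0 := by
      funext x; simp [partialDeriv]
    rw [this]; exact Submodule.zero_mem _
  | add f g hf hg ihf ihg =>
    rw [partialDeriv_add (contDiff_of_mem_polyLT hf) (contDiff_of_mem_polyLT hg)]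
    exact Submodule.add_mem _ ihf ihg
  | smul c f hf ih =>
    rw [partialDeriv_const_smul (contDiff_of_mem_polyLT hf)]
    exact Submodule.smul_mem _ c ih

theorem wordDeriv_mem_polyLT {k : ℕ} {f : Space d → ℝ} (l : List (Fin d))
    (hf : f ∈ polyLT d (k + l.length)) : wordDeriv l f ∈ polyLT d k := by
  induction l generalizing k with
  | nil => exact hf
  | cons j l ih =>
    exact partialDeriv_mem_polyLT (ih (by simpa [add_assoc, add_comm, add_left_comm] using hf)) j

theorem multiDeriv_of_mem_polyLT {k : ℕ} {f : Space d → ℝ} (hf : f ∈ polyLT d k)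
    {α : Fin d → ℕ} (hα : ∑ j, α j = k) : multiDeriv α f = 0 := by
  have : wordDeriv (idxWord α) f ∈ polyLT d 0 :=
    wordDeriv_mem_polyLT _ (by rw [length_idxWord, hα, zero_add]; exact hf)
  rwa [polyLT_zero, Submodule.mem_bot, ← multiDeriv_eq_wordDeriv] at this

end SmoothPUFEM

/-! ### Taylor expansion and polynomial approximation on convex sets. -/

namespace SmoothPUFEM

variable {d : ℕ}

/-! ### Directional derivatives and Taylor polynomials -/

/-- The `n`-th derivative of `f` at `x` in the direction `v`. -/
noncomputable def dirDeriv (n : ℕ) (v : Space d) (f : Space d → ℝ) (x : Space d) : ℝ :=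
  ∑ w : Fin n → Fin d, (∏ i, v (w i)) * wordDeriv (List.ofFn w) f x

theorem dirDeriv_zero (v : Space d) (f : Space d → ℝ) (x : Space d) : dirDeriv 0 v f x = f x := by
  simp [dirDeriv, wordDeriv]

theorem fderiv_eq_sum_partialDeriv (f : Space d → ℝ) (x v : Space d) :
    fderiv ℝ f x v = ∑ j, v j * partialDeriv j f x := by
  have hv : v = ∑ j, v j • EuclideanSpace.single j (1 : ℝ) := by
    ext i
    simp [Pi.single_apply]
  conv_lhs => rw [hv]
  simp [partialDeriv]

/-- Differentiating in the direction `v` prepends one letter to every word, and a word of length `n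
+ 1` is a first letter together with a word of length `n`. -/
theorem hasDerivAt_dirDeriv {f : Space d → ℝ} (hf : ContDiff ℝ ∞ f) (n : ℕ) (y v : Space d)
    (t : ℝ) : HasDerivAt (fun s : ℝ => dirDeriv n v f (y + s • v))
      (dirDeriv (n + 1) v f (y + t • v)) t := by
  have h : HasDerivAt (fun s : ℝ => dirDeriv n v f (y + s • v))
      (∑ w : Fin n → Fin d, (∏ i, v (w i)) *
        fderiv ℝ (wordDeriv (List.ofFn w) f) (y + t • v) v) t := by
    unfold dirDeriv
    refine HasDerivAt.fun_sum fun w _ => ?_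
    exact (hasDerivAt_along ((contDiff_wordDeriv hf _).differentiable (by simp)) y v t).const_mul _
  convert h using 1
  unfold dirDeriv
  rw [← (Fin.consEquiv fun _ => Fin d).sum_comp, Fintype.sum_prod_type_right]
  refine Finset.sum_congr rfl fun w _ => ?_
  rw [fderiv_eq_sum_partialDeriv, Finset.mul_sum]
  refine Finset.sum_congr rfl fun j _ => ?_
  simp only [Fin.consEquiv_apply, Fin.prod_univ_succ, Fin.cons_zero, Fin.cons_succ,
    List.ofFn_succ]
  change _ * partialDeriv j (wordDeriv (List.ofFn w) f) _ = _
  ring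

/-- The sum of the squares of the derivatives of order `k`. -/
noncomputable def gradSq (k : ℕ) (f : Space d → ℝ) (x : Space d) : ℝ :=
  ∑ α ∈ multiIndicesEq d k, multiDeriv α f x ^ 2

theorem gradSq_nonneg (k : ℕ) (f : Space d → ℝ) (x : Space d) : 0 ≤ gradSq k f x :=
  Finset.sum_nonneg fun _ _ => sq_nonneg _

theorem continuous_gradSq {f : Space d → ℝ} (hf : ContDiff ℝ ∞ f) (k : ℕ) :
    Continuous (gradSq k f) :=
  continuous_finsetSum _ fun α _ => (contDiff_multiDeriv hf α).continuous.pow 2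

theorem sq_wordDeriv_le_gradSq {f : Space d → ℝ} (hf : ContDiff ℝ ∞ f) (l : List (Fin d))
    (x : Space d) : wordDeriv l f x ^ 2 ≤ gradSq l.length f x := by
  rw [wordDeriv_eq_multiDeriv hf]
  exact Finset.single_le_sum (f := fun α => multiDeriv α f x ^ 2) (fun _ _ => sq_nonneg _)
    (count_mem_multiIndicesEq l)

/-- There are `d ^ k` words: one factor `d ^ k` comes from Cauchy–Schwarz, the other from bounding
every summand by the same quantity. -/
theorem sq_dirDeriv_le {f : Space d → ℝ} (hf : ContDiff ℝ ∞ f) (k : ℕ) {v : Space d} {s : ℝ}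
    (hv : ∀ j, |v j| ≤ s) (x : Space d) :
    dirDeriv k v f x ^ 2 ≤ ((d : ℝ) ^ k) ^ 2 * s ^ (2 * k) * gradSq k f x := by
  have hcard : ((Finset.univ : Finset (Fin k → Fin d)).card : ℝ) = (d : ℝ) ^ k := by
    simp
  have hterm : ∀ w : Fin k → Fin d,
      ((∏ i, v (w i)) * wordDeriv (List.ofFn w) f x) ^ 2 ≤ s ^ (2 * k) * gradSq k f x := by
    intro w
    rw [mul_pow]
    have h1 : (∏ i, v (w i)) ^ 2 ≤ s ^ (2 * k) := by
      have : |∏ i, v (w i)| ≤ s ^ k := by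
        rw [Finset.abs_prod]
        calc ∏ i, |v (w i)| ≤ ∏ _i : Fin k, s :=
              Finset.prod_le_prod (fun _ _ => abs_nonneg _) fun i _ => hv _
          _ = s ^ k := by simp
      calc (∏ i, v (w i)) ^ 2 = |∏ i, v (w i)| ^ 2 := (sq_abs _).symm
        _ ≤ (s ^ k) ^ 2 := pow_le_pow_left₀ (abs_nonneg _) this 2
        _ = s ^ (2 * k) := by ring
    have h2 := sq_wordDeriv_le_gradSq hf (List.ofFn w) x
    rw [List.length_ofFn] at h2
    exact mul_le_mul h1 h2 (sq_nonneg _) ((sq_nonneg _).trans h1)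
  calc dirDeriv k v f x ^ 2
      ≤ (Finset.univ : Finset (Fin k → Fin d)).card *
        ∑ w : Fin k → Fin d, ((∏ i, v (w i)) * wordDeriv (List.ofFn w) f x) ^ 2 :=
        sq_sum_le_card_mul_sum_sq
    _ ≤ (d : ℝ) ^ k * ∑ _w : Fin k → Fin d, s ^ (2 * k) * gradSq k f x := by
        rw [hcard]
        gcongr with w
        exact hterm w
    _ = _ := by
        rw [Finset.sum_const, nsmul_eq_mul, hcard]; ring

theorem taylor_remainder {g : ℕ → ℝ → ℝ} (hg : ∀ n t, HasDerivAt (g n) (g (n + 1) t) t) (k : ℕ) :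
    g 0 1 - ∑ n ∈ Finset.range (k + 1), g n 0 / n.factorial =
      ∫ t in (0 : ℝ)..1, (1 - t) ^ k / k.factorial * g (k + 1) t := by
  -- By the product rule the derivative of this sum telescopes to its last term. Its value at `1` is
  -- `g 0 1`, its value at `0` the Taylor sum.
  have hψ : ∀ k t, HasDerivAt
      (fun t => ∑ n ∈ Finset.range (k + 1), (1 - t) ^ n / n.factorial * g n t)
      ((1 - t) ^ k / k.factorial * g (k + 1) t) t := by
    intro k t
    induction k with
    | zero => simpa using hg 0 t
    | succ k ih =>
      simp only [Finset.sum_range_succ _ (k + 1)]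
      have h1 : HasDerivAt (fun t : ℝ => (1 - t) ^ (k + 1) / ((k + 1).factorial : ℝ))
          (-((1 - t) ^ k / k.factorial)) t := by
        have h0 := ((((hasDerivAt_id t).const_sub 1).pow (k + 1)).div_const
          ((k + 1).factorial : ℝ))
        refine h0.congr_deriv ?_
        rw [Nat.factorial_succ]
        push_cast
        have : (k.factorial : ℝ) ≠ 0 := by positivity
        have : ((k : ℝ) + 1) ≠ 0 := by positivity
        simp
        field_simp
      have h2 := ih.add (h1.mul (hg (k + 1) t))
      refine h2.congr_deriv ?_
      ring
  have hc : ∀ n, Continuous (g n) := fun n =>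
    continuous_iff_continuousAt.2 fun t => (hg n t).continuousAt
  rw [intervalIntegral.integral_eq_sub_of_hasDerivAt (fun t _ => hψ k t)
    (by
      have := hc (k + 1)
      exact Continuous.intervalIntegrable (by fun_prop) _ _)]
  congr 1
  · rw [Finset.sum_eq_single 0]
    · simp
    · intro n _ hn; simp [hn]
    · simp
  · refine Finset.sum_congr rfl fun n _ => ?_
    simp; ring

/-- The Taylor polynomial of degree less than `k` of `f` at `y`. -/
noncomputable def taylorPoly (k : ℕ) (f : Space d → ℝ) (y x : Space d) : ℝ :=
  ∑ n ∈ Finset.range k, dirDeriv n (x - y) f y / n.factorial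

theorem taylorPoly_mem_polyLT (k : ℕ) (f : Space d → ℝ) (y : Space d) :
    taylorPoly k f y ∈ polyLT d k := by
  have : taylorPoly k f y = ∑ n ∈ Finset.range k, ∑ w : Fin n → Fin d,
      (wordDeriv (List.ofFn w) f y / n.factorial) • fun x : Space d => ∏ i, (1 * x (w i) + -y (w i)) := by
    funext x
    simp only [taylorPoly, dirDeriv, Finset.sum_apply, Pi.smul_apply, smul_eq_mul, Finset.sum_div]
    refine Finset.sum_congr rfl fun n _ => Finset.sum_congr rfl fun w _ => ?_
    simp only [PiLp.sub_apply, one_mul, ← sub_eq_add_neg]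
    ring
  rw [this]
  refine Submodule.sum_mem _ fun n hn => Submodule.sum_mem _ fun w _ => Submodule.smul_mem _ _ ?_
  have h := prod_mem_polySpace (Finset.univ : Finset (Fin n)) (a := fun _ => 1)
    (fun i _ => affine_mem_polySpace (w i) 1 (-y (w i)))
  refine polyLT_mono (Nat.succ_le_of_lt (Finset.mem_range.1 hn)) ?_
  rw [Nat.succ_eq_add_one, polyLT_succ]
  simpa using h

theorem sub_taylorPoly_eq {f : Space d → ℝ} (hf : ContDiff ℝ ∞ f) (k : ℕ) (y x : Space d) :
    f x - taylorPoly (k + 1) f y x = ∫ t in (0 : ℝ)..1, (1 - t) ^ k / k.factorial *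
      dirDeriv (k + 1) (x - y) f (y + t • (x - y)) := by
  rw [← taylor_remainder (g := fun n t => dirDeriv n (x - y) f (y + t • (x - y)))
    (fun n t => hasDerivAt_dirDeriv hf n y (x - y) t)]
  simp [taylorPoly, dirDeriv_zero]

/-- The variance of `h` is nonnegative. -/
theorem sq_integral_le {h : ℝ → ℝ} (hh : Continuous h) :
    (∫ t in (0 : ℝ)..1, h t) ^ 2 ≤ ∫ t in (0 : ℝ)..1, h t ^ 2 := by
  set c := ∫ t in (0 : ℝ)..1, h t
  have h0 : 0 ≤ ∫ t in (0 : ℝ)..1, (h t - c) ^ 2 :=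
    intervalIntegral.integral_nonneg (by norm_num) fun t _ => sq_nonneg _
  have h1 : ∫ t in (0 : ℝ)..1, (h t - c) ^ 2 =
      (∫ t in (0 : ℝ)..1, h t ^ 2) - 2 * c * c + c ^ 2 := by
    have e : (fun t => (h t - c) ^ 2) = fun t => (h t ^ 2 - 2 * c * h t) + c ^ 2 := by
      funext t; ring
    rw [e, intervalIntegral.integral_add, intervalIntegral.integral_sub,
      intervalIntegral.integral_const_mul]
    · simp [c]
    all_goals exact Continuous.intervalIntegrable (by fun_prop) _ _
  nlinarith

theorem sq_sub_taylorPoly_le {f : Space d → ℝ} (hf : ContDiff ℝ ∞ f) (k : ℕ) {y x : Space d}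
    {s : ℝ} (hv : ∀ j, |(x - y) j| ≤ s) :
    (f x - taylorPoly (k + 1) f y x) ^ 2 ≤ ((d : ℝ) ^ (k + 1)) ^ 2 * s ^ (2 * (k + 1)) *
      ∫ t in (0 : ℝ)..1, gradSq (k + 1) f (y + t • (x - y)) := by
  have hcont : ∀ n, Continuous fun t : ℝ => dirDeriv n (x - y) f (y + t • (x - y)) := fun n =>
    continuous_iff_continuousAt.2 fun t => (hasDerivAt_dirDeriv hf n y (x - y) t).continuousAt
  have hg : Continuous fun t : ℝ => gradSq (k + 1) f (y + t • (x - y)) :=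
    (continuous_gradSq hf _).comp (by fun_prop)
  rw [sub_taylorPoly_eq hf, ← intervalIntegral.integral_const_mul]
  have hc := hcont (k + 1)
  refine (sq_integral_le (by fun_prop)).trans ?_
  refine intervalIntegral.integral_mono_on (by norm_num)
    (Continuous.intervalIntegrable (by fun_prop) _ _)
    (Continuous.intervalIntegrable (by fun_prop) _ _) fun t ht => ?_
  refine le_trans ?_ (sq_dirDeriv_le hf (k + 1) hv _)
  rw [mul_pow]
  refine mul_le_of_le_one_left (sq_nonneg _) ?_
  have h0 : 0 ≤ (1 - t) ^ k / (k.factorial : ℝ) :=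
    div_nonneg (pow_nonneg (by linarith [ht.2]) _) (by positivity)
  refine pow_le_one₀ h0 ?_
  rw [div_le_one (by positivity)]
  refine (pow_le_one₀ (by linarith [ht.2]) (by linarith [ht.1])).trans ?_
  exact_mod_cast Nat.one_le_iff_ne_zero.2 (Nat.factorial_ne_zero k)

/-! ### Averaging over a convex set -/

/-- The Jacobian factor of the dilation is `t⁻¹ ^ d`, which is at most `2 ^ d`. -/
theorem lintegral_comp_add_smul_le (F : Space d → ENNReal) (c : Space d)
    {t : ℝ} (ht : 1 / 2 ≤ t) :
    ∫⁻ x, F (c + t • x) ≤ 2 ^ d * ∫⁻ x, F x := by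
  have ht0 : t ≠ 0 := by linarith
  have h1 : ∫⁻ x, F (c + t • x) = ∫⁻ y, F (c + y) ∂Measure.map (fun x => t • x) volume :=
    (lintegral_map_equiv (μ := (volume : Measure (Space d))) (fun y => F (c + y))
      (Homeomorph.smul (isUnit_iff_ne_zero.2 ht0).unit : Space d ≃ₜ Space d).toMeasurableEquiv).symm
  rw [h1, Measure.map_addHaar_smul _ ht0, lintegral_smul_measure, lintegral_add_left_eq_self]
  refine mul_le_mul_left ?_ _
  rw [finrank_euclideanSpace_fin, abs_of_nonneg (by positivity), ← inv_pow,
    ENNReal.ofReal_pow (by positivity)]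
  refine pow_le_pow_left' ?_ d
  rw [ENNReal.ofReal_le_iff_le_toReal (by simp)]
  simp only [ENNReal.toReal_ofNat]
  rw [inv_le_comm₀ (by linarith) (by norm_num)]
  linarith

/-- The point `(1 - t) y + t x` moves with speed at least `1 / 2` in `x` if `t ≥ 1 / 2` and in `y`
if `t ≤ 1 / 2`. Substituting in that variable keeps the Jacobian bounded by `2 ^ d`, convexity keeps
the point in `B`, and the other variable contributes the factor `volume B`. -/
theorem lintegral_segment_le {B : Set (Space d)} (hB : Convex ℝ B) (hm : MeasurableSet B)
    {G : Space d → ENNReal} (hG : Measurable G) :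
    ∫⁻ y in B, ∫⁻ x in B, ∫⁻ t in Set.Ioc (0 : ℝ) 1, G (y + t • (x - y)) ≤
      2 ^ d * volume B * ∫⁻ x in B, G x := by
  have hhalf : ∀ {t : ℝ}, 1 / 2 ≤ t → t ≤ 1 → ∀ {y : Space d}, y ∈ B →
      ∫⁻ x in B, G (y + t • (x - y)) ≤ 2 ^ d * ∫⁻ x in B, G x := by
    intro t ht ht1 y hy
    rw [← lintegral_indicator hm, ← lintegral_indicator hm]
    refine le_trans (lintegral_mono fun x => ?_)
      (lintegral_comp_add_smul_le (B.indicator G) ((1 - t) • y) ht)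
    have e : (1 - t) • y + t • x = y + t • (x - y) := by
      rw [sub_smul, smul_sub, one_smul]; abel
    by_cases hx : x ∈ B
    · rw [Set.indicator_of_mem hx, Set.indicator_of_mem, e]
      exact hB hy hx (by linarith) (by linarith) (by ring)
    · rw [Set.indicator_of_notMem hx]; exact zero_le
  have hswap : ∫⁻ y in B, ∫⁻ x in B, ∫⁻ t in Set.Ioc (0 : ℝ) 1, G (y + t • (x - y)) =
      ∫⁻ t in Set.Ioc (0 : ℝ) 1, ∫⁻ y in B, ∫⁻ x in B, G (y + t • (x - y)) := by
    have h1 : ∀ y : Space d, ∫⁻ x in B, ∫⁻ t in Set.Ioc (0 : ℝ) 1, G (y + t • (x - y)) =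
        ∫⁻ t in Set.Ioc (0 : ℝ) 1, ∫⁻ x in B, G (y + t • (x - y)) := by
      intro y
      refine lintegral_lintegral_swap (Measurable.aemeasurable ?_)
      exact hG.comp (by fun_prop)
    simp only [h1]
    refine lintegral_lintegral_swap (Measurable.aemeasurable ?_)
    refine Measurable.lintegral_prod_right' (f := fun q : (Space d × ℝ) × Space d =>
      G (q.1.1 + q.1.2 • (q.2 - q.1.1))) ?_
    exact hG.comp (by fun_prop)
  rw [hswap]
  have hI : ∀ t ∈ Set.Ioc (0 : ℝ) 1, ∫⁻ y in B, ∫⁻ x in B, G (y + t • (x - y)) ≤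
      2 ^ d * volume B * ∫⁻ x in B, G x := by
    intro t ht
    have hconst : ∫⁻ _ in B, (2 ^ d * ∫⁻ x in B, G x) = 2 ^ d * volume B * ∫⁻ x in B, G x := by
      rw [setLIntegral_const]; ring
    rw [← hconst]
    rcases le_total (1 / 2) t with h | h
    · exact setLIntegral_mono' hm fun y hy => hhalf h ht.2 hy
    · have hsw : Measurable (fun q : Space d × Space d => G (q.1 + t • (q.2 - q.1))) :=
        hG.comp (by fun_prop)
      rw [lintegral_lintegral_swap hsw.aemeasurable]
      refine setLIntegral_mono' hm fun x hx => ?_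
      have := hhalf (t := 1 - t) (by linarith) (by linarith [ht.1]) hx
      refine le_trans (le_of_eq ?_) this
      refine lintegral_congr fun y => ?_
      congr 1
      module
  refine (setLIntegral_mono' measurableSet_Ioc hI).trans ?_
  simp

/-- Local polynomial approximation on convex sets. -/
theorem exists_poly_approx {f : Space d → ℝ} (hf : ContDiff ℝ ∞ f) {B : Set (Space d)}
    (hB : Convex ℝ B) (hm : MeasurableSet B) (hb : Bornology.IsBounded B) (h0 : volume B ≠ 0)
    {s : ℝ} (hs : ∀ x ∈ B, ∀ y ∈ B, ∀ j, |(x - y) j| ≤ s) (k : ℕ) :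
    ∃ p ∈ polyLT d k, ∫ x in B, (f x - p x) ^ 2 ≤
      2 ^ d * ((d : ℝ) ^ k) ^ 2 * s ^ (2 * k) * ∫ x in B, gradSq k f x := by
  have hfin : volume B ≠ ⊤ := hb.measure_lt_top.ne
  have hint : ∀ {g : Space d → ℝ}, Continuous g → IntegrableOn g B := fun hg =>
    (hg.continuousOn.integrableOn_compact hb.isCompact_closure).mono_set subset_closure
  rcases k with _ | k
  -- For `k = 0` only the zero polynomial is available, and `gradSq 0 f = f ^ 2`.
  · refine ⟨0, Submodule.zero_mem _, ?_⟩
    have : ∀ x, gradSq 0 f x = f x ^ 2 := by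
      intro x
      have : multiIndicesEq d 0 = {0} := by simp [multiIndicesEq]
      simp [gradSq, this, multiDeriv_zero]
    simp only [this, Pi.zero_apply, sub_zero, pow_zero, mul_zero, mul_one, one_pow]
    refine le_mul_of_one_le_left (integral_nonneg fun x => sq_nonneg _) ?_
    exact one_le_pow₀ (by norm_num)
  set c : ℝ := ((d : ℝ) ^ (k + 1)) ^ 2 * s ^ (2 * (k + 1)) with hc
  have hc0 : 0 ≤ c := mul_nonneg (sq_nonneg _) (by rw [pow_mul]; positivity)
  set G : Space d → ENNReal := fun z => ENNReal.ofReal (gradSq (k + 1) f z) with hG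
  have hGm : Measurable G := (continuous_gradSq hf _).measurable.ennreal_ofReal
  set R : Space d → ENNReal := fun y => ∫⁻ x in B, ENNReal.ofReal c *
    ∫⁻ t in Set.Ioc (0 : ℝ) 1, G (y + t • (x - y)) with hR
  have hpt : ∀ y ∈ B, ∫⁻ x in B, ENNReal.ofReal ((f x - taylorPoly (k + 1) f y x) ^ 2) ≤ R y := by
    intro y hy
    refine setLIntegral_mono' hm fun x hx => ?_
    have := ENNReal.ofReal_le_ofReal (sq_sub_taylorPoly_le hf k (hs x hx y hy))
    refine this.trans (le_of_eq ?_)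
    rw [ENNReal.ofReal_mul hc0, intervalIntegral.integral_of_le (by norm_num),
      ofReal_integral_eq_lintegral_ofReal]
    · have : Continuous fun t : ℝ => gradSq (k + 1) f (y + t • (x - y)) :=
        (continuous_gradSq hf _).comp (by fun_prop)
      exact (this.integrableOn_Icc).mono_set Set.Ioc_subset_Icc_self
    · exact Filter.Eventually.of_forall fun t => gradSq_nonneg _ _ _
  have hRm : Measurable R := by
    refine Measurable.lintegral_prod_right' (f := fun q : Space d × Space d => ENNReal.ofReal c *
      ∫⁻ t in Set.Ioc (0 : ℝ) 1, G (q.1 + t • (q.2 - q.1))) (Measurable.const_mul ?_ _)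
    refine Measurable.lintegral_prod_right' (f := fun q : (Space d × Space d) × ℝ =>
      G (q.1.1 + q.2 • (q.1.2 - q.1.1))) ?_
    exact hGm.comp (by fun_prop)
  have hRint : ∫⁻ y in B, R y ≤ ENNReal.ofReal c * (2 ^ d * volume B * ∫⁻ x in B, G x) := by
    have : ∫⁻ y in B, R y = ENNReal.ofReal c *
        ∫⁻ y in B, ∫⁻ x in B, ∫⁻ t in Set.Ioc (0 : ℝ) 1, G (y + t • (x - y)) := by
      simp only [hR, lintegral_const_mul' _ _ ENNReal.ofReal_ne_top]
    rw [this]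
    gcongr
    exact lintegral_segment_le hB hm hGm
  have hGfin : ∫⁻ x in B, G x = ENNReal.ofReal (∫ x in B, gradSq (k + 1) f x) := by
    rw [ofReal_integral_eq_lintegral_ofReal (hint (continuous_gradSq hf _))]
    exact Filter.Eventually.of_forall fun t => gradSq_nonneg _ _ _
  -- The Taylor polynomial at a single point may approximate badly, since point values are not
  -- controlled by the integral. The average of the remainder over all base points is controlled, so
  -- some base point does at least as well as the average.
  obtain ⟨y, hy, hRy⟩ : ∃ y ∈ B, R y ≤ ⨍⁻ a in B, R a ∂volume :=
    exists_le_setLAverage h0 hfin hRm.aemeasurable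
  refine ⟨taylorPoly (k + 1) f y, taylorPoly_mem_polyLT _ _ _, ?_⟩
  have hpc : Continuous fun x => (f x - taylorPoly (k + 1) f y x) ^ 2 :=
    (hf.continuous.sub (contDiff_of_mem_polyLT (taylorPoly_mem_polyLT _ _ _)).continuous).pow 2
  have hfinal : ENNReal.ofReal (∫ x in B, (f x - taylorPoly (k + 1) f y x) ^ 2) ≤
      ENNReal.ofReal (2 ^ d * c * ∫ x in B, gradSq (k + 1) f x) := by
    rw [ofReal_integral_eq_lintegral_ofReal (hint hpc)
      (Filter.Eventually.of_forall fun t => sq_nonneg _)]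
    refine (hpt y hy).trans (hRy.trans ?_)
    rw [setLAverage_eq]
    refine (ENNReal.div_le_of_le_mul' (hRint.trans (le_of_eq ?_)))
    rw [hGfin, ENNReal.ofReal_mul (p := 2 ^ d * c) (by positivity),
      ENNReal.ofReal_mul (p := 2 ^ d) (by positivity)]
    have h2 : ENNReal.ofReal (2 ^ d) = 2 ^ d := by
      rw [ENNReal.ofReal_pow (by norm_num), ENNReal.ofReal_ofNat]
    rw [h2]
    ring
  have h3 := (ENNReal.ofReal_le_ofReal_iff (mul_nonneg (by positivity)
    (integral_nonneg fun x => gradSq_nonneg _ _ _))).1 hfinal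
  calc _ ≤ _ := h3
    _ = _ := by rw [hc]; ring

end SmoothPUFEM

/-! ### Grid geometry, the mollifier and the partition of unity. -/

namespace SmoothPUFEM

variable {d : ℕ}

/-! ### Change of variables and the grid -/

/-- The point of `ℝ^d` with integer coordinates `i`. -/
noncomputable def gridPt (i : Fin d → ℤ) : Space d := WithLp.toLp 2 fun j => (i j : ℝ)

@[simp] theorem gridPt_apply (i : Fin d → ℤ) (j : Fin d) : gridPt i j = i j := rfl

theorem integral_comp_affine (g : Space d → ℝ) {σ : ℝ} (hσ : 0 < σ) (c : Space d) :
    ∫ x, g x = σ ^ d * ∫ y, g (σ • (y + c)) := by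
  rw [integral_add_right_eq_self (fun y => g (σ • y)) c,
    Measure.integral_comp_smul volume g σ, finrank_euclideanSpace_fin,
    abs_of_nonneg (by positivity), smul_eq_mul, mul_inv_cancel_left₀ (by positivity)]

theorem setIntegral_comp_affine (g : Space d → ℝ) {S : Set (Space d)} (hS : MeasurableSet S)
    {σ : ℝ} (hσ : 0 < σ) (c : Space d) :
    ∫ x in S, g x = σ ^ d * ∫ y in (fun y : Space d => σ • (y + c)) ⁻¹' S, g (σ • (y + c)) := by
  rw [← integral_indicator hS, integral_comp_affine _ hσ c, ← integral_indicator]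
  · rfl
  · exact hS.preimage (by fun_prop)

theorem isOpen_openBox (l u : Fin d → ℝ) :
    IsOpen {x : Space d | ∀ j, l j < x j ∧ x j < u j} := by
  have h : {x : Space d | ∀ j, l j < x j ∧ x j < u j} =
      ⋂ j, {x : Space d | l j < x j} ∩ {x : Space d | x j < u j} := by
    ext x; simp
  rw [h]
  exact isOpen_iInter_of_finite fun j =>
    (isOpen_lt continuous_const (by fun_prop)).inter (isOpen_lt (by fun_prop) continuous_const)

theorem isOpen_element (σ : ℝ) (i : Fin d → ℤ) : IsOpen (element (d := d) σ i) :=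
  isOpen_openBox _ _

theorem measurableSet_element (σ : ℝ) (i : Fin d → ℤ) : MeasurableSet (element (d := d) σ i) :=
  (isOpen_element σ i).measurableSet

theorem isOpen_patchCore (σ : ℝ) (i : Fin d → ℤ) : IsOpen (patchCore (d := d) σ i) :=
  isOpen_openBox _ _

/-- The open cube of side `s` whose lower corner is `a`. -/
def cube (a : Space d) (s : ℝ) : Set (Space d) := {x | ∀ j, a j < x j ∧ x j < a j + s}

theorem isOpen_cube (a : Space d) (s : ℝ) : IsOpen (cube a s) :=
  isOpen_openBox _ _

theorem convex_cube (a : Space d) (s : ℝ) : Convex ℝ (cube a s) := by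
  intro x hx y hy u v hu hv huv j
  have h1 := hx j
  have h2 := hy j
  simp only [PiLp.add_apply, PiLp.smul_apply, smul_eq_mul]
  have : (a j : ℝ) = u * a j + v * a j := by rw [← add_mul, huv, one_mul]
  constructor
  · rcases hu.eq_or_lt with rfl | hu
    · nlinarith
    · nlinarith
  · have e : a j + s = u * (a j + s) + v * (a j + s) := by rw [← add_mul, huv, one_mul]
    rcases hu.eq_or_lt with rfl | hu
    · nlinarith
    · nlinarith

theorem abs_sub_le_of_mem_cube {a : Space d} {s : ℝ} {x y : Space d} (hx : x ∈ cube a s)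
    (hy : y ∈ cube a s) (j : Fin d) : |(x - y) j| ≤ s := by
  have h1 := hx j
  have h2 := hy j
  simp only [PiLp.sub_apply]
  rw [abs_le]
  constructor <;> linarith

theorem isBounded_cube (a : Space d) (s : ℝ) : Bornology.IsBounded (cube a s) := by
  have hK : IsCompact (WithLp.toLp 2 '' Set.univ.pi fun j : Fin d =>
      Set.Icc (a j) (a j + s) : Set (Space d)) :=
    (isCompact_univ_pi fun _ => isCompact_Icc).image (PiLp.continuous_toLp 2 _)
  exact hK.isBounded.subset fun x hx => ⟨x.ofLp, fun j _ => ⟨(hx j).1.le, (hx j).2.le⟩, rfl⟩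

theorem volume_cube_ne_zero (a : Space d) {s : ℝ} (hs : 0 < s) : volume (cube a s) ≠ 0 := by
  refine ((isOpen_cube a s).measure_pos volume
    ⟨WithLp.toLp 2 fun j => a j + s / 2, fun j => ?_⟩).ne'
  simp only
  constructor <;> linarith

theorem element_eq_cube (σ : ℝ) (i : Fin d → ℤ) : element σ i = cube (σ • gridPt i) σ := by
  ext x
  simp only [element, cube, Set.mem_ofPred_eq, PiLp.smul_apply, smul_eq_mul, gridPt_apply]
  refine forall_congr' fun j => ?_
  rw [mul_comm σ, add_mul, one_mul]

theorem isBounded_element (σ : ℝ) (i : Fin d → ℤ) : Bornology.IsBounded (element (d := d) σ i) := by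
  rw [element_eq_cube]; exact isBounded_cube _ _

theorem Continuous.integrableOn_isBounded {g : Space d → ℝ} (hg : Continuous g)
    {B : Set (Space d)} (hb : Bornology.IsBounded B) : IntegrableOn g B :=
  (hg.continuousOn.integrableOn_compact hb.isCompact_closure).mono_set subset_closure

/-- The index of the element that contains a given point off the grid. -/
theorem mem_element_iff {σ : ℝ} (hσ : 0 < σ) {x : Space d} {i : Fin d → ℤ}
    (hx : x ∈ element σ i) (j : Fin d) : ⌊x j / σ⌋ = i j := by
  have h := hx j
  rw [Int.floor_eq_iff, le_div_iff₀ hσ, div_lt_iff₀ hσ]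
  exact ⟨h.1.le, h.2⟩

theorem pairwise_disjoint_element {σ : ℝ} (hσ : 0 < σ) :
    Pairwise (Function.onFun Disjoint fun i : Fin d → ℤ => element (d := d) σ i) := by
  intro i i' h
  refine Set.disjoint_left.2 fun x hx hx' => h ?_
  funext j
  rw [← mem_element_iff hσ hx, mem_element_iff hσ hx']

theorem ae_coord_ne (j : Fin d) (t : ℝ) : ∀ᵐ x : Space d, x j ≠ t := by
  have h : ∀ᵐ y : Fin d → ℝ, y j ≠ t := Measure.ae_eval_ne (μ := fun _ : Fin d => (volume : Measure ℝ)) j t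
  exact (PiLp.volume_preserving_ofLp (Fin d)).quasiMeasurePreserving.ae h

/-- The grid hyperplanes form a countable union of null sets. -/
theorem ae_mem_element {σ : ℝ} (hσ : 0 < σ) :
    ∀ᵐ x : Space d, x ∈ element σ (fun j => ⌊x j / σ⌋) := by
  have h : ∀ᵐ x : Space d, ∀ j : Fin d, ∀ n : ℤ, x j ≠ n * σ :=
    ae_all_iff.2 fun j => ae_all_iff.2 fun n => ae_coord_ne j _
  filter_upwards [h] with x hx j
  have h1 := Int.floor_le (x j / σ)
  have h2 := Int.lt_floor_add_one (x j / σ)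
  rw [le_div_iff₀ hσ] at h1
  rw [div_lt_iff₀ hσ] at h2
  exact ⟨lt_of_le_of_ne h1 (hx j _).symm, h2⟩

/-- The sum runs over all of `ℤ^d` with an indicator, so that sums over different families of
elements can be compared and shifted termwise. -/
theorem hasSum_setIntegral_element {σ : ℝ} (hσ : 0 < σ) (I : Set (Fin d → ℤ)) {g : Space d → ℝ}
    (hg : IntegrableOn g (⋃ i ∈ I, element σ i)) :
    HasSum (I.indicator fun i => ∫ x in element σ i, g x)
      (∫ x in ⋃ i ∈ I, element σ i, g x) := by
  rw [← hasSum_subtype_iff_indicator]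
  rw [Set.biUnion_eq_iUnion] at hg ⊢
  refine hasSum_integral_iUnion (fun i => measurableSet_element σ _) ?_ hg
  intro i i' h
  exact pairwise_disjoint_element hσ fun h' => h (Subtype.ext h')

theorem iUnion_element_ae {σ : ℝ} (hσ : 0 < σ) :
    (⋃ i, element (d := d) σ i : Set (Space d)) =ᵐ[volume] Set.univ := by
  refine Filter.eventuallyEq_univ.2 ?_
  filter_upwards [ae_mem_element hσ] with x hx
  exact Set.mem_iUnion.2 ⟨_, hx⟩

theorem hasSum_integral_element {σ : ℝ} (hσ : 0 < σ) {g : Space d → ℝ} (hg : Integrable g) :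
    HasSum (fun i : Fin d → ℤ => ∫ x in element σ i, g x) (∫ x, g x) := by
  have h := hasSum_integral_iUnion (fun i => measurableSet_element (d := d) σ i)
    (pairwise_disjoint_element hσ) hg.integrableOn
  rwa [setIntegral_congr_set (iUnion_element_ae hσ), setIntegral_univ] at h

theorem preimage_element {σ : ℝ} (hσ : 0 < σ) (i n : Fin d → ℤ) :
    (fun y : Space d => σ • (y + gridPt i)) ⁻¹' element σ (n + i) = element 1 n := by
  ext y
  simp only [Set.mem_preimage, element, Set.mem_ofPred_eq, PiLp.smul_apply, PiLp.add_apply,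
    smul_eq_mul, gridPt_apply, Pi.add_apply, Int.cast_add]
  refine forall_congr' fun j => and_congr ?_ ?_
  · rw [mul_comm σ, mul_lt_mul_iff_left₀ hσ, mul_one]; simp
  · rw [mul_comm σ, mul_lt_mul_iff_left₀ hσ, mul_one]
    constructor <;> intro h <;> linarith

theorem preimage_patchCore {σ : ℝ} (hσ : 0 < σ) (i n : Fin d → ℤ) :
    (fun y : Space d => σ • (y + gridPt i)) ⁻¹' patchCore σ (n + i) = patchCore 1 n := by
  ext y
  simp only [Set.mem_preimage, patchCore, Set.mem_ofPred_eq, PiLp.smul_apply, PiLp.add_apply,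
    smul_eq_mul, gridPt_apply, Pi.add_apply, Int.cast_add]
  refine forall_congr' fun j => and_congr ?_ ?_
  · rw [mul_comm σ, mul_lt_mul_iff_left₀ hσ, mul_one]
    constructor <;> intro h <;> linarith
  · rw [mul_comm σ, mul_lt_mul_iff_left₀ hσ, mul_one]
    constructor <;> intro h <;> linarith

theorem setIntegral_element (g : Space d → ℝ) {σ : ℝ} (hσ : 0 < σ) (i n : Fin d → ℤ) :
    ∫ x in element σ (n + i), g x =
      σ ^ d * ∫ y in element 1 n, g (σ • (y + gridPt i)) := by
  rw [setIntegral_comp_affine g (measurableSet_element _ _) hσ (gridPt i), preimage_element hσ]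

/-- The multi-indices with entries of absolute value at most `L`. -/
noncomputable def box (d L : ℕ) : Finset (Fin d → ℤ) := Fintype.piFinset fun _ => Finset.Icc (-(L : ℤ)) L

theorem mem_box {L : ℕ} {n : Fin d → ℤ} : n ∈ box d L ↔ ∀ j, |n j| ≤ L := by
  simp [box, abs_le]

/-! ### The mollifier -/

theorem continuous_friedrichsBump : Continuous friedrichsBump := by
  have h : friedrichsBump = fun x => expNegInvGlue (1 - 4 * x ^ 2) := by
    funext x; rw [friedrichsBump_eq]
  rw [h]
  exact expNegInvGlue.contDiff (n := 0).continuous.comp (by fun_prop)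

theorem integral_friedrichsBump_pos : 0 < ∫ t, friedrichsBump t := by
  refine continuous_friedrichsBump.integral_pos_of_hasCompactSupport_nonneg_nonzero
    (x := 0) ?_ ?_ ?_
  · refine HasCompactSupport.of_support_subset_isCompact (K := Set.Icc (-(1 / 2)) (1 / 2))
      isCompact_Icc fun x hx => ?_
    have : |x| < 1 / 2 := by
      by_contra! h
      exact hx (by rw [friedrichsBump, if_pos h])
    exact abs_le.1 this.le
  · intro x
    rw [friedrichsBump_eq]; exact expNegInvGlue.nonneg _
  · rw [friedrichsBump, if_neg (by norm_num)]; exact (Real.exp_pos _).ne'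

theorem friedrichs_nonneg (x : ℝ) : 0 ≤ friedrichs x := by
  rw [friedrichs, friedrichsBump_eq]
  exact mul_nonneg (inv_nonneg.2 integral_friedrichsBump_pos.le) (expNegInvGlue.nonneg _)

theorem integral_friedrichs : ∫ t, friedrichs t = 1 := by
  unfold friedrichs
  rw [integral_const_mul, inv_mul_cancel₀ integral_friedrichsBump_pos.ne']

theorem integral_mollifier : ∫ x : Space d, mollifier x = 1 := by
  have h := (PiLp.volume_preserving_ofLp (Fin d)).integral_comp
    (MeasurableEquiv.toLp 2 (Fin d → ℝ)).symm.measurableEmbedding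
    (fun y : Fin d → ℝ => ∏ j, friedrichs (y j))
  have h2 : ∫ y : Fin d → ℝ, ∏ j, friedrichs (y j) = 1 := by
    rw [integral_fintype_prod_volume_eq_pow, integral_friedrichs, one_pow]
  rw [h2] at h
  exact h

theorem integral_scaledMollifier {σ : ℝ} (hσ : 0 < σ) :
    ∫ x : Space d, scaledMollifier σ x = 1 := by
  rw [integral_comp_affine _ hσ 0]
  simp only [scaledMollifier, add_zero, inv_smul_smul₀ hσ.ne']
  rw [integral_const_mul, integral_mollifier, mul_one, mul_inv_cancel₀ (by positivity)]

theorem scaledMollifier_nonneg {σ : ℝ} (hσ : 0 < σ) (x : Space d) : 0 ≤ scaledMollifier σ x :=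
  mul_nonneg (by positivity) (Finset.prod_nonneg fun _ _ => friedrichs_nonneg _)

theorem abs_lt_of_scaledMollifier_ne_zero {σ : ℝ} (hσ : 0 < σ) {x : Space d}
    (hx : scaledMollifier σ x ≠ 0) (j : Fin d) : |x j| < σ / 2 := by
  have hj : friedrichs ((σ⁻¹ • x) j) ≠ 0 := by
    intro h0
    refine hx ?_
    unfold scaledMollifier mollifier
    rw [Finset.prod_eq_zero (Finset.mem_univ j) h0, mul_zero]
  have hlt : |σ⁻¹ * x j| < 1 / 2 := by
    by_contra! hge
    refine hj ?_
    rw [friedrichs, friedrichsBump, if_pos (by simpa using hge), mul_zero]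
  rw [abs_mul, abs_of_pos (inv_pos.2 hσ), inv_mul_lt_iff₀ hσ] at hlt
  linarith

theorem continuous_scaledMollifier {σ : ℝ} (hσ : 0 < σ) :
    Continuous (scaledMollifier (d := d) σ) :=
  (isSmoothCompact_scaledMollifier hσ).1.continuous

theorem integrable_scaledMollifier_sub {σ : ℝ} (hσ : 0 < σ) (x : Space d) :
    Integrable fun y => scaledMollifier σ (x - y) :=
  ((continuous_scaledMollifier hσ).integrable_of_hasCompactSupport
    (isSmoothCompact_scaledMollifier hσ).2).comp_sub_left x

/-! ### The partition of unity -/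

theorem pou_nonneg {σ : ℝ} (hσ : 0 < σ) (n : Fin d → ℤ) (x : Space d) : 0 ≤ pou σ n x :=
  integral_nonneg fun _ => scaledMollifier_nonneg hσ _

theorem preimage_half_patchCore (σ : ℝ) (n : Fin d → ℤ) :
    (fun y : Space d => (1 : ℝ) • (y + WithLp.toLp 2 fun _ => -(σ / 2))) ⁻¹' patchCore σ n =
      element σ n := by
  ext y
  simp only [Set.mem_preimage, patchCore, element, Set.mem_ofPred_eq, PiLp.smul_apply,
    PiLp.add_apply, smul_eq_mul]
  refine forall_congr' fun j => and_congr ?_ ?_ <;> constructor <;> intro h <;> linarith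

/-- The patch cores are the elements translated by half a grid width, so they tile the space up to a
null set. The integrals of `scaledMollifier σ (x - ·)` over them add up to its total mass one. -/
theorem hasSum_pou {σ : ℝ} (hσ : 0 < σ) (x : Space d) :
    HasSum (fun n : Fin d → ℤ => pou σ n x) 1 := by
  have h0 := integrable_scaledMollifier_sub hσ x
  have h := hasSum_integral_element hσ
    (h0.comp_add_right (WithLp.toLp 2 fun _ => -(σ / 2) : Space d))
  rw [integral_add_right_eq_self (fun y => scaledMollifier σ (x - y)),
    integral_sub_left_eq_self (fun y => scaledMollifier σ y), integral_scaledMollifier hσ] at h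
  convert h using 2 with n
  rw [pou, setIntegral_comp_affine _ (isOpen_patchCore σ n).measurableSet one_pos
    (WithLp.toLp 2 fun _ => -(σ / 2)), preimage_half_patchCore]
  simp

theorem pou_le_one {σ : ℝ} (hσ : 0 < σ) (n : Fin d → ℤ) (x : Space d) : pou σ n x ≤ 1 :=
  le_hasSum (hasSum_pou hσ x) n fun m _ => pou_nonneg hσ m x

/-- Half the width of the core plus half the width of the support of the mollifier. -/
theorem abs_lt_of_pou_ne_zero {σ : ℝ} (hσ : 0 < σ) {n : Fin d → ℤ} {x : Space d}
    (h : pou σ n x ≠ 0) (j : Fin d) : |x j - n j * σ| < σ := by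
  by_contra! hge
  refine h ?_
  unfold pou
  refine (setIntegral_congr_fun (isOpen_patchCore σ n).measurableSet fun y hy => ?_).trans
    (integral_zero _ _)
  by_contra hne
  have h1 := abs_lt.1 (abs_lt_of_scaledMollifier_ne_zero hσ hne j)
  have h2 := hy j
  simp only [PiLp.sub_apply] at h1
  rcases le_abs.1 hge with h3 | h3 <;> linarith

/-- The nodes of the element `Q_i`. -/
def nodes (i : Fin d → ℤ) : Finset (Fin d → ℤ) := Fintype.piFinset fun j => {i j, i j + 1}

theorem mem_nodes {i n : Fin d → ℤ} : n ∈ nodes i ↔ IsNode n i := by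
  simp [nodes, IsNode]

theorem isNode_of_pou_ne_zero {σ : ℝ} (hσ : 0 < σ) {i n : Fin d → ℤ} {x : Space d}
    (hx : x ∈ element σ i) (h : pou σ n x ≠ 0) : IsNode n i := by
  intro j
  have h1 := abs_lt.1 (abs_lt_of_pou_ne_zero hσ h j)
  have h2 := hx j
  have h3 : ((i j : ℝ) - 1) * σ < n j * σ := by linarith
  have h4 : (n j : ℝ) * σ < ((i j : ℝ) + 2) * σ := by linarith
  have h5 : i j - 1 < n j := by exact_mod_cast lt_of_mul_lt_mul_right h3 hσ.le
  have h6 : n j < i j + 2 := by exact_mod_cast lt_of_mul_lt_mul_right h4 hσ.le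
  omega

theorem sum_nodes_pou {σ : ℝ} (hσ : 0 < σ) {i : Fin d → ℤ} {x : Space d}
    (hx : x ∈ element σ i) : ∑ n ∈ nodes i, pou σ n x = 1 := by
  refine HasSum.unique (hasSum_sum_of_ne_finset_zero fun n hn => ?_) (hasSum_pou hσ x)
  by_contra h
  exact hn (mem_nodes.2 (isNode_of_pou_ne_zero hσ hx h))

theorem pou_comp_affine {σ : ℝ} (hσ : 0 < σ) (i n : Fin d → ℤ) (y : Space d) :
    pou σ (n + i) (σ • (y + gridPt i)) = pou 1 n y := by
  unfold pou
  rw [setIntegral_comp_affine _ (isOpen_patchCore σ _).measurableSet hσ (gridPt i),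
    preimage_patchCore hσ, ← integral_const_mul]
  refine integral_congr_ae (Filter.Eventually.of_forall fun z => ?_)
  simp only [scaledMollifier, one_pow, inv_one, one_mul, one_smul]
  rw [← smul_sub, inv_smul_smul₀ hσ.ne', add_sub_add_right_eq_sub,
    mul_inv_cancel_left₀ (by positivity)]

/-- The rescaled space is the one with grid size one, whichever element is moved to the origin.
Local estimates therefore need a proof only on `element 1 0`, and their constants depend neither on
`σ` nor on the element. -/
theorem comp_affine_mem_pufem {P : ℕ} {σ : ℝ} (hσ : 0 < σ) (i : Fin d → ℤ) {w : Space d → ℝ}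
    (hw : w ∈ pufem d P σ) : (fun y => w (σ • (y + gridPt i))) ∈ pufem d P 1 := by
  unfold pufem at hw
  induction hw using Submodule.span_induction with
  | mem f hf =>
    obtain ⟨n, v, hv, rfl⟩ := hf
    refine Submodule.subset_span ⟨n - i, _, comp_affine_mem_polySpace hv σ (gridPt i), ?_⟩
    funext y
    rw [← pou_comp_affine hσ i (n - i), sub_add_cancel]
  | zero => exact Submodule.zero_mem _
  | add f g _ _ hf hg => exact Submodule.add_mem _ hf hg
  | smul a f _ hf => exact Submodule.smul_mem _ a hf

end SmoothPUFEM

/-! ### Density of smooth compactly supported functions in the Sobolev space on the whole space. -/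

namespace SmoothPUFEM

variable {d : ℕ}

open Filter Topology

/-! ### Mollification -/

theorem eLpNorm_two_sq (f : Space d → ℝ) (μ : Measure (Space d)) :
    eLpNorm f 2 μ ^ 2 = ∫⁻ x, ‖f x‖ₑ ^ 2 ∂μ := by
  have h := eLpNorm_nnreal_pow_eq_lintegral (f := f) (μ := μ) (p := 2) (by norm_num)
  simpa using h

/-- Translations are measure preserving and depend continuously on the shift, hence so does their
action on `L²`. -/
theorem tendsto_eLpNorm_translate {g : Space d → ℝ} (hg : MemLp g 2) :
    Tendsto (fun y => eLpNorm (fun x => g (x - y) - g x) 2) (𝓝 0) (𝓝 0) := by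
  have : Fact ((1 : ENNReal) ≤ 2) := ⟨by norm_num⟩
  let τ : Space d → C(Space d, Space d) := fun y => ⟨fun x => x - y, by fun_prop⟩
  have hτ : ∀ y, MeasurePreserving (τ y) (volume : Measure (Space d)) volume := fun y =>
    measurePreserving_sub_right volume y
  have hτc : Continuous τ := by
    refine ContinuousMap.continuous_of_continuous_uncurry _ ?_
    change Continuous fun q : Space d × Space d => q.2 - q.1
    fun_prop
  have h := (Continuous.compMeasurePreservingLp (p := 2)
    (continuous_const (y := hg.toLp g)) hτc hτ (by norm_num)).tendsto 0
  have h2 := (tendsto_iff_edist_tendsto_0.1 h)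
  refine h2.congr fun y => ?_
  rw [Lp.edist_def]
  refine eLpNorm_congr_ae ?_
  have h3 : ∀ z, Lp.compMeasurePreserving (τ z) (hτ z) (hg.toLp g) =ᵐ[volume]
      fun x => g (x - z) := fun z =>
    (Lp.coeFn_compMeasurePreserving _ (hτ z)).trans
      ((hτ z).quasiMeasurePreserving.ae_eq_comp hg.coeFn_toLp)
  filter_upwards [h3 y, h3 0] with x h1 h2
  simp only [Pi.sub_apply]
  rw [h1, h2, sub_zero]

/-- The convolution of a smooth compactly supported function with `g`. -/
noncomputable def conv (η g : Space d → ℝ) (x : Space d) : ℝ := ∫ y, η (x - y) * g y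

theorem conv_eq_convolution (η g : Space d → ℝ) :
    conv η g = MeasureTheory.convolution η g (ContinuousLinearMap.mul ℝ ℝ) volume := by
  funext x
  rw [MeasureTheory.convolution_eq_swap]
  rfl

theorem contDiff_conv {η g : Space d → ℝ} (hη : IsSmoothCompact η)
    (hg : LocallyIntegrable g) : ContDiff ℝ ∞ (conv η g) := by
  rw [conv_eq_convolution]
  exact hη.2.contDiff_convolution_left _ hη.1 hg

theorem partialDeriv_conv {η g : Space d → ℝ} (hη : IsSmoothCompact η)
    (hg : LocallyIntegrable g) (j : Fin d) :
    partialDeriv j (conv η g) = conv (partialDeriv j η) g := by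
  funext x
  have h := hη.2.hasFDerivAt_convolution_left (ContinuousLinearMap.mul ℝ ℝ)
    (hη.1.of_le (by exact_mod_cast le_top)) hg x
  rw [partialDeriv, conv_eq_convolution, h.fderiv, MeasureTheory.convolution_eq_swap]
  rw [ContinuousLinearMap.integral_apply]
  · rfl
  · have hc : MeasureTheory.ConvolutionExistsAt (fderiv ℝ η) g x
        (ContinuousLinearMap.precompL (Space d) (ContinuousLinearMap.mul ℝ ℝ)) volume :=
      (hη.2.fderiv (𝕜 := ℝ)).convolutionExists_left _
        ((hη.1.fderiv_right (m := ∞) (by simp)).continuous) hg x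
    exact hc.integrable_swap

theorem multiDeriv_conv {η g : Space d → ℝ} (hη : IsSmoothCompact η)
    (hg : LocallyIntegrable g) (α : Fin d → ℕ) :
    multiDeriv α (conv η g) = conv (multiDeriv α η) g := by
  have key : ∀ l : List (Fin d), IsSmoothCompact (wordDeriv l η) ∧
      wordDeriv l (conv η g) = conv (wordDeriv l η) g := by
    intro l
    induction l with
    | nil => exact ⟨hη, rfl⟩
    | cons j l ih =>
      refine ⟨ih.1.partialDeriv j, ?_⟩
      change partialDeriv j (wordDeriv l _) = _
      rw [ih.2, partialDeriv_conv ih.1 hg]; rfl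
  simp only [multiDeriv_eq_wordDeriv]
  exact (key _).2

/-- Jensen's inequality for the probability density `ρ`, obtained from Hölder's inequality with the
constant `1`. -/
theorem lintegral_sq_le {ρ : Space d → ENNReal} (hρ : Measurable ρ) (h1 : ∫⁻ y, ρ y = 1)
    {h : Space d → ENNReal} (hh : Measurable h) :
    (∫⁻ y, ρ y * h y) ^ 2 ≤ ∫⁻ y, ρ y * h y ^ 2 := by
  set μ : Measure (Space d) := volume.withDensity ρ
  have e : ∀ {f : Space d → ENNReal}, Measurable f → ∫⁻ y, ρ y * f y = ∫⁻ y, f y ∂μ :=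
    fun hf => (lintegral_withDensity_eq_lintegral_mul _ hρ hf).symm
  rw [e hh, e (hh.pow_const 2)]
  have hμ : ∫⁻ _, (1 : ENNReal) ∂μ = 1 := by
    rw [← e measurable_const]; simpa using h1
  have h2 := ENNReal.lintegral_mul_le_Lp_mul_Lq μ Real.HolderConjugate.two_two
    hh.aemeasurable (measurable_const (a := (1 : ENNReal))).aemeasurable
  simp only [Pi.mul_apply, mul_one, ENNReal.one_rpow, hμ] at h2
  calc (∫⁻ y, h y ∂μ) ^ 2 ≤ ((∫⁻ y, h y ^ (2 : ℝ) ∂μ) ^ (1 / 2 : ℝ)) ^ 2 := by gcongr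
    _ = ∫⁻ y, h y ^ 2 ∂μ := by
      rw [← ENNReal.rpow_natCast, ← ENNReal.rpow_mul]
      simp

/-- As `η` has mass one, the error at `x` is the `η`-average of `g (x - y) - g x`. Jensen and
Tonelli reduce convergence of mollification to continuity of translations in `L²`. -/
theorem eLpNorm_conv_sub_sq_le {η g : Space d → ℝ} (hη : IsSmoothCompact η)
    (h0 : ∀ x, 0 ≤ η x) (h1 : ∫ x, η x = 1) (hgm : Measurable g) (hg : LocallyIntegrable g) :
    eLpNorm (fun x => conv η g x - g x) 2 ^ 2 ≤
      ∫⁻ y, ENNReal.ofReal (η y) * eLpNorm (fun x => g (x - y) - g x) 2 ^ 2 := by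
  have hηi : Integrable η := hη.1.continuous.integrable_of_hasCompactSupport hη.2
  have hρ : Measurable fun y => ENNReal.ofReal (η y) := hη.1.continuous.measurable.ennreal_ofReal
  have hρ1 : ∫⁻ y, ENNReal.ofReal (η y) = 1 := by
    rw [← ofReal_integral_eq_lintegral_ofReal hηi (Eventually.of_forall h0), h1,
      ENNReal.ofReal_one]
  have hpt : ∀ x, ‖conv η g x - g x‖ₑ ^ 2 ≤
      ∫⁻ y, ENNReal.ofReal (η y) * ‖g (x - y) - g x‖ₑ ^ 2 := by
    intro x
    have e1 : conv η g x = ∫ y, η y * g (x - y) := by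
      rw [conv, ← integral_sub_left_eq_self (fun y => η y * g (x - y)) volume x]
      simp
    have hi : Integrable fun y => η y * g (x - y) := by
      have hc : MeasureTheory.ConvolutionExistsAt η g x (ContinuousLinearMap.mul ℝ ℝ) volume :=
        hη.2.convolutionExists_left _ hη.1.continuous hg x
      exact hc.integrable
    have e2 : conv η g x - g x = ∫ y, η y * (g (x - y) - g x) := by
      simp only [mul_sub]
      rw [integral_sub hi (hηi.mul_const _), integral_mul_const, h1, one_mul, e1]
    rw [e2]
    refine le_trans ?_ (lintegral_sq_le hρ hρ1 (h := fun y => ‖g (x - y) - g x‖ₑ)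
      (by fun_prop))
    gcongr
    refine (enorm_integral_le_lintegral_enorm _).trans (le_of_eq ?_)
    refine lintegral_congr fun y => ?_
    rw [enorm_mul, Real.enorm_of_nonneg (h0 y)]
  rw [eLpNorm_two_sq]
  refine (lintegral_mono hpt).trans (le_of_eq ?_)
  rw [lintegral_lintegral_swap]
  · refine lintegral_congr fun y => ?_
    rw [eLpNorm_two_sq, lintegral_const_mul' _ _ ENNReal.ofReal_ne_top]
  · refine Measurable.aemeasurable ?_
    have : Measurable fun q : Space d × Space d =>
        ENNReal.ofReal (η q.2) * ‖g (q.1 - q.2) - g q.1‖ₑ ^ 2 :=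
      (hρ.comp measurable_snd).mul (((hgm.comp (by fun_prop)).sub
        (hgm.comp measurable_fst)).enorm.pow_const 2)
    exact this

theorem norm_le_of_scaledMollifier_ne_zero {σ : ℝ} (hσ : 0 < σ) {x : Space d}
    (hx : scaledMollifier σ x ≠ 0) : ‖x‖ ≤ √d * σ := by
  rw [EuclideanSpace.norm_eq]
  have : ∑ j, ‖x j‖ ^ 2 ≤ (√d * σ) ^ 2 := by
    rw [mul_pow, Real.sq_sqrt (Nat.cast_nonneg _)]
    calc ∑ j, ‖x j‖ ^ 2 ≤ ∑ _j : Fin d, σ ^ 2 := by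
          refine Finset.sum_le_sum fun j _ => pow_le_pow_left₀ (norm_nonneg _) ?_ 2
          have := abs_lt_of_scaledMollifier_ne_zero hσ hx j
          rw [Real.norm_eq_abs]; linarith
      _ = d * σ ^ 2 := by simp
  exact Real.sqrt_le_iff.2 ⟨by positivity, this⟩

theorem tendsto_eLpNorm_conv_sub {g : Space d → ℝ} (hgm : Measurable g) (hg : MemLp g 2) :
    Tendsto (fun δ => eLpNorm (fun x => conv (scaledMollifier δ) g x - g x) 2)
      (𝓝[>] (0 : ℝ)) (𝓝 0) := by
  rw [ENNReal.tendsto_nhds_zero]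
  intro ε hε
  have h := ENNReal.tendsto_nhds_zero.1 (tendsto_eLpNorm_translate hg) ε hε
  obtain ⟨r, hr, hball⟩ := Metric.eventually_nhds_iff.1 h
  have hev : ∀ᶠ δ : ℝ in 𝓝[>] 0, √d * δ < r := by
    have : Tendsto (fun δ : ℝ => √d * δ) (𝓝[>] 0) (𝓝 0) := by
      have h := (continuous_const_mul (√d : ℝ)).tendsto (0 : ℝ)
      rw [mul_zero] at h
      exact h.mono_left nhdsWithin_le_nhds
    exact this.eventually (gt_mem_nhds hr)
  filter_upwards [hev, self_mem_nhdsWithin] with δ hδ hδ0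
  have hδ0 : 0 < δ := hδ0
  have hη := isSmoothCompact_scaledMollifier (d := d) hδ0
  have h1 := eLpNorm_conv_sub_sq_le hη (scaledMollifier_nonneg hδ0)
    (integral_scaledMollifier hδ0) hgm (hg.locallyIntegrable (by norm_num))
  have h2 : ∫⁻ y, ENNReal.ofReal (scaledMollifier δ y) *
      eLpNorm (fun x => g (x - y) - g x) 2 ^ 2 ≤ ε ^ 2 := by
    calc _ ≤ ∫⁻ y : Space d, ENNReal.ofReal (scaledMollifier δ y) * ε ^ 2 := by
          refine lintegral_mono fun y => ?_
          by_cases hy : scaledMollifier δ y = 0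
          · simp [hy]
          · gcongr
            refine hball ?_
            rw [dist_zero_right]
            exact (norm_le_of_scaledMollifier_ne_zero hδ0 hy).trans_lt hδ
      _ = ε ^ 2 := by
          rw [lintegral_mul_const _ hη.1.continuous.measurable.ennreal_ofReal,
            ← ofReal_integral_eq_lintegral_ofReal
              (hη.1.continuous.integrable_of_hasCompactSupport hη.2)
              (Eventually.of_forall (scaledMollifier_nonneg hδ0)),
            integral_scaledMollifier hδ0, ENNReal.ofReal_one, one_mul]
  exact (ENNReal.pow_right_strictMono two_ne_zero).le_iff_le.1 (h1.trans h2)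

/-! ### Cutoff -/

theorem partialDeriv_mul {f g : Space d → ℝ} (hf : ContDiff ℝ ∞ f) (hg : ContDiff ℝ ∞ g)
    (j : Fin d) : partialDeriv j (fun x => f x * g x) =
      fun x => partialDeriv j f x * g x + f x * partialDeriv j g x := by
  funext x
  simp only [partialDeriv]
  rw [fderiv_fun_mul (hf.differentiable (by simp) x) (hg.differentiable (by simp) x)]
  simp only [add_apply, smul_apply, smul_eq_mul]
  ring

theorem tendsto_eLpNorm_cutoff {χ f : Space d → ℝ} (hχ : IsSmoothCompact χ) (hf : MemLp f 2) :
    Tendsto (fun r : ℝ => eLpNorm (fun x => χ (r • x) * f x - χ 0 * f x) 2) (𝓝 0) (𝓝 0) := by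
  obtain ⟨M, hM⟩ := hχ.1.continuous.bounded_above_of_compact_support hχ.2
  have h : Tendsto (fun r : ℝ => ∫⁻ x, ‖χ (r • x) * f x - χ 0 * f x‖ₑ ^ 2) (𝓝 0)
      (𝓝 (∫⁻ _ : Space d, 0)) := by
    refine tendsto_lintegral_filter_of_dominated_convergence'
      (fun x => ENNReal.ofReal (2 * M) ^ 2 * ‖f x‖ₑ ^ 2) ?_ ?_ ?_ ?_
    · refine Eventually.of_forall fun r => ?_
      have : AEStronglyMeasurable (fun x => χ (r • x)) (volume : Measure (Space d)) :=
        (hχ.1.continuous.comp (by fun_prop)).aestronglyMeasurable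
      exact ((this.mul hf.1).sub (hf.1.const_mul _)).enorm.pow_const 2
    · refine Eventually.of_forall fun r => Eventually.of_forall fun x => ?_
      rw [← sub_mul, enorm_mul, mul_pow]
      gcongr
      rw [← ofReal_norm]
      refine ENNReal.ofReal_le_ofReal ((norm_sub_le _ _).trans ?_)
      linarith [hM (r • x), hM 0]
    · rw [lintegral_const_mul' _ _ (ENNReal.pow_ne_top ENNReal.ofReal_ne_top), ← eLpNorm_two_sq]
      exact ENNReal.mul_ne_top (ENNReal.pow_ne_top ENNReal.ofReal_ne_top)
        (ENNReal.pow_ne_top hf.2.ne)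
    · refine Eventually.of_forall fun x => ?_
      have hc : Continuous fun r : ℝ => ‖χ (r • x) * f x - χ 0 * f x‖ₑ ^ 2 := by
        have := hχ.1.continuous
        have h2 : Continuous fun r : ℝ => χ (r • x) * f x - χ 0 * f x := by fun_prop
        exact (ENNReal.continuous_pow 2).comp h2.enorm
      simpa using hc.tendsto 0
  rw [lintegral_zero] at h
  simp only [← eLpNorm_two_sq] at h
  have h3 := (ENNReal.continuous_rpow_const (y := 1 / 2)).tendsto 0 |>.comp h
  rw [ENNReal.zero_rpow_of_pos (by norm_num)] at h3
  refine h3.congr fun r => ?_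
  simp only [Function.comp]
  rw [← ENNReal.rpow_natCast, ← ENNReal.rpow_mul]
  simp

/-- By the Leibniz rule, a derivative that falls on the cutoff `χ (r • ·)` brings out a factor `r`,
and what it multiplies stays bounded in `L²`. -/
theorem tendsto_eLpNorm_wordDeriv_cutoff (l : List (Fin d)) :
    ∀ {χ f : Space d → ℝ}, IsSmoothCompact χ → ContDiff ℝ ∞ f →
      (∀ l' : List (Fin d), l'.length ≤ l.length → MemLp (wordDeriv l' f) 2) →
      Tendsto (fun r : ℝ => eLpNorm (fun x => wordDeriv l (fun y => χ (r • y) * f y) x -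
        χ 0 * wordDeriv l f x) 2) (𝓝 0) (𝓝 0) := by
  -- The innermost letter is removed first. The induction hypothesis is then applied to the pairs
  -- `(∂_j χ, f)` and `(χ, ∂_j f)`, which is why `χ` and `f` are quantified inside the induction.
  induction l using List.reverseRecOn with
  | nil =>
    intro χ f hχ _ hL
    exact tendsto_eLpNorm_cutoff hχ (hL [] le_rfl)
  | append_singleton l j ih =>
    intro χ f hχ hf hL
    have hA := ih (hχ.partialDeriv j) hf fun l' hl' => hL l' (by simp; omega)
    have hB := ih hχ (contDiff_partialDeriv hf j) fun l' hl' => by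
      have := hL (l' ++ [j]) (by simpa using hl')
      rwa [wordDeriv_append] at this
    have hN : MemLp (fun x => partialDeriv j χ 0 * wordDeriv l f x) 2 :=
      (hL l (by simp)).const_mul _
    set N := eLpNorm (fun x => partialDeriv j χ 0 * wordDeriv l f x) 2
    have hmaj : Tendsto (fun r : ℝ => ‖r‖ₑ *
        (eLpNorm (fun x => wordDeriv l (fun y => partialDeriv j χ (r • y) * f y) x -
          partialDeriv j χ 0 * wordDeriv l f x) 2 + N) +
        eLpNorm (fun x => wordDeriv l (fun y => χ (r • y) * partialDeriv j f y) x -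
          χ 0 * wordDeriv l (partialDeriv j f) x) 2) (𝓝 0) (𝓝 0) := by
      have h1 : Tendsto (fun r : ℝ => ‖r‖ₑ) (𝓝 0) (𝓝 0) := by
        simpa using (continuous_enorm (E := ℝ)).tendsto 0
      have h2 := ENNReal.Tendsto.mul h1 (Or.inr (by simpa using hN.2.ne))
        (hA.add (tendsto_const_nhds (x := N))) (Or.inr (by simp))
      simpa using h2.add hB
    refine tendsto_of_tendsto_of_tendsto_of_le_of_le tendsto_const_nhds hmaj
      (fun _ => zero_le) fun r => ?_
    have sχ : ∀ {ψ : Space d → ℝ}, IsSmoothCompact ψ → ContDiff ℝ ∞ fun y => ψ (r • y) :=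
      fun hψ => hψ.1.comp (by fun_prop)
    have sA : ContDiff ℝ ∞ fun y => partialDeriv j χ (r • y) * f y :=
      (sχ (hχ.partialDeriv j)).mul hf
    have sB : ContDiff ℝ ∞ fun y => χ (r • y) * partialDeriv j f y :=
      (sχ hχ).mul (contDiff_partialDeriv hf j)
    have hleib : partialDeriv j (fun y => χ (r • y) * f y) =
        r • (fun y => partialDeriv j χ (r • y) * f y) +
          fun y => χ (r • y) * partialDeriv j f y := by
      rw [partialDeriv_mul (sχ hχ) hf]
      have := partialDeriv_comp_affine hχ.1 r 0 j
      simp only [add_zero] at this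
      rw [this]
      funext x
      simp [mul_assoc]
    have e1 : wordDeriv (l ++ [j]) (fun y => χ (r • y) * f y) =
        r • wordDeriv l (fun y => partialDeriv j χ (r • y) * f y) +
          wordDeriv l (fun y => χ (r • y) * partialDeriv j f y) := by
      rw [wordDeriv_append, show wordDeriv [j] (fun y => χ (r • y) * f y) = _ from hleib,
        wordDeriv_add (f := r • fun y => partialDeriv j χ (r • y) * f y) (sA.const_smul r) sB, wordDeriv_const_smul sA]
    have e2 : (fun x => wordDeriv (l ++ [j]) (fun y => χ (r • y) * f y) x -
        χ 0 * wordDeriv (l ++ [j]) f x) =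
        r • ((fun x => wordDeriv l (fun y => partialDeriv j χ (r • y) * f y) x -
          partialDeriv j χ 0 * wordDeriv l f x) +
          fun x => partialDeriv j χ 0 * wordDeriv l f x) +
        fun x => wordDeriv l (fun y => χ (r • y) * partialDeriv j f y) x -
          χ 0 * wordDeriv l (partialDeriv j f) x := by
      rw [e1]
      funext x
      simp only [Pi.add_apply, Pi.smul_apply, smul_eq_mul, wordDeriv_append]
      change _ - χ 0 * wordDeriv l (partialDeriv j f) x = _
      ring
    have cont : ∀ {ψ : Space d → ℝ}, ContDiff ℝ ∞ ψ → ∀ l,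
        AEStronglyMeasurable (wordDeriv l ψ) (volume : Measure (Space d)) := fun hψ l =>
      (contDiff_wordDeriv hψ l).continuous.aestronglyMeasurable
    rw [e2]
    have mA := (cont sA l).sub (hN.1)
    have mB := (cont sB l).sub ((cont (contDiff_partialDeriv hf j) l).const_mul (χ 0))
    refine (eLpNorm_add_le ((mA.add hN.1).const_smul r) mB (by norm_num)).trans ?_
    refine add_le_add ?_ le_rfl
    rw [eLpNorm_const_smul]
    gcongr
    exact eLpNorm_add_le mA hN.1 (by norm_num)

/-! ### Density of smooth functions -/

theorem memLp_of_univ {g : Space d → ℝ} (h : MemLp g 2 (volume.restrict Set.univ)) :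
    MemLp g 2 := by
  rwa [Measure.restrict_univ] at h

/-- The function `y ↦ η (x - y)` is a test function. Its derivatives carry the same sign as the
definition of the weak derivative, and the signs cancel. -/
theorem multiDeriv_conv_sobolev {k : ℕ} (u : sobolev k (Set.univ : Set (Space d)))
    {η : Space d → ℝ} (hη : IsSmoothCompact η) (α : multiIndices d k) :
    multiDeriv α.1 (conv η (u.1 (zeroIdx d k))) = conv η (u.1 α) := by
  have hloc : LocallyIntegrable (u.1 (zeroIdx d k) : Space d → ℝ) :=
    (memLp_of_univ (Lp.memLp (u.1 (zeroIdx d k)))).locallyIntegrable (by norm_num)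
  rw [multiDeriv_conv hη hloc]
  funext x
  -- The reflection is written as an affine map of factor `-1`, so that `multiDeriv_comp_affine`
  -- applies.
  have hφ : IsSmoothCompact fun y : Space d => η ((-1 : ℝ) • (y + -x)) := by
    refine ⟨hη.1.comp (by fun_prop), ?_⟩
    have := hη.2.comp_homeomorph (Homeomorph.subLeft x)
    convert this using 1
    funext y
    simp only [Function.comp, Homeomorph.coe_subLeft]
    congr 1
    module
  have h := u.2 α _ hφ.isTest
  simp only [Measure.restrict_univ] at h
  rw [multiDeriv_comp_affine hη.1] at h
  have e : ∀ y : Space d, (-1 : ℝ) • (y + -x) = x - y := fun y => by module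
  simp only [e] at h
  have h2 : ∀ y, u.1 (zeroIdx d k) y * ((-1) ^ (∑ j, α.1 j) * multiDeriv α.1 η (x - y)) =
      (-1) ^ (∑ j, α.1 j) * (multiDeriv α.1 η (x - y) * u.1 (zeroIdx d k) y) := fun y => by ring
  simp only [h2] at h
  rw [integral_const_mul] at h
  have h3 := mul_left_cancel₀ (pow_ne_zero _ (by norm_num : (-1 : ℝ) ≠ 0)) h
  refine h3.trans (integral_congr_ae (Eventually.of_forall fun y => ?_))
  simp only [mul_comm]

theorem norm_sobolev_le {k : ℕ} {Ω : Set (Space d)} (u : sobolev k Ω) {c : ℝ}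
    (h : ∀ α, ‖u.1 α‖ ≤ c) : ‖u‖ ≤ ((multiIndices d k).card + 1) * c := by
  have hc : 0 ≤ c := (norm_nonneg _).trans (h (zeroIdx d k))
  rw [← abs_of_nonneg (norm_nonneg u), ← abs_of_nonneg (by positivity : 0 ≤ (((multiIndices d k).card : ℝ) + 1) * c),
    ← sq_le_sq]
  have e : ‖u‖ ^ 2 = ∑ α, ‖u.1 α‖ ^ 2 := PiLp.norm_sq_eq_of_L2 _ u.1
  rw [e]
  calc ∑ α, ‖u.1 α‖ ^ 2 ≤ ∑ _α : multiIndices d k, c ^ 2 :=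
        Finset.sum_le_sum fun α _ => pow_le_pow_left₀ (norm_nonneg _) (h α) 2
    _ = (multiIndices d k).card * c ^ 2 := by simp
    _ ≤ _ := by
      rw [mul_pow]
      gcongr
      nlinarith [Nat.cast_nonneg (α := ℝ) (multiIndices d k).card]

/-- Mollification makes `u` smooth, and a wide cutoff then gives compact support. Each may cost `η /
2` in every derivative, where `η` compensates the constant of `norm_sobolev_le`. -/
theorem exists_smooth_approx (k : ℕ) (u : sobolev k (Set.univ : Set (Space d))) {δ : ℝ}
    (hδ : 0 < δ) : ∃ (f : Space d → ℝ) (hf : IsSmoothCompact f),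
      ‖u - smoothToSobolev k Set.univ hf‖ ≤ δ := by
  set η : ℝ := δ / ((multiIndices d k).card + 1) with hη
  have hη0 : 0 < η := by positivity
  have hη2 : (0 : ENNReal) < ENNReal.ofReal (η / 2) := ENNReal.ofReal_pos.2 (by positivity)
  have hmem : ∀ α, MemLp (u.1 α : Space d → ℝ) 2 := fun α =>
    memLp_of_univ (Lp.memLp (u.1 α))
  have hev : ∀ᶠ t in 𝓝[>] (0 : ℝ), ∀ α, eLpNorm (fun x => conv (scaledMollifier t) (u.1 α) x -
      u.1 α x) 2 ≤ ENNReal.ofReal (η / 2) := eventually_all.2 fun α =>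
    ENNReal.tendsto_nhds_zero.1 (tendsto_eLpNorm_conv_sub
      (Lp.stronglyMeasurable (u.1 α)).measurable (hmem α)) _ hη2
  obtain ⟨t, ht, ht0⟩ := (hev.and self_mem_nhdsWithin).exists
  have ht0 : 0 < t := ht0
  have hζ := isSmoothCompact_scaledMollifier (d := d) ht0
  set f₁ := conv (scaledMollifier t) (u.1 (zeroIdx d k)) with hf₁
  have hf₁s : ContDiff ℝ ∞ f₁ := contDiff_conv hζ ((hmem _).locallyIntegrable (by norm_num))
  have hd : ∀ α : multiIndices d k, multiDeriv α.1 f₁ = conv (scaledMollifier t) (u.1 α) :=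
    multiDeriv_conv_sobolev u hζ
  have hcm : ∀ {ψ : Space d → ℝ}, ContDiff ℝ ∞ ψ → ∀ α,
      AEStronglyMeasurable (multiDeriv α ψ) (volume : Measure (Space d)) := fun hψ α =>
    (contDiff_multiDeriv hψ α).continuous.aestronglyMeasurable
  have hdm : ∀ α : multiIndices d k, MemLp (multiDeriv α.1 f₁) 2 := by
    intro α
    have h1 : MemLp (fun x => multiDeriv α.1 f₁ x - u.1 α x) 2 :=
      ⟨(hcm hf₁s _).sub (hmem α).1, by
        rw [hd α]; exact (ht α).trans_lt ENNReal.ofReal_lt_top⟩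
    have h2 := h1.add (hmem α)
    rwa [show (fun x => multiDeriv α.1 f₁ x - u.1 α x) + (u.1 α : Space d → ℝ) =
      multiDeriv α.1 f₁ from funext fun x => by simp] at h2
  have hwm : ∀ l : List (Fin d), l.length ≤ k → MemLp (wordDeriv l f₁) 2 := by
    intro l hl
    rw [wordDeriv_eq_multiDeriv hf₁s]
    refine hdm ⟨_, mem_multiIndices.2 ?_⟩
    exact (mem_multiIndicesEq.1 (count_mem_multiIndicesEq l)).le.trans hl
  let b : ContDiffBump (0 : Space d) := ⟨1, 2, one_pos, one_lt_two⟩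
  have hχ : IsSmoothCompact (b : Space d → ℝ) := ⟨b.contDiff, b.hasCompactSupport⟩
  have hχ0 : b 0 = 1 := b.eventuallyEq_one.eq_of_nhds
  have hev2 : ∀ᶠ r in 𝓝 (0 : ℝ), ∀ α : multiIndices d k,
      eLpNorm (fun x => multiDeriv α.1 (fun y => b (r • y) * f₁ y) x - multiDeriv α.1 f₁ x) 2 ≤
        ENNReal.ofReal (η / 2) := by
    refine eventually_all.2 fun α => ?_
    have h := tendsto_eLpNorm_wordDeriv_cutoff (idxWord α.1) hχ hf₁s fun l' hl' =>
      hwm l' (hl'.trans (by rw [length_idxWord]; exact mem_multiIndices.1 α.2))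
    simp only [hχ0, one_mul, ← multiDeriv_eq_wordDeriv] at h
    exact ENNReal.tendsto_nhds_zero.1 h _ hη2
  obtain ⟨r, hr, hr0⟩ := ((hev2.filter_mono nhdsWithin_le_nhds).and
    (self_mem_nhdsWithin (s := Set.Ioi (0 : ℝ)))).exists
  have hr0 : 0 < r := hr0
  set f : Space d → ℝ := fun y => b (r • y) * f₁ y with hf
  have hfs : IsSmoothCompact f := by
    refine ⟨(hχ.1.comp (by fun_prop)).mul hf₁s, HasCompactSupport.mul_right ?_⟩
    exact hχ.2.comp_homeomorph (Homeomorph.smulOfNeZero r hr0.ne')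
  refine ⟨f, hfs, ?_⟩
  have hfin := norm_sobolev_le (u - smoothToSobolev k Set.univ hfs) (c := η) fun α => ?_
  · refine hfin.trans (le_of_eq ?_)
    rw [hη]; field_simp
  change ‖u.1 α - ((hfs.multiDeriv α.1).memLp Set.univ).toLp _‖ ≤ η
  rw [Lp.norm_def]
  refine ENNReal.toReal_le_of_le_ofReal hη0.le ?_
  have e : (u.1 α - ((hfs.multiDeriv α.1).memLp Set.univ).toLp _ : L2 _) =ᵐ[volume.restrict Set.univ]
      fun x => -((multiDeriv α.1 f x - multiDeriv α.1 f₁ x) +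
        (multiDeriv α.1 f₁ x - u.1 α x)) := by
    filter_upwards [Lp.coeFn_sub (u.1 α) (((hfs.multiDeriv α.1).memLp Set.univ).toLp _),
      ((hfs.multiDeriv α.1).memLp Set.univ).coeFn_toLp] with x h1 h2
    rw [h1, Pi.sub_apply, h2]; ring
  have hru : ∀ g : Space d → ℝ, eLpNorm g 2 (volume.restrict Set.univ) = eLpNorm g 2 volume :=
    fun g => by rw [Measure.restrict_univ]
  rw [eLpNorm_congr_ae e, hru]
  have hneg := eLpNorm_neg (p := 2) (μ := (volume : Measure (Space d)))
    (f := (fun x => multiDeriv α.1 f x - multiDeriv α.1 f₁ x) +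
      fun x => multiDeriv α.1 f₁ x - u.1 α x)
  refine (le_of_eq hneg).trans ((eLpNorm_add_le ((hcm hfs.1 _).sub (hcm hf₁s _))
    ((hcm hf₁s _).sub (hmem α).1) (by norm_num)).trans ?_)
  have h1 := hr α
  have h2 := ht α
  rw [← hd α] at h2
  refine (add_le_add h1 h2).trans (le_of_eq ?_)
  rw [← ENNReal.ofReal_add (by positivity) (by positivity), add_halves]

end SmoothPUFEM

/-! ### Estimates on elements by finite dimensionality and scaling. -/

namespace SmoothPUFEM

variable {d : ℕ}

/-! ### Derivatives as elements of `L²` -/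

/-- The smooth compactly supported functions. -/
def smoothFns (d : ℕ) : Submodule ℝ (Space d → ℝ) where
  carrier := {f | IsSmoothCompact f}
  zero_mem' := ⟨contDiff_const, HasCompactSupport.zero⟩
  add_mem' := fun hf hg => ⟨hf.1.add hg.1, hf.2.add hg.2⟩
  smul_mem' := fun c _ hf => ⟨contDiff_const.smul hf.1, hf.2.smul_left (f := fun _ => c)⟩

theorem pufem_le_smoothFns {P : ℕ} {σ : ℝ} (hσ : 0 < σ) : pufem d P σ ≤ smoothFns d :=
  fun _ hv => isSmoothCompact_of_mem_pufem hσ hv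

/-- The restriction of `∂^α f` to `U` as an element of `L²(U)`. -/
noncomputable def derivL2 (U : Set (Space d)) (α : Fin d → ℕ) : smoothFns d →ₗ[ℝ] L2 U where
  toFun f := (IsSmoothCompact.memLp (IsSmoothCompact.multiDeriv f.2 α) U).toLp _
  map_add' f g := by
    rw [← MemLp.toLp_add]
    exact MemLp.toLp_congr _ _ (Filter.EventuallyEq.of_eq (multiDeriv_add f.2.1 g.2.1 α))
  map_smul' c f := by
    rw [RingHom.id_apply, ← MemLp.toLp_const_smul]
    exact MemLp.toLp_congr _ _ (Filter.EventuallyEq.of_eq (multiDeriv_const_smul f.2.1 c α))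

theorem coeFn_derivL2 (U : Set (Space d)) (α : Fin d → ℕ) (f : smoothFns d) :
    derivL2 U α f =ᵐ[volume.restrict U] multiDeriv α f.1 :=
  MemLp.coeFn_toLp (IsSmoothCompact.memLp (IsSmoothCompact.multiDeriv f.2 α) U)

theorem inner_derivL2 (U : Set (Space d)) (α β : Fin d → ℕ) (f g : smoothFns d) :
    inner ℝ (derivL2 U α f) (derivL2 U β g) =
      ∫ x in U, multiDeriv α f.1 x * multiDeriv β g.1 x := by
  rw [L2.inner_def]
  refine integral_congr_ae ?_
  filter_upwards [coeFn_derivL2 U α f, coeFn_derivL2 U β g] with x h1 h2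
  rw [h1, h2]; simp [mul_comm]

theorem norm_sq_derivL2 (U : Set (Space d)) (α : Fin d → ℕ) (f : smoothFns d) :
    ‖derivL2 U α f‖ ^ 2 = ∫ x in U, multiDeriv α f.1 x ^ 2 := by
  rw [← real_inner_self_eq_norm_sq, inner_derivL2]
  simp only [pow_two]

/-- Continuous functions that agree almost everywhere on an open set agree everywhere on it. This
turns kernels of `L²` maps into pointwise statements. -/
theorem derivL2_eq_zero_iff {U : Set (Space d)} (hU : IsOpen U) (α : Fin d → ℕ)
    (f : smoothFns d) : derivL2 U α f = 0 ↔ Set.EqOn (multiDeriv α f.1) 0 U := by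
  rw [Lp.eq_zero_iff_ae_eq_zero]
  constructor
  · intro h
    refine Measure.eqOn_open_of_ae_eq ((coeFn_derivL2 U α f).symm.trans h) hU ?_ continuousOn_const
    exact (contDiff_multiDeriv f.2.1 α).continuous.continuousOn
  · intro h
    refine (coeFn_derivL2 U α f).trans ?_
    exact (ae_restrict_mem hU.measurableSet).mono fun x hx => h hx

/-- If `T` determines `S`, then `S` factors through the range of `T`, and linear maps on a
finite-dimensional space are bounded. Local inequalities thus reduce to statements about kernels. -/
theorem exists_norm_le_of_ker_le {E X Y : Type*} [AddCommGroup E] [Module ℝ E]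
    [FiniteDimensional ℝ E] [NormedAddCommGroup X] [NormedSpace ℝ X] [NormedAddCommGroup Y]
    [NormedSpace ℝ Y] (S : E →ₗ[ℝ] X) (T : E →ₗ[ℝ] Y) (h : ∀ v, T v = 0 → S v = 0) :
    ∃ C : ℝ, 0 ≤ C ∧ ∀ v, ‖S v‖ ≤ C * ‖T v‖ := by
  obtain ⟨g, hg⟩ := T.rangeRestrict.exists_rightInverse_of_surjective T.range_rangeRestrict
  let S' : LinearMap.range T →L[ℝ] X := (S ∘ₗ g).toContinuousLinearMap
  refine ⟨‖S'‖, ContinuousLinearMap.opNorm_nonneg S', fun v => ?_⟩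
  have e : S v = S' (T.rangeRestrict v) := by
    have h1 : T.rangeRestrict (g (T.rangeRestrict v)) = T.rangeRestrict v :=
      LinearMap.congr_fun hg _
    have h2 : T (v - g (T.rangeRestrict v)) = 0 := by
      have : T (g (T.rangeRestrict v)) = T v := congrArg Subtype.val h1
      rw [map_sub, this, sub_self]
    have h3 := h _ h2
    rw [map_sub, sub_eq_zero] at h3
    exact h3
  rw [e]
  exact S'.le_opNorm _

/-! ### Finite-dimensional representation on bounded sets -/

/-- Only finitely many partition functions meet a bounded set. `F` plays the role of the space of
restrictions to `B`, but consists of functions on the whole space. -/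
theorem exists_finiteDimensional_rep (P : ℕ) {σ : ℝ} (hσ : 0 < σ) {B : Set (Space d)}
    (hB : Bornology.IsBounded B) :
    ∃ F : Submodule ℝ (Space d → ℝ), F ≤ pufem d P σ ∧ FiniteDimensional ℝ F ∧
      ∀ w ∈ pufem d P σ, ∃ v ∈ F, Set.EqOn w v B := by
  obtain ⟨R, hR⟩ := hB.exists_norm_le
  obtain ⟨L, hL⟩ := exists_nat_ge ((R + σ) / σ)
  let gen : (Fin d → ℤ) × (Fin d → ℕ) → Space d → ℝ :=
    fun q x => pou σ q.1 x * ∏ j, x j ^ q.2 j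
  let s : Set (Space d → ℝ) := gen '' ((box d L ×ˢ multiIndices d P : Finset _) : Set _)
  have hs : s.Finite := (Finset.finite_toSet _).image _
  have hmul : ∀ n ∈ box d L, ∀ v ∈ polySpace d P,
      (fun x => pou σ n x * v x) ∈ Submodule.span ℝ s := by
    intro n hn v hv
    unfold polySpace at hv
    induction hv using Submodule.span_induction with
    | mem f hf =>
      obtain ⟨α, hα, rfl⟩ := hf
      exact Submodule.subset_span ⟨(n, α), by
        simpa using And.intro hn hα, rfl⟩
    | zero => simp only [Pi.zero_apply, mul_zero]; exact Submodule.zero_mem _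
    | add f g _ _ hf hg =>
      simp only [Pi.add_apply, mul_add]; exact Submodule.add_mem _ hf hg
    | smul c f _ hf =>
      simp only [Pi.smul_apply, smul_eq_mul, mul_left_comm _ c]; exact Submodule.smul_mem _ c hf
  have hout : ∀ n ∉ box d L, ∀ x ∈ B, pou σ n x = 0 := by
    intro n hn x hx
    by_contra h
    refine hn (mem_box.2 fun j => ?_)
    have h1 := abs_lt_of_pou_ne_zero hσ h j
    have h2 : |x j| ≤ R := (PiLp.norm_apply_le x j).trans (hR x hx)
    have h3 : |(n j : ℝ)| * σ < R + σ := by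
      rw [← abs_of_pos hσ, ← abs_mul, abs_of_pos hσ]
      have := abs_sub_abs_le_abs_sub ((n j : ℝ) * σ) (x j)
      rw [abs_sub_comm] at this
      linarith
    have h4 : |(n j : ℝ)| < L := ((lt_div_iff₀ hσ).2 h3).trans_le hL
    exact_mod_cast h4.le
  refine ⟨Submodule.span ℝ s, ?_, FiniteDimensional.span_of_finite ℝ hs, ?_⟩
  · rw [Submodule.span_le]
    rintro _ ⟨⟨n, α⟩, hq, rfl⟩
    simp only [Finset.coe_product, Set.mem_prod, Finset.mem_coe] at hq
    exact Submodule.subset_span ⟨n, _, Submodule.subset_span ⟨α, hq.2, rfl⟩, rfl⟩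
  · intro w hw
    unfold pufem at hw
    induction hw using Submodule.span_induction with
    | mem f hf =>
      obtain ⟨n, v, hv, rfl⟩ := hf
      by_cases hn : n ∈ box d L
      · exact ⟨_, hmul n hn v hv, fun _ _ => rfl⟩
      · exact ⟨0, Submodule.zero_mem _, fun x hx => by simp [hout n hn x hx]⟩
    | zero => exact ⟨0, Submodule.zero_mem _, fun _ _ => rfl⟩
    | add f g _ _ hf hg =>
      obtain ⟨v, hv, hv'⟩ := hf
      obtain ⟨v₂, hv₂, hv₂'⟩ := hg
      exact ⟨v + v₂, Submodule.add_mem _ hv hv₂, fun x hx => by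
        simp [hv' hx, hv₂' hx]⟩
    | smul c f _ hf =>
      obtain ⟨v, hv, hv'⟩ := hf
      exact ⟨c • v, Submodule.smul_mem _ c hv, fun x hx => by simp [hv' hx]⟩

/-! ### The inverse estimate -/

/-- A function that vanishes on an open element has vanishing derivatives there, which is the
required inclusion of kernels. -/
theorem inverse_estimate_unit (P : ℕ) (α : Fin d → ℕ) :
    ∃ C : ℝ, 0 ≤ C ∧ ∀ w ∈ pufem d P 1,
      ∫ x in element 1 0, multiDeriv α w x ^ 2 ≤ C * ∫ x in element 1 0, w x ^ 2 := by
  obtain ⟨F, hF, hfin, hrep⟩ := exists_finiteDimensional_rep P one_pos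
    (isBounded_element (d := d) 1 0)
  have hFs : F ≤ smoothFns d := hF.trans (pufem_le_smoothFns one_pos)
  let ι : F →ₗ[ℝ] smoothFns d := Submodule.inclusion hFs
  have hopen := isOpen_element (d := d) 1 0
  obtain ⟨C, hC0, hC⟩ := exists_norm_le_of_ker_le ((derivL2 (element 1 0) α) ∘ₗ ι)
    ((derivL2 (element 1 0) 0) ∘ₗ ι) (by
      intro v hv
      simp only [LinearMap.comp_apply, derivL2_eq_zero_iff hopen] at hv ⊢
      rw [multiDeriv_zero] at hv
      have := multiDeriv_congr_of_isOpen hopen hv α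
      rwa [multiDeriv_zero_fun] at this)
  refine ⟨C ^ 2, sq_nonneg _, fun w hw => ?_⟩
  obtain ⟨v, hv, hwv⟩ := hrep w hw
  have h1 := pow_le_pow_left₀ (norm_nonneg _) (hC ⟨v, hv⟩) 2
  rw [mul_pow, LinearMap.comp_apply, LinearMap.comp_apply, norm_sq_derivL2,
    norm_sq_derivL2, multiDeriv_zero] at h1
  have e1 : ∫ x in element 1 0, multiDeriv α w x ^ 2 = ∫ x in element 1 0, multiDeriv α v x ^ 2 :=
    setIntegral_congr_fun hopen.measurableSet fun x hx => by
      simp only [multiDeriv_congr_of_isOpen hopen hwv α hx]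
  have e2 : ∫ x in element 1 0, w x ^ 2 = ∫ x in element 1 0, v x ^ 2 :=
    setIntegral_congr_fun hopen.measurableSet fun x hx => by simp only [hwv hx]
  rw [e1, e2]
  exact h1

theorem inverse_estimate (P : ℕ) (α : Fin d → ℕ) :
    ∃ C : ℝ, 0 ≤ C ∧ ∀ σ : ℝ, 0 < σ → ∀ w ∈ pufem d P σ, ∀ i,
      σ ^ (2 * ∑ j, α j) * ∫ x in element σ i, multiDeriv α w x ^ 2 ≤
        C * ∫ x in element σ i, w x ^ 2 := by
  obtain ⟨C, hC0, hC⟩ := inverse_estimate_unit P α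
  refine ⟨C, hC0, fun σ hσ w hw i => ?_⟩
  have h := hC _ (comp_affine_mem_pufem hσ i hw)
  rw [multiDeriv_comp_affine (isSmoothCompact_of_mem_pufem hσ hw).1] at h
  have e := fun g => setIntegral_element g hσ i 0
  simp only [zero_add] at e
  rw [e, e]
  simp only [mul_pow, integral_const_mul] at h
  rw [← pow_mul, mul_comm _ 2] at h
  calc _ = σ ^ d * (σ ^ (2 * ∑ j, α j) *
        ∫ x in element 1 0, multiDeriv α w (σ • (x + gridPt i)) ^ 2) := by ring
    _ ≤ σ ^ d * (C * ∫ x in element 1 0, w (σ • (x + gridPt i)) ^ 2) := by gcongr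
    _ = _ := by ring

/-! ### The estimate between neighbours -/

theorem segment_mem_cube {a x y : Space d} {s : ℝ} (hx : ∀ j, a j ≤ x j ∧ x j ≤ a j + s)
    (hy : y ∈ cube a s) {t : ℝ} (ht : 0 < t) (ht1 : t ≤ 1) : x + t • (y - x) ∈ cube a s := by
  intro j
  have h1 := hx j
  have h2 := hy j
  simp only [PiLp.add_apply, PiLp.smul_apply, PiLp.sub_apply, smul_eq_mul]
  constructor
  · nlinarith [mul_nonneg (sub_nonneg.2 ht1) (sub_nonneg.2 h1.1), mul_pos ht (sub_pos.2 h2.1)]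
  · nlinarith [mul_nonneg (sub_nonneg.2 ht1) (sub_nonneg.2 h1.2), mul_pos ht (sub_pos.2 h2.2)]

theorem mem_closure_cube {a x : Space d} {s : ℝ} (hs : 0 < s)
    (hx : ∀ j, a j ≤ x j ∧ x j ≤ a j + s) : x ∈ closure (cube a s) := by
  have hc : (WithLp.toLp 2 fun j => a j + s / 2 : Space d) ∈ cube a s := fun j => by
    simp only; constructor <;> linarith
  set c : Space d := WithLp.toLp 2 fun j => a j + s / 2
  have ht : Filter.Tendsto (fun t : ℝ => x + t • (c - x)) (nhdsWithin 0 (Set.Ioi 0)) (nhds x) := by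
    have : Continuous fun t : ℝ => x + t • (c - x) := by fun_prop
    have h := this.tendsto 0
    simp only [zero_smul, add_zero] at h
    exact h.mono_left nhdsWithin_le_nhds
  refine mem_closure_of_tendsto ht ?_
  filter_upwards [Ioc_mem_nhdsGT (zero_lt_one : (0 : ℝ) < 1)] with t ht
  exact segment_mem_cube hx hc ht.1 ht.2

/-- Since `f` vanishes on the second cube and is smooth, all its derivatives vanish at the common
boundary point `c`. The Taylor polynomial at `c` is therefore zero, and the remainder only sees
derivatives of order `k + 1` on the segment from `c` to `x`, inside the first cube. A single shared
corner suffices. -/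
theorem eq_zero_of_deriv_eq_zero {f : Space d → ℝ} (hf : ContDiff ℝ ∞ f) {a a' c : Space d}
    {s : ℝ} (hs : 0 < s) (hc : ∀ j, a j ≤ c j ∧ c j ≤ a j + s)
    (hc' : ∀ j, a' j ≤ c j ∧ c j ≤ a' j + s) (h0 : Set.EqOn f 0 (cube a' s)) {k : ℕ}
    (hk : ∀ α ∈ multiIndicesEq d (k + 1), Set.EqOn (multiDeriv α f) 0 (cube a s)) :
    Set.EqOn f 0 (cube a s) := by
  have hcl : ∀ l : List (Fin d), wordDeriv l f c = 0 := by
    intro l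
    have h1 : Set.EqOn (wordDeriv l f) 0 (cube a' s) := by
      have := wordDeriv_congr_of_isOpen (isOpen_cube a' s) h0 l
      intro x hx
      rw [this hx]
      have hz := multiDeriv_zero_fun (d := d) fun j => l.count j
      rw [← wordDeriv_eq_multiDeriv (f := 0) contDiff_const] at hz
      rw [hz]
    have h2 := h1.closure (contDiff_wordDeriv hf l).continuous continuous_const
    exact h2 (mem_closure_cube hs hc')
  intro x hx
  have h := sub_taylorPoly_eq hf k c x
  have ht : taylorPoly (k + 1) f c x = 0 := by
    simp [taylorPoly, dirDeriv, hcl]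
  rw [ht, sub_zero] at h
  rw [h, Pi.zero_apply]
  have hz : ∀ t ∈ Set.Ioc (0 : ℝ) 1, (1 - t) ^ k / k.factorial *
      dirDeriv (k + 1) (x - c) f (c + t • (x - c)) = 0 := by
    intro t ht
    have hmem := segment_mem_cube hc hx ht.1 ht.2
    have : dirDeriv (k + 1) (x - c) f (c + t • (x - c)) = 0 := by
      refine Finset.sum_eq_zero fun w _ => ?_
      rw [wordDeriv_eq_multiDeriv hf, hk _ (by
        have := count_mem_multiIndicesEq (List.ofFn w)
        rwa [List.length_ofFn] at this) hmem]
      simp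
    rw [this, mul_zero]
  rw [intervalIntegral.integral_of_le zero_le_one,
    setIntegral_congr_fun measurableSet_Ioc hz, integral_zero]

theorem setIntegral_gradSq {f : Space d → ℝ} (hf : IsSmoothCompact f) (U : Set (Space d)) (k : ℕ) :
    ∫ x in U, gradSq k f x = ∑ α ∈ multiIndicesEq d k, ∫ x in U, multiDeriv α f x ^ 2 :=
  integral_finsetSum _ fun α _ => ((hf.multiDeriv α).memLp U).integrable_sq

theorem ghost_estimate_unit (P : ℕ) (n : Fin d → ℤ) (hn : n ∈ box d 1) :
    ∃ C : ℝ, 0 ≤ C ∧ ∀ w ∈ pufem d P 1, ∫ x in element 1 0, w x ^ 2 ≤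
      C * ((∫ x in element 1 n, w x ^ 2) + ∫ x in element 1 0, gradSq (P + 1) w x) := by
  obtain ⟨F, hF, hfin, hrep⟩ := exists_finiteDimensional_rep P one_pos
    ((isBounded_element (d := d) 1 0).union (isBounded_element (d := d) 1 n))
  have hFs : F ≤ smoothFns d := hF.trans (pufem_le_smoothFns one_pos)
  let ι : F →ₗ[ℝ] smoothFns d := Submodule.inclusion hFs
  have hopen := isOpen_element (d := d) 1
  let T : F →ₗ[ℝ] L2 (element (d := d) 1 n) × (multiIndicesEq d (P + 1) → L2 (element (d := d) 1 0)) :=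
    LinearMap.prod ((derivL2 (element 1 n) 0) ∘ₗ ι)
      (LinearMap.pi fun α => (derivL2 (element 1 0) α.1) ∘ₗ ι)
  obtain ⟨C, hC0, hC⟩ := exists_norm_le_of_ker_le ((derivL2 (element 1 0) 0) ∘ₗ ι) T (by
      intro v hv
      have h1 : derivL2 (element 1 n) 0 (ι v) = 0 := congrArg Prod.fst hv
      have h2 : ∀ α : multiIndicesEq d (P + 1), derivL2 (element 1 0) α.1 (ι v) = 0 := fun α =>
        congrFun (congrArg Prod.snd hv) α
      simp only [LinearMap.comp_apply, derivL2_eq_zero_iff (hopen _), multiDeriv_zero] at h1 h2 ⊢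
      rw [element_eq_cube] at h1 h2 ⊢
      have hn' := mem_box.1 hn
      -- For `|n j| ≤ 1` the intervals `[0, 1]` and `[n j, n j + 1]` both contain `max 0 (n j)`, so
      -- this is a common corner of the two elements.
      refine eq_zero_of_deriv_eq_zero (hFs v.2).1 (c := gridPt fun j => max 0 (n j)) one_pos
        (fun j => ?_) (fun j => ?_) h1 (k := P) fun α hα => h2 ⟨α, hα⟩
      · have := abs_le.1 (hn' j)
        simp only [PiLp.smul_apply, gridPt_apply, smul_eq_mul, one_mul, Pi.zero_apply]
        push_cast at this
        constructor
        · exact_mod_cast le_max_left 0 (n j)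
        · exact_mod_cast (by omega : max 0 (n j) ≤ 0 + 1)
      · have := abs_le.1 (hn' j)
        simp only [PiLp.smul_apply, gridPt_apply, smul_eq_mul, one_mul]
        push_cast at this
        constructor
        · exact_mod_cast le_max_right 0 (n j)
        · exact_mod_cast (by omega : max 0 (n j) ≤ n j + 1))
  refine ⟨C ^ 2, sq_nonneg _, fun w hw => ?_⟩
  obtain ⟨v, hv, hwv⟩ := hrep w hw
  have hvs : IsSmoothCompact v := hFs hv
  have h1 := pow_le_pow_left₀ (norm_nonneg _) (hC ⟨v, hv⟩) 2
  rw [mul_pow, LinearMap.comp_apply, norm_sq_derivL2, multiDeriv_zero] at h1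
  have hT : ‖T ⟨v, hv⟩‖ ^ 2 ≤ (∫ x in element 1 n, v x ^ 2) +
      ∫ x in element 1 0, gradSq (P + 1) v x := by
    have t1 : ‖(T ⟨v, hv⟩).1‖ ^ 2 = ∫ x in element 1 n, v x ^ 2 := by
      change ‖derivL2 (element 1 n) 0 (ι ⟨v, hv⟩)‖ ^ 2 = _
      rw [norm_sq_derivL2, multiDeriv_zero]; rfl
    have t2 : ‖(T ⟨v, hv⟩).2‖ ^ 2 ≤ ∫ x in element 1 0, gradSq (P + 1) v x := by
      have hnn : 0 ≤ ∫ x in element 1 0, gradSq (P + 1) v x :=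
        integral_nonneg fun x => gradSq_nonneg _ _ _
      rw [← Real.le_sqrt (norm_nonneg _) hnn, pi_norm_le_iff_of_nonneg (Real.sqrt_nonneg _)]
      intro α
      rw [Real.le_sqrt (norm_nonneg _) hnn]
      change ‖derivL2 (element 1 0) α.1 (ι ⟨v, hv⟩)‖ ^ 2 ≤ _
      rw [norm_sq_derivL2, setIntegral_gradSq hvs]
      exact Finset.single_le_sum (f := fun α => ∫ x in element 1 0, multiDeriv α v x ^ 2)
        (fun _ _ => integral_nonneg fun _ => sq_nonneg _) α.2
    rw [Prod.norm_def]
    rcases max_cases ‖(T ⟨v, hv⟩).1‖ ‖(T ⟨v, hv⟩).2‖ with ⟨h, _⟩ | ⟨h, _⟩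
    · rw [h, t1]
      exact le_add_of_nonneg_right (integral_nonneg fun x => gradSq_nonneg _ _ _)
    · rw [h]
      exact t2.trans (le_add_of_nonneg_left (integral_nonneg fun x => sq_nonneg _))
  have e1 : ∀ {m}, Set.EqOn w v (element 1 m) →
      ∫ x in element 1 m, w x ^ 2 = ∫ x in element 1 m, v x ^ 2 := fun h =>
    setIntegral_congr_fun (hopen _).measurableSet fun x hx => by simp only [h hx]
  have hw0 := hwv.mono Set.subset_union_left
  have e2 : ∫ x in element 1 0, gradSq (P + 1) w x = ∫ x in element 1 0, gradSq (P + 1) v x :=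
    setIntegral_congr_fun (hopen _).measurableSet fun x hx =>
      Finset.sum_congr rfl fun α _ => by
        rw [multiDeriv_congr_of_isOpen (hopen 0) hw0 α hx]
  rw [e1 hw0, e1 (hwv.mono Set.subset_union_right), e2]
  exact h1.trans (mul_le_mul_of_nonneg_left hT (sq_nonneg _))

theorem gradSq_comp_affine {f : Space d → ℝ} (hf : ContDiff ℝ ∞ f) (σ : ℝ) (c : Space d) (k : ℕ)
    (y : Space d) : gradSq k (fun y => f (σ • (y + c))) y =
      σ ^ (2 * k) * gradSq k f (σ • (y + c)) := by
  simp only [gradSq, Finset.mul_sum]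
  refine Finset.sum_congr rfl fun α hα => ?_
  rw [multiDeriv_comp_affine hf, mem_multiIndicesEq.1 hα]
  ring

theorem sub_mem_box_of_neighbors {i i' : Fin d → ℤ} (h : Neighbors i i') : i' - i ∈ box d 1 := by
  obtain ⟨n, h1, h2⟩ := h
  refine mem_box.2 fun j => ?_
  have := h1 j
  have := h2 j
  simp only [Pi.sub_apply, abs_le]
  push_cast
  omega

/-- The ghost penalty mechanism: mass on an element is controlled by mass on a neighbour and the
stabilization term. Up to scaling there are only the finitely many relative positions in `box d 1`,
whose constants are added. -/
theorem ghost_estimate (d P : ℕ) :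
    ∃ C : ℝ, 0 ≤ C ∧ ∀ σ : ℝ, 0 < σ → ∀ w ∈ pufem d P σ, ∀ i i', Neighbors i i' →
      ∫ x in element σ i, w x ^ 2 ≤ C * ((∫ x in element σ i', w x ^ 2) +
        σ ^ (2 * (P + 1)) * ∫ x in element σ i, gradSq (P + 1) w x) := by
  choose! C hC0 hC using ghost_estimate_unit (d := d) P
  refine ⟨∑ n ∈ box d 1, C n, Finset.sum_nonneg hC0, fun σ hσ w hw i i' hii' => ?_⟩
  have hn := sub_mem_box_of_neighbors hii'
  have h := hC _ hn _ (comp_affine_mem_pufem hσ i hw)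
  simp only [gradSq_comp_affine (isSmoothCompact_of_mem_pufem hσ hw).1, integral_const_mul] at h
  have e0 := fun g => setIntegral_element g hσ i 0
  have e1 := fun g => setIntegral_element g hσ i (i' - i)
  simp only [zero_add, sub_add_cancel] at e0 e1
  rw [e0, e0, e1]
  have hle : C (i' - i) ≤ ∑ n ∈ box d 1, C n :=
    Finset.single_le_sum (f := C) hC0 hn
  have hnn : 0 ≤ (∫ x in element 1 (i' - i), w (σ • (x + gridPt i)) ^ 2) +
      σ ^ (2 * (P + 1)) * ∫ x in element 1 0, gradSq (P + 1) w (σ • (x + gridPt i)) :=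
    add_nonneg (integral_nonneg fun x => sq_nonneg _)
      (mul_nonneg (by positivity) (integral_nonneg fun x => gradSq_nonneg _ _ _))
  calc _ ≤ σ ^ d * _ := mul_le_mul_of_nonneg_left
        (h.trans (mul_le_mul_of_nonneg_right hle hnn)) (by positivity)
    _ = _ := by ring

end SmoothPUFEM

namespace SmoothPUFEM

variable {d : ℕ}

/-! ### Stability of the stabilized form -/

/-- The union of the elements with index in `I`. -/
def elementUnion (σ : ℝ) (I : Set (Fin d → ℤ)) : Set (Space d) := ⋃ i ∈ I, element σ i

theorem isOpen_elementUnion (σ : ℝ) (I : Set (Fin d → ℤ)) : IsOpen (elementUnion (d := d) σ I) :=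
  isOpen_biUnion fun i _ => isOpen_element σ i

theorem hasSum_setIntegral_elementUnion {σ : ℝ} (hσ : 0 < σ) (I : Set (Fin d → ℤ))
    {g : Space d → ℝ} (hg : IntegrableOn g (elementUnion σ I)) :
    HasSum (I.indicator fun i => ∫ x in element σ i, g x) (∫ x in elementUnion σ I, g x) :=
  hasSum_setIntegral_element hσ I hg

theorem ae_le_activeUnion {σ : ℝ} (hσ : 0 < σ) (Ω : Set (Space d)) :
    Ω ≤ᵐ[volume] elementUnion σ (activeElements σ Ω) := by
  have h : ∀ᵐ x : Space d, ∀ i, i ∉ activeElements σ Ω → x ∉ element σ i ∩ Ω := by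
    refine ae_all_iff.2 fun i => ?_
    by_cases hi : i ∈ activeElements σ Ω
    · exact Filter.Eventually.of_forall fun x h => absurd hi h
    · have h0 : volume (element σ i ∩ Ω) = 0 := by
        simpa [activeElements] using hi
      filter_upwards [measure_eq_zero_iff_ae_notMem.1 h0] with x hx _ using hx
  filter_upwards [h, ae_mem_element hσ] with x hx hm hΩ
  by_contra hcon
  refine hx (fun j => ⌊x j / σ⌋) (fun ha => hcon ?_) ⟨hm, hΩ⟩
  exact Set.mem_biUnion ha hm

/-- The series over cut elements becomes one integral over their union, which makes `stab` an `L²`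
inner product of derivatives. -/
theorem stab_eq (P : ℕ) {σ : ℝ} (hσ : 0 < σ) (Ω : Set (Space d)) {u v : Space d → ℝ}
    (hu : IsSmoothCompact u) (hv : IsSmoothCompact v) :
    stab P σ Ω u v = σ ^ (2 * (P + 1)) * ∑ α ∈ multiIndicesEq d (P + 1),
      ∫ x in elementUnion σ (cutElements σ Ω), multiDeriv α u x * multiDeriv α v x := by
  unfold stab
  congr 1
  refine HasSum.tsum_eq (hasSum_sum fun α _ => ?_)
  have hint : Integrable fun x => multiDeriv α u x * multiDeriv α v x := by
    have h1 := hu.multiDeriv α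
    have h2 := hv.multiDeriv α
    exact (h1.1.continuous.mul h2.1.continuous).integrable_of_hasCompactSupport h2.2.mul_left
  exact (hasSum_subtype_iff_indicator).2
    (hasSum_setIntegral_elementUnion hσ (cutElements σ Ω) hint.integrableOn)

theorem IsSmoothCompact.integrable_gradSq {f : Space d → ℝ} (hf : IsSmoothCompact f) (k : ℕ) :
    Integrable (gradSq k f) :=
  integrable_finsetSum _ fun α _ =>
    (memLp_of_univ ((hf.multiDeriv α).memLp Set.univ)).integrable_sq

theorem IsSmoothCompact.integrable_sq {f : Space d → ℝ} (hf : IsSmoothCompact f) :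
    Integrable fun x => f x ^ 2 :=
  (memLp_of_univ (hf.memLp Set.univ)).integrable_sq

theorem stab_self_eq (P : ℕ) {σ : ℝ} (hσ : 0 < σ) (Ω : Set (Space d)) {v : Space d → ℝ}
    (hv : IsSmoothCompact v) : stab P σ Ω v v =
      σ ^ (2 * (P + 1)) * ∫ x in elementUnion σ (cutElements σ Ω), gradSq (P + 1) v x := by
  rw [stab_eq P hσ Ω hv hv, setIntegral_gradSq hv]
  simp only [pow_two]

/-- Finite overlap: each index lies in exactly `(box d K).card` of the translated boxes. -/
theorem hasSum_sum_box_shift (K : ℕ) {a : (Fin d → ℤ) → ℝ} {A : ℝ} (h : HasSum a A) :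
    HasSum (fun i => ∑ n ∈ box d K, a (i + n)) ((box d K).card * A) := by
  have hn : ∀ n : Fin d → ℤ, HasSum (fun i => a (i + n)) A := by
    intro n
    rw [← (Equiv.addRight n).hasSum_iff] at h
    exact h
  have := hasSum_sum (s := box d K) (f := fun n i => a (i + n)) fun n _ => hn n
  rwa [Finset.sum_const, nsmul_eq_mul] at this

theorem chain_bound {C S : ℝ} (hC : 0 ≤ C) {L : ℕ} {E : ℕ → ℝ} (hS : 0 ≤ S)
    (hstep : ∀ l < L, E l ≤ C * (E (l + 1) + S)) (hlast : E L ≤ C * (S + S)) :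
    E 0 ≤ (2 * (C + 1)) ^ (L + 1) * S := by
  -- The bound travels from the uncut end of the chain back to its start. As the power is at least
  -- one, the added `S` in each step at most doubles it.
  have key : ∀ l ≤ L, E (L - l) ≤ (2 * (C + 1)) ^ (l + 1) * S := by
    intro l
    induction l with
    | zero => intro _; simp only [Nat.sub_zero, zero_add, pow_one]; nlinarith
    | succ l ih =>
      intro hl
      have h1 := hstep (L - (l + 1)) (by omega)
      rw [show L - (l + 1) + 1 = L - l by omega] at h1
      have h2 := ih (by omega)
      have hX : 1 ≤ (2 * (C + 1)) ^ (l + 1) := one_le_pow₀ (by linarith)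
      set X := (2 * (C + 1)) ^ (l + 1)
      have h3 : C * (E (L - l) + S) ≤ C * (X * S + S) := by gcongr
      have h4 : C * (X * S + S) ≤ C * (X * S + X * S) := by
        gcongr; nlinarith
      have h5 : 0 ≤ X * S := mul_nonneg (by linarith) hS
      rw [pow_succ]
      nlinarith
  simpa using key L le_rfl

theorem abs_sub_le_of_chain {q : ℕ → Fin d → ℤ} {L : ℕ}
    (h : ∀ l < L, Neighbors (q l) (q (l + 1))) {l : ℕ} (hl : l ≤ L) (j : Fin d) :
    |q l j - q 0 j| ≤ l := by
  induction l with
  | zero => simp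
  | succ l ih =>
    have h1 := ih (by omega)
    have h2 := mem_box.1 (sub_mem_box_of_neighbors (h l (by omega))) j
    simp only [Pi.sub_apply] at h2
    rw [abs_le] at *
    push_cast at *
    omega

/-- Repeated use of `ghost_estimate` along a chain bounds the mass on a cut element by the energy in
the box of radius `K` around it. Summation over all elements counts each contribution `(box d
K).card` times. -/
theorem activeUnion_estimate (d P K : ℕ) : ∃ M : ℝ, 0 ≤ M ∧ ∀ σ : ℝ, 0 < σ →
    ∀ Ω : Set (Space d), IsOpen Ω → ReachableFromUncut σ Ω K → ∀ w ∈ pufem d P σ,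
      ∫ x in elementUnion σ (activeElements σ Ω), w x ^ 2 ≤
        M * ((∫ x in Ω, w x ^ 2) + stab P σ Ω w w) := by
  obtain ⟨C, hC0, hC⟩ := ghost_estimate d P
  refine ⟨((2 * (C + 1)) ^ K + 1) * (box d K).card, by positivity, ?_⟩
  intro σ hσ Ω hΩ hreach w hw
  have hws := isSmoothCompact_of_mem_pufem hσ hw
  set e : (Fin d → ℤ) → ℝ := fun i => ∫ x in element σ i, w x ^ 2 with he
  set g : (Fin d → ℤ) → ℝ := fun i => ∫ x in element σ i, gradSq (P + 1) w x with hg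
  have he0 : ∀ i, 0 ≤ e i := fun i => integral_nonneg fun _ => sq_nonneg _
  have hg0 : ∀ i, 0 ≤ g i := fun i => integral_nonneg fun _ => gradSq_nonneg _ _ _
  set s : ℝ := σ ^ (2 * (P + 1)) with hs
  have hs0 : 0 ≤ s := by positivity
  -- The share of one element in the energy: the mass if it is uncut, the stabilization if it is
  -- cut. `S` collects it over the box of radius `K`.
  set a : (Fin d → ℤ) → ℝ := fun i =>
    (uncutElements σ Ω).indicator e i + s * (cutElements σ Ω).indicator g i with ha
  have ha1 : ∀ i, 0 ≤ (uncutElements σ Ω).indicator e i := fun i =>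
    Set.indicator_nonneg (fun i _ => he0 i) i
  have ha2 : ∀ i, 0 ≤ s * (cutElements σ Ω).indicator g i := fun i =>
    mul_nonneg hs0 (Set.indicator_nonneg (fun i _ => hg0 i) i)
  have ha0 : ∀ i, 0 ≤ a i := fun i => add_nonneg (ha1 i) (ha2 i)
  set S : (Fin d → ℤ) → ℝ := fun i => ∑ n ∈ box d K, a (i + n) with hS
  have hS0 : ∀ i, 0 ≤ S i := fun i => Finset.sum_nonneg fun n _ => ha0 _
  have haS : ∀ i i', i' - i ∈ box d K → a i' ≤ S i := by
    intro i i' h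
    have := Finset.single_le_sum (f := fun n => a (i + n)) (fun n _ => ha0 _) h
    simpa using this
  have hcut : ∀ i ∈ cutElements σ Ω, e i ≤ (2 * (C + 1)) ^ K * S i := by
    intro i hi
    obtain ⟨L, q, hLK, rfl, hqc, hqn, i', hi', hn'⟩ := hreach i hi
    have hgS : ∀ l ≤ L, s * g (q l) ≤ S (q 0) := by
      intro l hl
      refine le_trans ?_ (haS (q 0) (q l) (mem_box.2 fun j => ?_))
      · simp only [ha, Set.indicator_of_mem (hqc l hl)]
        linarith [ha1 (q l)]
      · refine (abs_sub_le_of_chain hqn hl j).trans ?_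
        exact_mod_cast (by omega : l ≤ K)
    have heS : e i' ≤ S (q 0) := by
      refine le_trans ?_ (haS (q 0) i' (mem_box.2 fun j => ?_))
      · simp only [ha, Set.indicator_of_mem hi']
        linarith [ha2 i']
      -- The uncut element lies one step beyond the last member of the chain, at distance at most `L
      -- + 1 ≤ K`.
      · have h1 := abs_sub_le_of_chain hqn le_rfl j
        have h2 := mem_box.1 (sub_mem_box_of_neighbors hn') j
        simp only [Pi.sub_apply] at h2 ⊢
        rw [abs_le] at *
        push_cast at *
        omega
    have h := chain_bound (E := fun l => e (q l)) hC0 (hS0 (q 0)) (L := L) (fun l hl => ?_) ?_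
    · refine h.trans (mul_le_mul_of_nonneg_right ?_ (hS0 _))
      exact pow_le_pow_right₀ (by linarith) hLK
    · refine (hC σ hσ w hw _ _ (hqn l hl)).trans ?_
      have := hgS l hl.le
      gcongr
    · refine (hC σ hσ w hw _ _ hn').trans ?_
      have := hgS L le_rfl
      gcongr
  have hact : ∀ i, (activeElements σ Ω).indicator e i ≤ ((2 * (C + 1)) ^ K + 1) * S i := by
    intro i
    have hp : 0 ≤ (2 * (C + 1)) ^ K * S i := mul_nonneg (by positivity) (hS0 i)
    by_cases hi : i ∈ activeElements σ Ω
    · rw [Set.indicator_of_mem hi]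
      by_cases hsub : element σ i ⊆ Ω
      · have h1 := haS i i (mem_box.2 fun j => by simp)
        have h2 : e i ≤ a i := by
          simp only [ha, Set.indicator_of_mem (show i ∈ uncutElements σ Ω from ⟨hi, hsub⟩)]
          linarith [ha2 i]
        linarith
      · linarith [hcut i ⟨hi, hsub⟩, hS0 i]
    · rw [Set.indicator_of_notMem hi]
      exact mul_nonneg (by positivity) (hS0 i)
  have hE := hasSum_setIntegral_elementUnion hσ (activeElements σ Ω) hws.integrable_sq.integrableOn
  have hA : HasSum a ((∫ x in elementUnion σ (uncutElements σ Ω), w x ^ 2) + stab P σ Ω w w) := by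
    rw [stab_self_eq P hσ Ω hws]
    exact (hasSum_setIntegral_elementUnion hσ (uncutElements σ Ω) hws.integrable_sq.integrableOn).add
      ((hasSum_setIntegral_elementUnion hσ (cutElements σ Ω)
        (hws.integrable_gradSq (P + 1)).integrableOn).mul_left s)
  have hSsum : HasSum S ((box d K).card *
      ((∫ x in elementUnion σ (uncutElements σ Ω), w x ^ 2) + stab P σ Ω w w)) := by
    exact hasSum_sum_box_shift K hA
  have hfin := hasSum_le hact hE (hSsum.mul_left ((2 * (C + 1)) ^ K + 1))
  refine hfin.trans ?_
  rw [← mul_assoc]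
  refine mul_le_mul_of_nonneg_left ?_ (by positivity)
  gcongr
  · exact Filter.Eventually.of_forall fun _ => sq_nonneg _
  · exact hws.integrable_sq.integrableOn
  · exact Set.iUnion₂_subset fun i hi => hi.2

theorem norm_sq_smoothToSobolev (k : ℕ) (Ω : Set (Space d)) {f : Space d → ℝ}
    (hf : IsSmoothCompact f) : ‖smoothToSobolev k Ω hf‖ ^ 2 =
      ∑ α ∈ multiIndices d k, ∫ x in Ω, multiDeriv α f x ^ 2 := by
  have e : ‖smoothToSobolev k Ω hf‖ ^ 2 = ∑ α, ‖(smoothToSobolev k Ω hf).1 α‖ ^ 2 :=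
    PiLp.norm_sq_eq_of_L2 _ _
  rw [e]
  exact (Finset.sum_congr rfl fun α _ => norm_sq_derivL2 Ω α.1 ⟨f, hf⟩).trans
    (Finset.sum_coe_sort (multiIndices d k) fun α => ∫ x in Ω, multiDeriv α f x ^ 2)

theorem activeUnion_inverse_estimate (P : ℕ) (α : Fin d → ℕ) :
    ∃ C : ℝ, 0 ≤ C ∧ ∀ σ : ℝ, 0 < σ → ∀ w ∈ pufem d P σ, ∀ I : Set (Fin d → ℤ),
      σ ^ (2 * ∑ j, α j) * ∫ x in elementUnion σ I, multiDeriv α w x ^ 2 ≤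
        C * ∫ x in elementUnion σ I, w x ^ 2 := by
  obtain ⟨C, hC0, hC⟩ := inverse_estimate P α
  refine ⟨C, hC0, fun σ hσ w hw I => ?_⟩
  have hws := isSmoothCompact_of_mem_pufem hσ hw
  have h1 := hasSum_setIntegral_elementUnion hσ I (hws.multiDeriv α).integrable_sq.integrableOn
  have h2 := hasSum_setIntegral_elementUnion hσ I hws.integrable_sq.integrableOn
  refine hasSum_le (fun i => ?_) (h1.mul_left (σ ^ (2 * ∑ j, α j))) (h2.mul_left C)
  by_cases hi : i ∈ I
  · simpa only [Set.indicator_of_mem hi] using hC σ hσ w hw i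
  · simp [Set.indicator_of_notMem hi]

/-- The inverse estimate for the stabilized form. -/
theorem norm_sq_pufemToSobolev_le (d P K : ℕ) {ε : ℝ} (hε : 0 < ε) :
    ∃ C : ℝ, 0 ≤ C ∧ ∀ (σ : ℝ) (hσ : 0 < σ), σ ≤ 1 →
    ∀ Ω : Set (Space d), IsOpen Ω → ReachableFromUncut σ Ω K → ∀ w : pufem d P σ,
      (∫ x in elementUnion σ (activeElements σ Ω), w.1 x ^ 2) ≤ C * bilinA P σ ε Ω w w ∧
      σ ^ (2 * (P + 1)) * ‖pufemToSobolev hσ (P + 1) Ω w‖ ^ 2 ≤ C * bilinA P σ ε Ω w w := by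
  obtain ⟨M, hM0, hM⟩ := activeUnion_estimate d P K
  choose C hC0 hC using fun α : Fin d → ℕ => activeUnion_inverse_estimate (d := d) P α
  set C' := ∑ α ∈ multiIndices d (P + 1), C α with hC'
  have hC'0 : 0 ≤ C' := Finset.sum_nonneg fun α _ => hC0 α
  -- `1 + ε⁻¹` passes from the unweighted stabilization to `A`. `C'` adds the inverse constants of
  -- all derivatives, and `+ 1` covers the `L²` bound.
  refine ⟨(C' + 1) * (M * (1 + ε⁻¹)), by positivity, fun σ hσ hσ1 Ω hΩ hreach w => ?_⟩
  have hws := isSmoothCompact_of_mem_pufem hσ w.2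
  have hA : bilinA P σ ε Ω w w = (∫ x in Ω, w.1 x ^ 2) + ε * stab P σ Ω w w := by
    simp only [bilinA, pow_two]
  have hst : 0 ≤ stab P σ Ω w w := by
    rw [stab_self_eq P hσ Ω hws]
    exact mul_nonneg (by positivity) (integral_nonneg fun _ => gradSq_nonneg _ _ _)
  have hw0 : 0 ≤ ∫ x in Ω, w.1 x ^ 2 := integral_nonneg fun _ => sq_nonneg _
  have hA0 : 0 ≤ bilinA P σ ε Ω w w := by rw [hA]; positivity
  have h1 : (∫ x in elementUnion σ (activeElements σ Ω), w.1 x ^ 2) ≤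
      M * (1 + ε⁻¹) * bilinA P σ ε Ω w w := by
    refine (hM σ hσ Ω hΩ hreach w w.2).trans ?_
    rw [mul_assoc]
    refine mul_le_mul_of_nonneg_left ?_ hM0
    have : ε⁻¹ * (ε * stab P σ Ω w w) = stab P σ Ω w w := inv_mul_cancel_left₀ hε.ne' _
    rw [hA, add_mul, one_mul, mul_add, this]
    have h2 : 0 ≤ ε⁻¹ * ∫ x in Ω, w.1 x ^ 2 := by positivity
    have h3 : 0 ≤ ε * stab P σ Ω w w := by positivity
    linarith
  have hB0 : 0 ≤ M * (1 + ε⁻¹) * bilinA P σ ε Ω w w := by positivity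
  constructor
  · refine h1.trans ?_
    rw [mul_assoc]
    nlinarith
  · have h2 : ‖pufemToSobolev hσ (P + 1) Ω w‖ ^ 2 =
        ∑ α ∈ multiIndices d (P + 1), ∫ x in Ω, multiDeriv α w.1 x ^ 2 :=
      norm_sq_smoothToSobolev _ _ _
    rw [h2, Finset.mul_sum]
    have h3 : ∀ α ∈ multiIndices d (P + 1),
        σ ^ (2 * (P + 1)) * ∫ x in Ω, multiDeriv α w.1 x ^ 2 ≤
          C α * ∫ x in elementUnion σ (activeElements σ Ω), w.1 x ^ 2 := by
      intro α hα
      refine le_trans ?_ (hC α σ hσ w w.2 (activeElements σ Ω))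
      refine mul_le_mul ?_ ?_ (integral_nonneg fun _ => sq_nonneg _) (by positivity)
      -- For `σ ≤ 1` the weight of the highest order is the smallest.
      · exact pow_le_pow_of_le_one hσ.le hσ1 (Nat.mul_le_mul_left 2 (mem_multiIndices.1 hα))
      · exact setIntegral_mono_set (hws.multiDeriv α).integrable_sq.integrableOn
          (Filter.Eventually.of_forall fun _ => sq_nonneg _) (ae_le_activeUnion hσ Ω)
    refine (Finset.sum_le_sum h3).trans ?_
    rw [← Finset.sum_mul, ← hC']
    calc C' * _ ≤ C' * (M * (1 + ε⁻¹) * bilinA P σ ε Ω w w) := by gcongr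
      _ ≤ _ := by nlinarith

end SmoothPUFEM

namespace SmoothPUFEM

variable {d : ℕ}

/-! ### Quasi-interpolation -/

/-- The cube that consists of the elements around the grid point with index `n`. -/
def patch (σ : ℝ) (n : Fin d → ℤ) : Set (Space d) := cube (σ • gridPt (n - 1)) (2 * σ)

/-- The cube that consists of `Q_i` and its neighbours. -/
def nbhd (σ : ℝ) (i : Fin d → ℤ) : Set (Space d) := cube (σ • gridPt (i - 1)) (3 * σ)

theorem mem_patch {σ : ℝ} {n : Fin d → ℤ} {x : Space d} :
    x ∈ patch σ n ↔ ∀ j, ((n j : ℝ) - 1) * σ < x j ∧ x j < ((n j : ℝ) + 1) * σ := by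
  simp only [patch, cube, Set.mem_ofPred_eq, PiLp.smul_apply, gridPt_apply, smul_eq_mul,
    Pi.sub_apply, Pi.one_apply, Int.cast_sub, Int.cast_one]
  refine forall_congr' fun j => and_congr ?_ ?_ <;> constructor <;> intro h <;> linarith

theorem mem_nbhd {σ : ℝ} {i : Fin d → ℤ} {x : Space d} :
    x ∈ nbhd σ i ↔ ∀ j, ((i j : ℝ) - 1) * σ < x j ∧ x j < ((i j : ℝ) + 2) * σ := by
  simp only [nbhd, cube, Set.mem_ofPred_eq, PiLp.smul_apply, gridPt_apply, smul_eq_mul,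
    Pi.sub_apply, Pi.one_apply, Int.cast_sub, Int.cast_one]
  refine forall_congr' fun j => and_congr ?_ ?_ <;> constructor <;> intro h <;> linarith

theorem element_subset_patch {σ : ℝ} {i n : Fin d → ℤ} (h : IsNode n i) :
    element σ i ⊆ patch σ n := by
  intro x hx
  refine mem_patch.2 fun j => ?_
  have h1 := hx j
  rcases h j with h2 | h2 <;> rw [h2] <;> push_cast <;> constructor <;> linarith

theorem patch_subset_nbhd {σ : ℝ} (hσ : 0 < σ) {i n : Fin d → ℤ} (h : IsNode n i) :
    patch σ n ⊆ nbhd σ i := by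
  intro x hx
  refine mem_nbhd.2 fun j => ?_
  have h1 := mem_patch.1 hx j
  rcases h j with h2 | h2 <;> rw [h2] at h1 <;> push_cast at h1 <;> constructor <;> nlinarith

theorem element_subset_nbhd {σ : ℝ} (hσ : 0 < σ) (i : Fin d → ℤ) : element σ i ⊆ nbhd σ i :=
  (element_subset_patch fun _ => Or.inl rfl).trans
    (patch_subset_nbhd (n := i) hσ fun _ => Or.inl rfl)

theorem setIntegral_nbhd_le {σ : ℝ} (hσ : 0 < σ) (i : Fin d → ℤ) {g : Space d → ℝ}
    (hg : Integrable g) (h0 : ∀ x, 0 ≤ g x) :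
    ∫ x in nbhd σ i, g x ≤ ∑ n ∈ box d 1, ∫ x in element σ (i + n), g x := by
  have hU := integral_biUnion_finset (box d 1) (s := fun n => element σ (i + n)) (f := g)
    (μ := volume) (fun n _ => measurableSet_element σ _)
    (fun n _ m _ h => pairwise_disjoint_element hσ fun h' => h (add_left_cancel h'))
    fun n _ => hg.integrableOn
  rw [← hU]
  refine setIntegral_mono_set hg.integrableOn (Filter.Eventually.of_forall h0) ?_
  filter_upwards [ae_mem_element hσ] with x hx hN
  have hmem : (fun j => ⌊x j / σ⌋) - i ∈ box d 1 := by
    refine mem_box.2 fun j => ?_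
    have h1 := mem_nbhd.1 hN j
    have h2 := hx j
    have h3 : (⌊x j / σ⌋ : ℝ) * σ < ((i j : ℝ) + 2) * σ := by linarith
    have h4 : ((i j : ℝ) - 1) * σ < ((⌊x j / σ⌋ : ℝ) + 1) * σ := by linarith
    have h5 : ⌊x j / σ⌋ < i j + 2 := by exact_mod_cast lt_of_mul_lt_mul_right h3 hσ.le
    have h6 : i j - 1 < ⌊x j / σ⌋ + 1 := by exact_mod_cast lt_of_mul_lt_mul_right h4 hσ.le
    simp only [Pi.sub_apply, abs_le]
    push_cast
    omega
  refine Set.mem_biUnion (Finset.mem_coe.2 hmem) ?_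
  rwa [add_sub_cancel]

theorem exists_poly_approx_cube (k : ℕ) {f : Space d → ℝ} (hf : ContDiff ℝ ∞ f) (a : Space d)
    {s : ℝ} (hs : 0 < s) : ∃ p ∈ polyLT d k, ∫ x in cube a s, (f x - p x) ^ 2 ≤
      2 ^ d * ((d : ℝ) ^ k) ^ 2 * s ^ (2 * k) * ∫ x in cube a s, gradSq k f x :=
  exists_poly_approx hf (convex_cube a s) (isOpen_cube a s).measurableSet (isBounded_cube a s)
    (volume_cube_ne_zero a hs) (fun _ hx _ hy => abs_sub_le_of_mem_cube hx hy) k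

theorem eq_sum_nodes {σ : ℝ} (hσ : 0 < σ) {i : Fin d → ℤ} {x : Space d} (hx : x ∈ element σ i)
    (s : Finset (Fin d → ℤ)) {p : (Fin d → ℤ) → ℝ} (hp : ∀ n ∉ s, p n = 0) :
    ∑ n ∈ s, pou σ n x * p n = ∑ n ∈ nodes i, pou σ n x * p n := by
  have h1 : ∑ n ∈ s, pou σ n x * p n = ∑ n ∈ s ∪ nodes i, pou σ n x * p n :=
    Finset.sum_subset Finset.subset_union_left fun n _ hn => by rw [hp n hn, mul_zero]
  have h2 : ∑ n ∈ nodes i, pou σ n x * p n = ∑ n ∈ s ∪ nodes i, pou σ n x * p n := by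
    refine Finset.sum_subset Finset.subset_union_right fun n _ hn => ?_
    have : pou σ n x = 0 := by
      by_contra h
      exact hn (mem_nodes.2 (isNode_of_pou_ne_zero hσ hx h))
    rw [this, zero_mul]
  rw [h1, h2]

theorem card_nodes (i : Fin d → ℤ) : (nodes i).card = 2 ^ d := by
  rw [nodes, Fintype.card_piFinset]
  simp

/-- Since the partition functions of the `2 ^ d` nodes sum to one, the error of the glued function
is a weighted average of the local errors. Cauchy–Schwarz and weights at most one give the bound. -/
theorem sq_sub_sum_nodes_le {σ : ℝ} (hσ : 0 < σ) {i : Fin d → ℤ} {x : Space d}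
    (hx : x ∈ element σ i) (c : ℝ) (p : (Fin d → ℤ) → ℝ) :
    (c - ∑ n ∈ nodes i, pou σ n x * p n) ^ 2 ≤ 2 ^ d * ∑ n ∈ nodes i, (c - p n) ^ 2 := by
  have e : c - ∑ n ∈ nodes i, pou σ n x * p n = ∑ n ∈ nodes i, pou σ n x * (c - p n) := by
    simp only [mul_sub, Finset.sum_sub_distrib]
    rw [← Finset.sum_mul, sum_nodes_pou hσ hx, one_mul]
  rw [e]
  refine sq_sum_le_card_mul_sum_sq.trans ?_
  rw [card_nodes]
  push_cast
  refine mul_le_mul_of_nonneg_left (Finset.sum_le_sum fun n _ => ?_) (by positivity)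
  rw [mul_pow]
  exact mul_le_of_le_one_left (sq_nonneg _) (pow_le_one₀ (pou_nonneg hσ _ _) (pou_le_one hσ _ _))

/-- Patches off the support of `f` receive the zero polynomial, so that the glued function is a
finite sum and belongs to `pufem`. -/
theorem exists_local_polys (P : ℕ) {σ : ℝ} (hσ : 0 < σ) {f : Space d → ℝ}
    (hf : IsSmoothCompact f) : ∃ (s : Finset (Fin d → ℤ)) (p : (Fin d → ℤ) → Space d → ℝ),
      (∀ n, p n ∈ polySpace d P) ∧ (∀ n ∉ s, p n = 0) ∧
      ∀ n, ∫ x in patch σ n, (f x - p n x) ^ 2 ≤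
        2 ^ d * ((d : ℝ) ^ (P + 1)) ^ 2 * (2 * σ) ^ (2 * (P + 1)) *
          ∫ x in patch σ n, gradSq (P + 1) f x := by
  obtain ⟨R, hR⟩ := hf.2.isBounded.exists_norm_le
  obtain ⟨L, hL⟩ := exists_nat_ge ((R + σ) / σ)
  have hzero : ∀ n ∉ box d L, ∀ x ∈ patch σ n, f x = 0 := by
    intro n hn x hx
    by_contra h
    refine hn (mem_box.2 fun j => ?_)
    have h1 := mem_patch.1 hx j
    have h2 := abs_le.1 ((PiLp.norm_apply_le x j).trans (hR x (subset_tsupport f h)))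
    have hL' := (div_le_iff₀ hσ).1 hL
    have h3 : (n j : ℝ) * σ < L * σ := by linarith
    have h4 : -(L : ℝ) * σ < n j * σ := by linarith
    have h5 : n j < L := by exact_mod_cast lt_of_mul_lt_mul_right h3 hσ.le
    have h6 : -(L : ℤ) < n j := by exact_mod_cast lt_of_mul_lt_mul_right h4 hσ.le
    rw [abs_le]; omega
  have hex : ∀ n : Fin d → ℤ, ∃ p ∈ polySpace d P, (n ∉ box d L → p = 0) ∧
      ∫ x in patch σ n, (f x - p x) ^ 2 ≤
        2 ^ d * ((d : ℝ) ^ (P + 1)) ^ 2 * (2 * σ) ^ (2 * (P + 1)) *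
          ∫ x in patch σ n, gradSq (P + 1) f x := by
    intro n
    by_cases hn : n ∈ box d L
    · obtain ⟨p, hp, hp'⟩ := exists_poly_approx_cube (P + 1) hf.1 (σ • gridPt (n - 1))
        (s := 2 * σ) (by positivity)
      rw [polyLT_succ] at hp
      exact ⟨p, hp, fun h => absurd hn h, hp'⟩
    · refine ⟨0, Submodule.zero_mem _, fun _ => rfl, ?_⟩
      have : ∫ x in patch σ n, (f x - (0 : Space d → ℝ) x) ^ 2 = 0 := by
        refine (setIntegral_congr_fun (g := fun _ => (0 : ℝ)) (isOpen_cube _ _).measurableSet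
          fun x hx => ?_).trans (integral_zero _ _)
        simp [hzero n hn x hx]
      rw [this]
      exact mul_nonneg (by positivity) (integral_nonneg fun _ => gradSq_nonneg _ _ _)
  choose p hp1 hp2 hp3 using hex
  exact ⟨box d L, p, hp1, hp2, hp3⟩

theorem IsSmoothCompact.sub {f g : Space d → ℝ} (hf : IsSmoothCompact f)
    (hg : IsSmoothCompact g) : IsSmoothCompact (f - g) :=
  (smoothFns d).sub_mem (show f ∈ smoothFns d from hf) hg

/-- The local estimates of the quasi-interpolant. -/
theorem local_quasi_interpolation (d P : ℕ) : ∃ C : ℝ, 0 ≤ C ∧ ∀ σ : ℝ, 0 < σ →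
    ∀ f : Space d → ℝ, IsSmoothCompact f → ∃ v ∈ pufem d P σ, ∀ i,
      ∫ x in element σ i, (f x - v x) ^ 2 ≤
        C * σ ^ (2 * (P + 1)) * ∫ x in nbhd σ i, gradSq (P + 1) f x := by
  -- One `2 ^ d` comes from `sq_sub_sum_nodes_le`, one counts the nodes, and the rest is polynomial
  -- approximation on a patch of side `2 * σ`.
  refine ⟨2 ^ d * (2 ^ d * (2 ^ d * ((d : ℝ) ^ (P + 1)) ^ 2 * 2 ^ (2 * (P + 1)))),
    by positivity, fun σ hσ f hf => ?_⟩
  obtain ⟨s, p, hp, hps, hest⟩ := exists_local_polys P hσ hf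
  have hsum : (∑ n ∈ s, fun x => pou σ n x * p n x) ∈ pufem d P σ :=
    Submodule.sum_mem _ fun n _ => Submodule.subset_span ⟨n, p n, hp n, rfl⟩
  refine ⟨_, hsum, fun i => ?_⟩
  have hb := isBounded_element (d := d) σ i
  have hpc : ∀ n, Continuous fun x => (f x - p n x) ^ 2 := fun n =>
    (hf.1.continuous.sub (contDiff_of_mem_polySpace (hp n)).continuous).pow 2
  have hvc : Continuous fun x => (f x - (∑ n ∈ s, fun x => pou σ n x * p n x) x) ^ 2 :=
    (hf.1.continuous.sub (isSmoothCompact_of_mem_pufem hσ hsum).1.continuous).pow 2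
  have hpt : ∀ x ∈ element σ i, (f x - (∑ n ∈ s, fun x => pou σ n x * p n x) x) ^ 2 ≤
      2 ^ d * ∑ n ∈ nodes i, (f x - p n x) ^ 2 := by
    intro x hx
    rw [Finset.sum_apply, eq_sum_nodes hσ hx s (p := fun n => p n x) fun n hn => by
      rw [hps n hn]; rfl]
    exact sq_sub_sum_nodes_le hσ hx _ _
  have hnode : ∀ n ∈ nodes i, ∫ x in element σ i, (f x - p n x) ^ 2 ≤
      2 ^ d * ((d : ℝ) ^ (P + 1)) ^ 2 * (2 * σ) ^ (2 * (P + 1)) *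
        ∫ x in nbhd σ i, gradSq (P + 1) f x := by
    intro n hn
    have hn' := mem_nodes.1 hn
    have hbp : Bornology.IsBounded (patch σ n) := isBounded_cube _ _
    refine (setIntegral_mono_set (Continuous.integrableOn_isBounded (hpc n) hbp)
      (Filter.Eventually.of_forall fun _ => sq_nonneg _)
      (element_subset_patch hn').eventuallyLE).trans ((hest n).trans ?_)
    refine mul_le_mul_of_nonneg_left ?_ (by positivity)
    exact setIntegral_mono_set (hf.integrable_gradSq _).integrableOn
      (Filter.Eventually.of_forall fun _ => gradSq_nonneg _ _ _)
      (patch_subset_nbhd hσ hn').eventuallyLE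
  calc ∫ x in element σ i, (f x - (∑ n ∈ s, fun x => pou σ n x * p n x) x) ^ 2
      ≤ ∫ x in element σ i, 2 ^ d * ∑ n ∈ nodes i, (f x - p n x) ^ 2 := by
        refine setIntegral_mono_on (Continuous.integrableOn_isBounded hvc hb)
          (Continuous.integrableOn_isBounded ?_ hb) (measurableSet_element _ _) hpt
        exact continuous_const.mul (continuous_finsetSum _ fun n _ => hpc n)
    _ = 2 ^ d * ∑ n ∈ nodes i, ∫ x in element σ i, (f x - p n x) ^ 2 := by
        rw [integral_const_mul, integral_finsetSum]
        exact fun n _ => Continuous.integrableOn_isBounded (hpc n) hb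
    _ ≤ 2 ^ d * ∑ _n ∈ nodes i, (2 ^ d * ((d : ℝ) ^ (P + 1)) ^ 2 * (2 * σ) ^ (2 * (P + 1)) *
          ∫ x in nbhd σ i, gradSq (P + 1) f x) :=
        mul_le_mul_of_nonneg_left (Finset.sum_le_sum hnode) (by positivity)
    _ = _ := by
        rw [Finset.sum_const, card_nodes, nsmul_eq_mul]
        push_cast
        rw [mul_pow 2 σ]
        ring

/-- Local stability of a finite element approximation. -/
theorem local_stability (P : ℕ) (α : Fin d → ℕ) (hα : ∑ j, α j ≤ P + 1) :
    ∃ C : ℝ, 0 ≤ C ∧ ∀ σ : ℝ, 0 < σ → ∀ f : Space d → ℝ, IsSmoothCompact f →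
      ∀ v ∈ pufem d P σ, ∀ i,
      σ ^ (2 * ∑ j, α j) * ∫ x in element σ i, multiDeriv α v x ^ 2 ≤
        C * ((∫ x in element σ i, (f x - v x) ^ 2) +
          σ ^ (2 * ∑ j, α j) * ∫ x in nbhd σ i, gradSq (∑ j, α j) f x) := by
  obtain ⟨Ci, hCi0, hCi⟩ := inverse_estimate P α
  set k := ∑ j, α j with hk
  set c : ℝ := 2 ^ d * ((d : ℝ) ^ k) ^ 2 * 3 ^ (2 * k) with hc
  have hc0 : 0 ≤ c := by positivity
  refine ⟨2 * Ci * (1 + c), by positivity, fun σ hσ f hf v hv i => ?_⟩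
  -- A polynomial of degree less than `k = |α|` has `∂^α p = 0`, so the inverse estimate may be
  -- applied to `v - p`, which is small because `v` and `p` are both close to `f`.
  obtain ⟨p, hp, hest⟩ := exists_poly_approx_cube k hf.1 (σ • gridPt (i - 1))
    (s := 3 * σ) (by positivity)
  have hpP : p ∈ polySpace d P := by
    rw [← polyLT_succ]; exact polyLT_mono hα hp
  have hps := contDiff_of_mem_polySpace hpP
  have hvs := isSmoothCompact_of_mem_pufem hσ hv
  -- The polynomial itself is not in `pufem`. Multiplied by the partition functions of the nodes of
  -- `Q_i`, it is, and on `Q_i` nothing changes.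
  have hz : v - (∑ n ∈ nodes i, fun x => pou σ n x * p x) ∈ pufem d P σ :=
    Submodule.sub_mem _ hv (Submodule.sum_mem _ fun n _ =>
      Submodule.subset_span ⟨n, p, hpP, rfl⟩)
  have heq : Set.EqOn (v - (∑ n ∈ nodes i, fun x => pou σ n x * p x)) (v - p) (element σ i) := by
    intro x hx
    simp only [Pi.sub_apply, Finset.sum_apply]
    rw [← Finset.sum_mul, sum_nodes_pou hσ hx, one_mul]
  have hopen := isOpen_element (d := d) σ i
  have h1 := hCi σ hσ _ hz i
  have e1 : ∫ x in element σ i,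
      multiDeriv α (v - (∑ n ∈ nodes i, fun x => pou σ n x * p x)) x ^ 2 =
      ∫ x in element σ i, multiDeriv α v x ^ 2 := by
    refine setIntegral_congr_fun hopen.measurableSet fun x hx => ?_
    rw [multiDeriv_congr_of_isOpen hopen heq α hx, multiDeriv_sub hvs.1 hps,
      multiDeriv_of_mem_polyLT hp hk.symm, sub_zero]
  have e2 : ∫ x in element σ i, (v - (∑ n ∈ nodes i, fun x => pou σ n x * p x)) x ^ 2 =
      ∫ x in element σ i, (v x - p x) ^ 2 :=
    setIntegral_congr_fun hopen.measurableSet fun x hx => by simp only [heq hx, Pi.sub_apply]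
  rw [e1, e2] at h1
  have hb := isBounded_element (d := d) σ i
  have cf := hf.1.continuous
  have cv := hvs.1.continuous
  have cp := hps.continuous
  have h2 : ∫ x in element σ i, (v x - p x) ^ 2 ≤
      2 * ((∫ x in element σ i, (f x - v x) ^ 2) + ∫ x in element σ i, (f x - p x) ^ 2) := by
    rw [← integral_add (Continuous.integrableOn_isBounded (by fun_prop) hb)
      (Continuous.integrableOn_isBounded (by fun_prop) hb), ← integral_const_mul]
    refine setIntegral_mono_on (Continuous.integrableOn_isBounded (by fun_prop) hb)
      (Continuous.integrableOn_isBounded (by fun_prop) hb) hopen.measurableSet fun x _ => ?_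
    nlinarith [sq_nonneg ((f x - v x) + (f x - p x))]
  have h3 : ∫ x in element σ i, (f x - p x) ^ 2 ≤
      c * (σ ^ (2 * k) * ∫ x in nbhd σ i, gradSq k f x) := by
    have hbn : Bornology.IsBounded (nbhd σ i) := isBounded_cube _ _
    refine (setIntegral_mono_set (Continuous.integrableOn_isBounded
      (by fun_prop) hbn) (Filter.Eventually.of_forall fun _ => sq_nonneg _)
      (element_subset_nbhd hσ i).eventuallyLE).trans (hest.trans (le_of_eq ?_))
    rw [mul_pow 3 σ, hc, nbhd]
    ring
  set X := ∫ x in element σ i, (f x - v x) ^ 2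
  set Y := σ ^ (2 * k) * ∫ x in nbhd σ i, gradSq k f x
  have hX : 0 ≤ X := integral_nonneg fun _ => sq_nonneg _
  have hY : 0 ≤ Y := mul_nonneg (by positivity) (integral_nonneg fun _ => gradSq_nonneg _ _ _)
  refine h1.trans ?_
  calc Ci * ∫ x in element σ i, (v x - p x) ^ 2
      ≤ Ci * (2 * (X + c * Y)) :=
        mul_le_mul_of_nonneg_left (h2.trans (by linarith)) hCi0
    _ ≤ Ci * (2 * ((1 + c) * (X + Y))) := by
        gcongr
        nlinarith [mul_nonneg hc0 hX]
    _ = _ := by ring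

theorem integral_le_of_local {σ : ℝ} (hσ : 0 < σ) {g G : Space d → ℝ} (hg : Integrable g)
    (hG : Integrable G) (h0 : ∀ x, 0 ≤ G x)
    (h : ∀ i, ∫ x in element σ i, g x ≤ ∫ x in nbhd σ i, G x) :
    ∫ x, g x ≤ ((box d 1).card : ℝ) * ∫ x, G x := by
  have h1 := hasSum_sum_box_shift 1 (a := fun i => ∫ x in element σ i, G x)
    (hasSum_integral_element hσ hG)
  have h2 : ∀ i, ∫ x in element σ i, g x ≤ ∑ n ∈ box d 1, ∫ x in element σ (i + n), G x :=
    fun i => (h i).trans (setIntegral_nbhd_le hσ i hG h0)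
  exact hasSum_le h2 (hasSum_integral_element hσ hg) h1

/-- Dividing the local stability by `σ ^ (2 * |α|)` leaves the interpolation error bounded, because
`|α| ≤ P + 1` and `σ ≤ 1`. The neighbourhoods overlap finitely often. -/
theorem global_stability (P : ℕ) (α : Fin d → ℕ) (hα : ∑ j, α j ≤ P + 1) {C₁ : ℝ} (hC₁ : 0 ≤ C₁) :
    ∃ C : ℝ, 0 ≤ C ∧ ∀ σ : ℝ, 0 < σ → σ ≤ 1 → ∀ f : Space d → ℝ, IsSmoothCompact f →
      ∀ v ∈ pufem d P σ,
      (∀ i, ∫ x in element σ i, (f x - v x) ^ 2 ≤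
        C₁ * σ ^ (2 * (P + 1)) * ∫ x in nbhd σ i, gradSq (P + 1) f x) →
      ∫ x, multiDeriv α v x ^ 2 ≤
        C * ((∫ x, gradSq (P + 1) f x) + ∫ x, gradSq (∑ j, α j) f x) := by
  obtain ⟨C₂, hC₂0, hC₂⟩ := local_stability P α hα
  refine ⟨((box d 1).card : ℝ) * (C₂ * (C₁ + 1)), by positivity,
    fun σ hσ hσ1 f hf v hv hloc => ?_⟩
  have hvs := isSmoothCompact_of_mem_pufem hσ hv
  set k := ∑ j, α j with hk
  have hpow : σ ^ (2 * (P + 1)) ≤ σ ^ (2 * k) := pow_le_pow_of_le_one hσ.le hσ1 (by omega)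
  have hi1 := hf.integrable_gradSq (P + 1)
  have hi2 := hf.integrable_gradSq k
  have hlocal : ∀ i, ∫ x in element σ i, multiDeriv α v x ^ 2 ≤
      ∫ x in nbhd σ i, C₂ * (C₁ + 1) * (gradSq (P + 1) f x + gradSq k f x) := by
    intro i
    rw [integral_const_mul, integral_add hi1.integrableOn hi2.integrableOn]
    have h1 := hC₂ σ hσ f hf v hv i
    have h2 := hloc i
    have hX : 0 ≤ ∫ x in nbhd σ i, gradSq (P + 1) f x :=
      integral_nonneg fun _ => gradSq_nonneg _ _ _
    have hY : 0 ≤ ∫ x in nbhd σ i, gradSq k f x := integral_nonneg fun _ => gradSq_nonneg _ _ _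
    generalize (∫ x in nbhd σ i, gradSq (P + 1) f x) = X at *
    generalize (∫ x in nbhd σ i, gradSq k f x) = Y at *
    have h3 : C₁ * σ ^ (2 * (P + 1)) * X ≤ σ ^ (2 * k) * (C₁ * X) := by
      calc _ ≤ C₁ * σ ^ (2 * k) * X := by gcongr
        _ = _ := by ring
    have hσk : 0 < σ ^ (2 * k) := by positivity
    refine le_of_mul_le_mul_left (h1.trans ?_) hσk
    calc _ ≤ C₂ * (σ ^ (2 * k) * (C₁ * X) + σ ^ (2 * k) * Y) :=
          mul_le_mul_of_nonneg_left (by linarith) hC₂0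
      _ = C₂ * σ ^ (2 * k) * (C₁ * X + Y) := by ring
      _ ≤ C₂ * σ ^ (2 * k) * ((C₁ + 1) * (X + Y)) := by
          gcongr
          nlinarith [mul_nonneg hC₁ hY]
      _ = _ := by ring
  have h : ∫ x, multiDeriv α v x ^ 2 ≤ ((box d 1).card : ℝ) *
      ∫ x, C₂ * (C₁ + 1) * (gradSq (P + 1) f x + gradSq k f x) :=
    integral_le_of_local hσ (hvs.multiDeriv α).integrable_sq
    ((hi1.add hi2).const_mul (C₂ * (C₁ + 1)))
    (fun x => mul_nonneg (by positivity) (add_nonneg (gradSq_nonneg _ _ _) (gradSq_nonneg _ _ _)))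
    hlocal
  rw [integral_const_mul, integral_add hi1 hi2, ← mul_assoc] at h
  exact h

theorem quasi_interpolation (d P : ℕ) : ∃ C : ℝ, 0 ≤ C ∧ ∀ σ : ℝ, 0 < σ → σ ≤ 1 →
    ∀ f : Space d → ℝ, IsSmoothCompact f → ∃ v ∈ pufem d P σ,
      ∫ x, (f x - v x) ^ 2 ≤ C * σ ^ (2 * (P + 1)) * ∫ x, gradSq (P + 1) f x ∧
      ∀ α ∈ multiIndices d (P + 1), ∫ x, multiDeriv α v x ^ 2 ≤
        C * ((∫ x, gradSq (P + 1) f x) + ∫ x, gradSq (∑ j, α j) f x) := by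
  obtain ⟨C₁, hC₁0, hC₁⟩ := local_quasi_interpolation d P
  choose! C₂ hC₂0 hC₂ using fun (α : Fin d → ℕ) (hα : α ∈ multiIndices d (P + 1)) =>
    global_stability P α (mem_multiIndices.1 hα) hC₁0
  have hD0 : 0 ≤ ∑ α ∈ multiIndices d (P + 1), C₂ α := Finset.sum_nonneg hC₂0
  refine ⟨(∑ α ∈ multiIndices d (P + 1), C₂ α) + ((box d 1).card : ℝ) * C₁, by positivity,
    fun σ hσ hσ1 f hf => ?_⟩
  obtain ⟨v, hv, hloc⟩ := hC₁ σ hσ f hf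
  have hvs := isSmoothCompact_of_mem_pufem hσ hv
  have hG0 : ∀ k, 0 ≤ ∫ x, gradSq k f x := fun k => integral_nonneg fun _ => gradSq_nonneg _ _ _
  have hN0 : 0 ≤ ((box d 1).card : ℝ) * C₁ := by positivity
  refine ⟨v, hv, ?_, fun α hα => ?_⟩
  · have h := integral_le_of_local hσ (hf.sub hvs).integrable_sq
      ((hf.integrable_gradSq (P + 1)).const_mul (C₁ * σ ^ (2 * (P + 1))))
      (fun x => mul_nonneg (by positivity) (gradSq_nonneg _ _ _))
      (fun i => (hloc i).trans (le_of_eq (integral_const_mul _ _).symm))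
    rw [integral_const_mul] at h
    refine h.trans ?_
    have h4 : 0 ≤ σ ^ (2 * (P + 1)) * ∫ x, gradSq (P + 1) f x :=
      mul_nonneg (by positivity) (hG0 _)
    nlinarith [mul_nonneg hD0 h4]
  · refine (hC₂ α hα σ hσ hσ1 f hf v hv hloc).trans ?_
    refine mul_le_mul_of_nonneg_right ?_ (add_nonneg (hG0 _) (hG0 _))
    have := Finset.single_le_sum (f := C₂) hC₂0 hα
    linarith

end SmoothPUFEM

/-! ### Approximation on the domain and the abstract duality argument. -/

namespace SmoothPUFEM

variable {d : ℕ}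

/-! ### Approximation of Sobolev functions -/

theorem norm_toL2_le {k : ℕ} {Ω : Set (Space d)} (w : sobolev k Ω) : ‖toL2 k Ω w‖ ≤ ‖w‖ :=
  PiLp.norm_apply_le (p := 2) w.1 (zeroIdx d k)

theorem norm_restrict_le {Ω : Set (Space d)} {a : L2 Ω} {b : L2 (Set.univ : Set (Space d))}
    (h : a =ᵐ[volume.restrict Ω] b) : ‖a‖ ≤ ‖b‖ := by
  rw [Lp.norm_def, Lp.norm_def, eLpNorm_congr_ae h]
  refine ENNReal.toReal_mono (Lp.eLpNorm_ne_top b) (eLpNorm_mono_measure _ ?_)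
  exact Measure.restrict_mono (Set.subset_univ _) le_rfl

theorem integral_gradSq_le {k m : ℕ} (hk : k ≤ m) {f : Space d → ℝ} (hf : IsSmoothCompact f) :
    ∫ x, gradSq k f x ≤ ‖smoothToSobolev m Set.univ hf‖ ^ 2 := by
  rw [norm_sq_smoothToSobolev, ← setIntegral_univ, setIntegral_gradSq hf]
  refine Finset.sum_le_sum_of_subset_of_nonneg (fun α hα => ?_)
    fun _ _ _ => integral_nonneg fun _ => sq_nonneg _
  exact mem_multiIndices.2 ((mem_multiIndicesEq.1 hα).le.trans hk)

theorem le_mul_of_sq_le {a b c : ℝ} (hb : 0 ≤ b) (hc : 0 ≤ c) (h : a ^ 2 ≤ c * b ^ 2) :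
    a ≤ (c + 1) * b := by
  refine le_of_sq_le_sq ?_ (by positivity)
  have : c * b ^ 2 ≤ (c + 1) ^ 2 * b ^ 2 := by
    gcongr; nlinarith
  rw [mul_pow]
  exact h.trans this

-- The extension of `u` is smoothed with Sobolev error at most `σ ^ (P + 1) * ‖u‖` and then
-- quasi-interpolated. The stabilization needs no smallness of the approximation: derivatives of
-- order `P + 1` are bounded, and `stab` carries the factor `σ ^ (2 * (P + 1))`.
set_option maxHeartbeats 1000000 in
theorem exists_pufem_approx (d P : ℕ) {CE : ℝ} (hCE : 0 ≤ CE) : ∃ C : ℝ, 0 ≤ C ∧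
    ∀ (σ : ℝ) (hσ : 0 < σ), σ ≤ 1 → ∀ Ω : Set (Space d), HasExtension (P + 1) Ω CE →
    ∀ u : sobolev (P + 1) Ω, ∃ v : pufem d P σ,
      ‖derivL2 Ω 0 ⟨v.1, pufem_le_smoothFns hσ v.2⟩ - toL2 (P + 1) Ω u‖ ≤
        C * (σ ^ (P + 1) * ‖u‖) ∧
      ‖pufemToSobolev hσ (P + 1) Ω v‖ ≤ C * ‖u‖ ∧
      stab P σ Ω v v ≤ (C * (σ ^ (P + 1) * ‖u‖)) ^ 2 := by
  obtain ⟨Cq, hCq0, hCq⟩ := quasi_interpolation d P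
  set B : ℝ := CE + 1 with hB
  have hB0 : 0 ≤ B := by positivity
  set N : ℝ := ((multiIndices d (P + 1)).card : ℝ) with hN
  have hN0 : 0 ≤ N := Nat.cast_nonneg _
  -- `D` dominates both `Cq + 1` and the sum of the at most `N` derivative bounds `2 * Cq`, and `1 ≤
  -- D` allows `D ≤ D ^ 2` in the last estimate.
  set D : ℝ := (N + 1) * (2 * Cq) + 1 with hD
  have hD1 : 1 ≤ D := by
    have : 0 ≤ (N + 1) * (2 * Cq) := by positivity
    linarith
  refine ⟨(D + 1) * B + 1, by positivity, fun σ hσ hσ1 Ω hext u => ?_⟩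
  -- The tolerance `t * ‖u‖` of the smoothing has to be positive.
  rcases eq_or_ne u 0 with rfl | hu
  · refine ⟨0, ?_⟩
    have h0 : (⟨(0 : pufem d P σ).1, pufem_le_smoothFns hσ (0 : pufem d P σ).2⟩ : smoothFns d) = 0 :=
      rfl
    have hs : IsSmoothCompact (0 : Space d → ℝ) := ⟨contDiff_const, HasCompactSupport.zero⟩
    refine ⟨?_, ?_, ?_⟩
    · rw [h0]; simp
    · have : ‖pufemToSobolev hσ (P + 1) Ω (0 : pufem d P σ)‖ ^ 2 = 0 := by
        refine (norm_sq_smoothToSobolev _ _ hs).trans ?_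
        simp [multiDeriv_zero_fun]
      rw [pow_eq_zero_iff two_ne_zero] at this
      simp [this]
    · rw [ZeroMemClass.coe_zero, stab_self_eq P hσ Ω hs]
      simp [gradSq, multiDeriv_zero_fun]
  obtain ⟨T, hT, hTu⟩ := hext
  have hun : 0 < ‖u‖ := norm_pos_iff.2 hu
  have ht0 : 0 < σ ^ (P + 1) := by positivity
  have ht1 : σ ^ (P + 1) ≤ 1 := pow_le_one₀ hσ.le hσ1
  set t := σ ^ (P + 1) with ht
  obtain ⟨f, hf, hfT⟩ := exists_smooth_approx (P + 1) (T u) (δ := t * ‖u‖) (by positivity)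
  have hfB : ‖smoothToSobolev (P + 1) Set.univ hf‖ ≤ B * ‖u‖ := by
    have h1 : ‖T u‖ ≤ CE * ‖u‖ := (T.le_opNorm u).trans (by gcongr)
    have h2 := norm_sub_norm_le (smoothToSobolev (P + 1) Set.univ hf) (T u)
    rw [norm_sub_rev] at h2
    have h3 : t * ‖u‖ ≤ 1 * ‖u‖ := by gcongr
    rw [hB, add_mul]; linarith
  have hgrad : ∀ k ≤ P + 1, ∫ x, gradSq k f x ≤ (B * ‖u‖) ^ 2 := fun k hk =>
    (integral_gradSq_le hk hf).trans (pow_le_pow_left₀ (norm_nonneg _) hfB 2)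
  obtain ⟨v, hv, hv1, hv2⟩ := hCq σ hσ hσ1 f hf
  have hvs := isSmoothCompact_of_mem_pufem hσ hv
  have hder : ∀ α ∈ multiIndices d (P + 1), ∫ x, multiDeriv α v x ^ 2 ≤
      2 * Cq * (B * ‖u‖) ^ 2 := by
    intro α hα
    refine (hv2 α hα).trans ?_
    have h1 := hgrad (P + 1) le_rfl
    have h2 := hgrad (∑ j, α j) (mem_multiIndices.1 hα)
    calc _ ≤ Cq * ((B * ‖u‖) ^ 2 + (B * ‖u‖) ^ 2) := by gcongr
      _ = _ := by ring
  have hres : ∀ {g : Space d → ℝ} (U : Set (Space d)), Integrable g → (∀ x, 0 ≤ g x) →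
      ∫ x in U, g x ≤ ∫ x, g x := fun U hg h0 =>
    setIntegral_le_integral hg (Filter.Eventually.of_forall h0)
  have hBD : 0 ≤ B * ‖u‖ := by positivity
  refine ⟨⟨v, hv⟩, ?_, ?_, ?_⟩
  · have h1 : ‖derivL2 Ω 0 ⟨v, hvs⟩ - derivL2 Ω 0 ⟨f, hf⟩‖ ≤ D * (t * (B * ‖u‖)) := by
      rw [norm_sub_rev, ← map_sub]
      have h2 : ‖derivL2 Ω 0 ((⟨f, hf⟩ : smoothFns d) - ⟨v, hvs⟩)‖ ^ 2 ≤
          Cq * (t * (B * ‖u‖)) ^ 2 := by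
        rw [norm_sq_derivL2, multiDeriv_zero]
        refine (hres Ω (hf.sub hvs).integrable_sq fun _ => sq_nonneg _).trans (hv1.trans ?_)
        calc _ ≤ Cq * σ ^ (2 * (P + 1)) * (B * ‖u‖) ^ 2 := by
              have := hgrad (P + 1) le_rfl
              gcongr
          _ = _ := by rw [ht]; ring
      refine (le_mul_of_sq_le (by positivity) hCq0 h2).trans ?_
      gcongr
      nlinarith [mul_nonneg hN0 hCq0]
    have h3 : ‖derivL2 Ω 0 ⟨f, hf⟩ - toL2 (P + 1) Ω u‖ ≤ t * ‖u‖ := by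
      refine le_trans ?_ ((norm_toL2_le (T u - smoothToSobolev (P + 1) Set.univ hf)).trans hfT)
      rw [norm_sub_rev, map_sub]
      refine norm_restrict_le ?_
      have e1 := coeFn_derivL2 Ω 0 ⟨f, hf⟩
      have e2 := (coeFn_derivL2 Set.univ 0 ⟨f, hf⟩).filter_mono
        (ae_mono (Measure.restrict_mono (Set.subset_univ Ω) le_rfl))
      have e3 := (Lp.coeFn_sub (toL2 (P + 1) Set.univ (T u)) (derivL2 Set.univ 0 ⟨f, hf⟩)).filter_mono
        (ae_mono (Measure.restrict_mono (Set.subset_univ Ω) le_rfl))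
      filter_upwards [e1, e2, e3, hTu u, Lp.coeFn_sub (toL2 (P + 1) Ω u) (derivL2 Ω 0 ⟨f, hf⟩)]
        with x h1 h2 h3 h4 h5
      rw [h5, Pi.sub_apply, h1, ← h4]
      refine Eq.trans ?_ h3.symm
      rw [Pi.sub_apply, h2]
    calc ‖derivL2 Ω 0 ⟨v, hvs⟩ - toL2 (P + 1) Ω u‖
        ≤ ‖derivL2 Ω 0 ⟨v, hvs⟩ - derivL2 Ω 0 ⟨f, hf⟩‖ +
          ‖derivL2 Ω 0 ⟨f, hf⟩ - toL2 (P + 1) Ω u‖ := norm_sub_le_norm_sub_add_norm_sub _ _ _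
      _ ≤ D * (t * (B * ‖u‖)) + t * ‖u‖ := add_le_add h1 h3
      _ ≤ _ := by
        have : 0 ≤ t * (B * ‖u‖) := by positivity
        nlinarith
  · have h1 : ‖pufemToSobolev hσ (P + 1) Ω ⟨v, hv⟩‖ ^ 2 ≤ D * (B * ‖u‖) ^ 2 := by
      refine (norm_sq_smoothToSobolev _ _ hvs).le.trans ?_
      calc _ ≤ ∑ _α ∈ multiIndices d (P + 1), 2 * Cq * (B * ‖u‖) ^ 2 :=
            Finset.sum_le_sum fun α hα => (hres Ω (hvs.multiDeriv α).integrable_sq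
              fun _ => sq_nonneg _).trans (hder α hα)
        _ = N * (2 * Cq) * (B * ‖u‖) ^ 2 := by
            rw [Finset.sum_const, nsmul_eq_mul]; ring
        _ ≤ D * (B * ‖u‖) ^ 2 := by
            gcongr
            nlinarith
    refine (le_mul_of_sq_le hBD (by linarith) h1).trans ?_
    nlinarith
  · rw [stab_self_eq P hσ Ω hvs, setIntegral_gradSq hvs]
    have hsub : multiIndicesEq d (P + 1) ⊆ multiIndices d (P + 1) := fun α hα =>
      mem_multiIndices.2 (mem_multiIndicesEq.1 hα).le
    have h1 : ∑ α ∈ multiIndicesEq d (P + 1),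
        ∫ x in elementUnion σ (cutElements σ Ω), multiDeriv α v x ^ 2 ≤ D * (B * ‖u‖) ^ 2 := by
      calc _ ≤ ∑ _α ∈ multiIndicesEq d (P + 1), 2 * Cq * (B * ‖u‖) ^ 2 :=
            Finset.sum_le_sum fun α hα => (hres _ (hvs.multiDeriv α).integrable_sq
              fun _ => sq_nonneg _).trans (hder α (hsub hα))
        _ = (multiIndicesEq d (P + 1)).card * (2 * Cq) * (B * ‖u‖) ^ 2 := by
            rw [Finset.sum_const, nsmul_eq_mul]; ring
        _ ≤ N * (2 * Cq) * (B * ‖u‖) ^ 2 := by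
            have : ((multiIndicesEq d (P + 1)).card : ℝ) ≤ N := by
              rw [hN]; exact Nat.cast_le.2 (Finset.card_le_card hsub)
            gcongr
        _ ≤ D * (B * ‖u‖) ^ 2 := by
            gcongr
            nlinarith
    have h2 : σ ^ (2 * (P + 1)) * (D * (B * ‖u‖) ^ 2) ≤ (D * (t * (B * ‖u‖))) ^ 2 := by
      have e1 : σ ^ (2 * (P + 1)) * (D * (B * ‖u‖) ^ 2) = D * (t * (B * ‖u‖)) ^ 2 := by
        rw [ht]; ring
      have e2 : (D * (t * (B * ‖u‖))) ^ 2 = D * (D * (t * (B * ‖u‖)) ^ 2) := by ring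
      rw [e1, e2]
      exact le_mul_of_one_le_left (by positivity) hD1
    have h3 : D * (t * (B * ‖u‖)) ≤ ((D + 1) * B + 1) * (t * ‖u‖) := by
      have h4 : 0 ≤ t * ‖u‖ := by positivity
      have h5 : 0 ≤ B * (t * ‖u‖) := by positivity
      linarith
    exact (mul_le_mul_of_nonneg_left h1 (by positivity)).trans
      (h2.trans (pow_le_pow_left₀ (by positivity) h3 2))

/-! ### The energy space -/

/-- The scaled derivatives of order `P + 1` on the cut elements. -/
noncomputable def stabMap (P : ℕ) (σ : ℝ) (Ω : Set (Space d)) : smoothFns d →ₗ[ℝ]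
    PiLp 2 (fun _ : multiIndicesEq d (P + 1) => L2 (elementUnion σ (cutElements σ Ω))) :=
  (WithLp.linearEquiv 2 ℝ _).symm.toLinearMap ∘ₗ
    LinearMap.pi fun α => σ ^ (P + 1) • derivL2 (elementUnion σ (cutElements σ Ω)) α.1

theorem stab_eq_inner (P : ℕ) {σ : ℝ} (hσ : 0 < σ) (Ω : Set (Space d)) (u v : smoothFns d) :
    stab P σ Ω u v = inner ℝ (stabMap P σ Ω u) (stabMap P σ Ω v) := by
  rw [stab_eq P hσ Ω u.2 v.2, PiLp.inner_apply, Finset.mul_sum]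
  rw [← Finset.sum_coe_sort (multiIndicesEq d (P + 1))]
  refine Finset.sum_congr rfl fun α _ => ?_
  change _ = inner ℝ (σ ^ (P + 1) • derivL2 (elementUnion σ (cutElements σ Ω)) α.1 u)
    (σ ^ (P + 1) • derivL2 (elementUnion σ (cutElements σ Ω)) α.1 v)
  rw [real_inner_smul_left, real_inner_smul_right, inner_derivL2]
  ring

theorem bilinA_eq_inner (P : ℕ) {σ : ℝ} (hσ : 0 < σ) (ε : ℝ) (Ω : Set (Space d))
    (u v : smoothFns d) : bilinA P σ ε Ω u v = inner ℝ (derivL2 Ω 0 u) (derivL2 Ω 0 v) +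
      ε * inner ℝ (stabMap P σ Ω u) (stabMap P σ Ω v) := by
  rw [bilinA, stab_eq_inner P hσ, inner_derivL2, multiDeriv_zero, multiDeriv_zero]

/-- An Aubin–Nitsche argument without a dual equation: `D` and `J` are the two parts of the energy,
`S` embeds finite element functions into the Sobolev space `W`, and `ι` forgets derivatives. An
energy error of order `t` meets an approximation error of order `t` for `φ`. -/
theorem abstract_error_estimate {H H' W V : Type*} [NormedAddCommGroup H] [InnerProductSpace ℝ H]
    [NormedAddCommGroup H'] [InnerProductSpace ℝ H'] [NormedAddCommGroup W] [NormedSpace ℝ W]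
    [AddCommGroup V] [Module ℝ V] (ι : W →L[ℝ] H) (D : V →ₗ[ℝ] H) (J : V →ₗ[ℝ] H') (S : V → W)
    {ε t c₁ c₂ cp : ℝ} (hε : 0 < ε) (ht : 0 < t) (hc₁ : 0 ≤ c₁) (hc₂ : 0 ≤ c₂) (hcp : 0 ≤ cp)
    (hι : ∀ v, ι (S v) = D v)
    (hS : ∀ v, t * ‖S v‖ ≤ c₁ * √(‖D v‖ ^ 2 + ε * ‖J v‖ ^ 2))
    (happ : ∀ φ, ∃ v, ‖D v - ι φ‖ ≤ c₂ * (t * ‖φ‖) ∧ ‖S v‖ ≤ c₂ * ‖φ‖ ∧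
      ‖J v‖ ≤ c₂ * (t * ‖φ‖))
    (u : W) (uh : W →L[ℝ] ℝ)
    (hu : ∀ φ, |uh φ - inner ℝ (ι u) (ι φ)| ≤ cp * (t * t) * ‖u‖ * ‖φ‖)
    (x : V) (hx : ∀ v, inner ℝ (D x) (D v) + ε * inner ℝ (J x) (J v) = uh (S v)) (φ : W) :
    |inner ℝ (D x - ι u) (ι φ)| ≤ ((cp * c₁ + c₂ + √ε * c₂ + c₂) * c₂ + cp * c₂ +
      √ε * (cp * c₁ + c₂ + √ε * c₂ + √ε * c₂) * c₂) * (t * t) * ‖u‖ * ‖φ‖ := by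
  obtain ⟨p, hp1, -, hp3⟩ := happ u
  obtain ⟨q, hq1, hq2, hq3⟩ := happ φ
  have hsε : √ε * √ε = ε := Real.mul_self_sqrt hε.le
  have hsε0 : 0 ≤ √ε := Real.sqrt_nonneg _
  set w := x - p with hw
  set a := √(‖D w‖ ^ 2 + ε * ‖J w‖ ^ 2) with ha
  have ha0 : 0 ≤ a := Real.sqrt_nonneg _
  have ha2 : a ^ 2 = ‖D w‖ ^ 2 + ε * ‖J w‖ ^ 2 := Real.sq_sqrt (by positivity)
  have hDw : ‖D w‖ ≤ a := Real.le_sqrt_of_sq_le (by nlinarith [sq_nonneg ‖J w‖])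
  have hJw : √ε * ‖J w‖ ≤ a := by
    refine Real.le_sqrt_of_sq_le ?_
    rw [mul_pow, Real.sq_sqrt hε.le]
    nlinarith [sq_nonneg ‖D w‖]
  have hU : 0 ≤ t * ‖u‖ := by positivity
  have hF : 0 ≤ t * ‖φ‖ := by positivity
  -- The energy of `x - p` is tested with itself. Its three parts are the data error, where `hS`
  -- trades one factor `t` for the energy, the approximation error of `p`, and the inconsistency
  -- caused by the stabilization of `p`.
  have key : a ^ 2 ≤ (cp * c₁ + c₂ + √ε * c₂) * (t * ‖u‖) * a := by
    have e : a ^ 2 = (uh (S w) - inner ℝ (ι u) (ι (S w))) - inner ℝ (D p - ι u) (D w) -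
        ε * inner ℝ (J p) (J w) := by
      rw [← hx w, hι, ha2, inner_sub_left, ← real_inner_self_eq_norm_sq,
        ← real_inner_self_eq_norm_sq]
      have h1 : inner ℝ (D w) (D w) = inner ℝ (D x) (D w) - inner ℝ (D p) (D w) := by
        rw [← inner_sub_left, ← map_sub]
      have h2 : inner ℝ (J w) (J w) = inner ℝ (J x) (J w) - inner ℝ (J p) (J w) := by
        rw [← inner_sub_left, ← map_sub]
      rw [h1, h2]; ring
    have b1 : uh (S w) - inner ℝ (ι u) (ι (S w)) ≤ cp * c₁ * (t * ‖u‖) * a := by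
      refine (le_abs_self _).trans ((hu _).trans ?_)
      calc _ = cp * (t * ‖u‖) * (t * ‖S w‖) := by ring
        _ ≤ cp * (t * ‖u‖) * (c₁ * a) := by
          have := hS w
          gcongr
        _ = _ := by ring
    have b2 : -inner ℝ (D p - ι u) (D w) ≤ c₂ * (t * ‖u‖) * a := by
      refine (neg_le_abs _).trans ((abs_real_inner_le_norm _ _).trans ?_)
      gcongr
    have b3 : -(ε * inner ℝ (J p) (J w)) ≤ √ε * c₂ * (t * ‖u‖) * a := by
      have h1 : -inner ℝ (J p) (J w) ≤ ‖J p‖ * ‖J w‖ :=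
        (neg_le_abs _).trans (abs_real_inner_le_norm _ _)
      calc -(ε * inner ℝ (J p) (J w)) = ε * -inner ℝ (J p) (J w) := by ring
        _ ≤ ε * (‖J p‖ * ‖J w‖) := by gcongr
        _ = √ε * ‖J p‖ * (√ε * ‖J w‖) := by 
            calc _ = √ε * √ε * (‖J p‖ * ‖J w‖) := by rw [hsε]
              _ = _ := by ring
        _ ≤ √ε * (c₂ * (t * ‖u‖)) * a := by gcongr
        _ = _ := by ring
    rw [e]
    linarith
  set c₃ := cp * c₁ + c₂ + √ε * c₂ with hc₃
  have haU : a ≤ c₃ * (t * ‖u‖) := by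
    rcases ha0.eq_or_lt with h0 | h0
    · rw [← h0]; positivity
    · exact le_of_mul_le_mul_right (by rwa [← sq]) h0
  have hc₃0 : 0 ≤ c₃ := by positivity
  have hDw' : D w = D x - D p := map_sub _ _ _
  have hJw' : J w = J x - J p := map_sub _ _ _
  have hDx : ‖D x - ι u‖ ≤ (c₃ + c₂) * (t * ‖u‖) := by
    have : D x - ι u = D w + (D p - ι u) := by rw [hDw']; abel
    rw [this, add_mul]
    exact (norm_add_le _ _).trans (add_le_add (hDw.trans haU) hp1)
  have hJx : √ε * ‖J x‖ ≤ (c₃ + √ε * c₂) * (t * ‖u‖) := by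
    have : J x = J w + J p := by rw [hJw']; abel
    have h1 : √ε * ‖J x‖ ≤ √ε * ‖J w‖ + √ε * ‖J p‖ := by
      rw [this, ← mul_add]; gcongr; exact norm_add_le _ _
    have h2 : √ε * ‖J p‖ ≤ √ε * (c₂ * (t * ‖u‖)) := by gcongr
    linarith
  -- The equation is used with the test function `q`. Here `‖S q‖ ≤ c₂ * ‖φ‖` is essential, since
  -- `hS` would lose a factor `t` in the data error.
  have e : inner ℝ (D x - ι u) (ι φ) = -inner ℝ (D x - ι u) (D q - ι φ) +
      ((uh (S q) - inner ℝ (ι u) (ι (S q))) - ε * inner ℝ (J x) (J q)) := by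
    rw [← hx q, hι, inner_sub_right, inner_sub_left (D x) (ι u) (D q)]; ring
  have b1 : |inner ℝ (D x - ι u) (D q - ι φ)| ≤ (c₃ + c₂) * (t * ‖u‖) * (c₂ * (t * ‖φ‖)) :=
    (abs_real_inner_le_norm _ _).trans (by gcongr)
  have b2 : |uh (S q) - inner ℝ (ι u) (ι (S q))| ≤ cp * (t * t) * ‖u‖ * (c₂ * ‖φ‖) :=
    (hu _).trans (by gcongr)
  have b3 : |ε * inner ℝ (J x) (J q)| ≤
      (c₃ + √ε * c₂) * (t * ‖u‖) * (√ε * (c₂ * (t * ‖φ‖))) := by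
    rw [abs_mul, abs_of_pos hε]
    calc ε * |inner ℝ (J x) (J q)| ≤ ε * (‖J x‖ * ‖J q‖) := by
          gcongr; exact abs_real_inner_le_norm _ _
      _ = √ε * ‖J x‖ * (√ε * ‖J q‖) := by
          calc _ = √ε * √ε * (‖J x‖ * ‖J q‖) := by rw [hsε]
            _ = _ := by ring
      _ ≤ _ := by gcongr
  rw [e]
  refine (abs_add_le _ _).trans ?_
  rw [abs_neg]
  refine (add_le_add b1 ((abs_sub _ _).trans (add_le_add b2 b3))).trans (le_of_eq ?_)
  ring

end SmoothPUFEM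

namespace SmoothPUFEM

variable {d : ℕ}

/-! ### Existence, uniqueness and the error estimate -/

/-- The functional `l` descends to the finite-dimensional range of `T`, where the Riesz theorem
represents it. `T` need not be injective, so different elements of `E` may solve the problem. -/
theorem exists_inner_eq_of_ker_le {E H : Type*} [AddCommGroup E] [Module ℝ E]
    [FiniteDimensional ℝ E] [NormedAddCommGroup H] [InnerProductSpace ℝ H]
    (T : E →ₗ[ℝ] H) (l : E →ₗ[ℝ] ℝ) (h : ∀ v, T v = 0 → l v = 0) :
    ∃ w, ∀ v, inner ℝ (T w) (T v) = l v := by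
  obtain ⟨s, hs⟩ := T.rangeRestrict.exists_rightInverse_of_surjective T.range_rangeRestrict
  obtain ⟨⟨_, w, rfl⟩, hw⟩ := (InnerProductSpace.toDual ℝ T.range).surjective
    (LinearMap.toContinuousLinearMap (l ∘ₗ s))
  refine ⟨w, fun v => ?_⟩
  have h1 := DFunLike.congr_fun hw (T.rangeRestrict v)
  rw [InnerProductSpace.toDual_apply_apply] at h1
  refine Eq.trans h1 ?_
  have h2 : T (s (T.rangeRestrict v) - v) = 0 := by
    rw [map_sub, sub_eq_zero]
    exact congrArg Subtype.val (LinearMap.congr_fun hs (T.rangeRestrict v))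
  have h3 := h _ h2
  rw [map_sub, sub_eq_zero] at h3
  exact h3

/-- The inclusion of the finite element space into the smooth compactly supported functions. -/
noncomputable def pufemIncl (P : ℕ) {σ : ℝ} (hσ : 0 < σ) : pufem d P σ →ₗ[ℝ] smoothFns d :=
  Submodule.inclusion (pufem_le_smoothFns hσ)

/-- The restriction of finite element functions to `Ω` as a linear map. -/
noncomputable def pufemToSobolevLM (P : ℕ) {σ : ℝ} (hσ : 0 < σ) (k : ℕ) (Ω : Set (Space d)) :
    pufem d P σ →ₗ[ℝ] sobolev k Ω where
  toFun := pufemToSobolev hσ k Ω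
  map_add' v w := Subtype.ext <| PiLp.ext fun α =>
    map_add (derivL2 Ω α.1) (pufemIncl P hσ v) (pufemIncl P hσ w)
  map_smul' c v := Subtype.ext <| PiLp.ext fun α =>
    map_smul (derivL2 Ω α.1) c (pufemIncl P hσ v)

/-- A linear map that represents the form `A` as an inner product. -/
noncomputable def energyMap (P : ℕ) {σ : ℝ} (hσ : 0 < σ) (ε : ℝ) (Ω : Set (Space d)) :
    pufem d P σ →ₗ[ℝ] WithLp 2 (L2 Ω ×
      PiLp 2 (fun _ : multiIndicesEq d (P + 1) => L2 (elementUnion σ (cutElements σ Ω)))) :=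
  (WithLp.linearEquiv 2 ℝ _).symm.toLinearMap ∘ₗ
    (LinearMap.prod (derivL2 Ω 0) (√ε • stabMap P σ Ω)) ∘ₗ pufemIncl P hσ

theorem bilinA_eq_inner_energyMap (P : ℕ) {σ : ℝ} (hσ : 0 < σ) {ε : ℝ} (hε : 0 < ε)
    (Ω : Set (Space d)) (u v : pufem d P σ) :
    bilinA P σ ε Ω u v = inner ℝ (energyMap P hσ ε Ω u) (energyMap P hσ ε Ω v) := by
  refine (bilinA_eq_inner P hσ ε Ω (pufemIncl P hσ u) (pufemIncl P hσ v)).trans ?_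
  rw [WithLp.prod_inner_apply]
  change _ = inner ℝ (derivL2 Ω 0 (pufemIncl P hσ u)) (derivL2 Ω 0 (pufemIncl P hσ v)) +
    inner ℝ (√ε • stabMap P σ Ω (pufemIncl P hσ u)) (√ε • stabMap P σ Ω (pufemIncl P hσ v))
  rw [real_inner_smul_left, real_inner_smul_right, ← mul_assoc, Real.mul_self_sqrt hε.le]

/-- The energy sees a function only on `Ω` and on the cut elements, so it may be replaced by any
representative there. -/
theorem energyMap_eq_zero {P : ℕ} {σ : ℝ} (hσ : 0 < σ) {ε : ℝ} {Ω B : Set (Space d)}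
    (hΩ : IsOpen Ω) (hΩB : Ω ⊆ B) (hcB : elementUnion σ (cutElements σ Ω) ⊆ B)
    {v : pufem d P σ} (hv : Set.EqOn v.1 0 B) : energyMap P hσ ε Ω v = 0 := by
  have h0 : ∀ {U : Set (Space d)}, IsOpen U → U ⊆ B → ∀ α, derivL2 U α (pufemIncl P hσ v) = 0 := by
    intro U hU hUB α
    rw [derivL2_eq_zero_iff hU]
    have := multiDeriv_congr_of_isOpen hU (hv.mono hUB) α
    rwa [multiDeriv_zero_fun] at this
  have h1 : stabMap P σ Ω (pufemIncl P hσ v) = 0 := by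
    refine PiLp.ext fun α => ?_
    change σ ^ (P + 1) • derivL2 (elementUnion σ (cutElements σ Ω)) α.1 (pufemIncl P hσ v) = 0
    rw [h0 (isOpen_elementUnion _ _) hcB, smul_zero]
  change WithLp.toLp 2 (derivL2 Ω 0 (pufemIncl P hσ v),
    √ε • stabMap P σ Ω (pufemIncl P hσ v)) = 0
  rw [h0 hΩ hΩB, h1, smul_zero]
  rfl

theorem isBounded_activeUnion {σ : ℝ} {Ω : Set (Space d)} (hΩ : Bornology.IsBounded Ω) :
    Bornology.IsBounded (elementUnion σ (activeElements σ Ω)) := by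
  obtain ⟨R, hR⟩ := hΩ.exists_norm_le
  refine isBounded_iff_forall_norm_le.2 ⟨R + √(∑ _j : Fin d, σ ^ 2), fun x hx => ?_⟩
  obtain ⟨i, hi, hx⟩ := Set.mem_iUnion₂.1 hx
  obtain ⟨y, hy, hyΩ⟩ : (element σ i ∩ Ω).Nonempty :=
    nonempty_of_measure_ne_zero (μ := volume) (ne_of_gt hi)
  have h1 : ‖x - y‖ ≤ √(∑ _j : Fin d, σ ^ 2) := by
    rw [EuclideanSpace.norm_eq]
    refine Real.sqrt_le_sqrt (Finset.sum_le_sum fun j _ => ?_)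
    rw [PiLp.sub_apply, Real.norm_eq_abs, sq_abs]
    obtain ⟨a1, a2⟩ := hx j
    obtain ⟨b1, b2⟩ := hy j
    exact sq_le_sq' (by linarith) (by linarith)
  calc ‖x‖ = ‖y + (x - y)‖ := by rw [add_sub_cancel]
    _ ≤ ‖y‖ + ‖x - y‖ := norm_add_le _ _
    _ ≤ _ := add_le_add (hR y hyΩ) h1

theorem exists_isSmoothed {P : ℕ} {σ : ℝ} (hσ : 0 < σ) {ε : ℝ} (hε : 0 < ε)
    {Ω : Set (Space d)} (hΩ : IsOpen Ω) (hb : Bornology.IsBounded Ω)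
    (hker : ∀ v : pufem d P σ, energyMap P hσ ε Ω v = 0 → pufemToSobolev hσ (P + 1) Ω v = 0)
    (uh : NegSobolev (P + 1) Ω) : ∃ uσ : pufem d P σ, IsSmoothed hσ ε uh uσ := by
  have hcut : elementUnion σ (cutElements σ Ω) ⊆ elementUnion σ (activeElements σ Ω) :=
    Set.biUnion_mono (fun i hi => hi.1) fun _ _ => subset_rfl
  obtain ⟨F, hF, hfin, hrep⟩ := exists_finiteDimensional_rep P hσ
    (hb.union (isBounded_activeUnion (σ := σ) hb))
  obtain ⟨w, hw⟩ := exists_inner_eq_of_ker_le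
    (energyMap P hσ ε Ω ∘ₗ Submodule.inclusion hF)
    (uh.toLinearMap ∘ₗ pufemToSobolevLM P hσ (P + 1) Ω ∘ₗ Submodule.inclusion hF) (fun v hv => by
      have := hker _ hv
      change uh (pufemToSobolev hσ (P + 1) Ω (Submodule.inclusion hF v)) = 0
      rw [this, map_zero])
  refine ⟨Submodule.inclusion hF w, fun v => ?_⟩
  -- The problem was solved with test functions in `F` only. A general test function differs from
  -- one in `F` by a function of zero energy, and by `hker` the data do not see this difference
  -- either.
  obtain ⟨v', hv', hvv'⟩ := hrep v.1 v.2
  have h1 : energyMap P hσ ε Ω (v - ⟨v', hF hv'⟩) = 0 :=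
    energyMap_eq_zero hσ hΩ Set.subset_union_left (hcut.trans Set.subset_union_right)
      fun x hx => sub_eq_zero.2 (hvv' hx)
  have h2 : pufemToSobolevLM P hσ (P + 1) Ω (v - ⟨v', hF hv'⟩) = 0 := hker _ h1
  rw [map_sub, sub_eq_zero] at h1 h2
  rw [bilinA_eq_inner_energyMap P hσ hε, h1]
  refine (hw ⟨v', hv'⟩).trans ?_
  exact congrArg uh h2.symm

/-- The difference of two solutions has zero energy, hence vanishes on the active elements, and by
continuity on their closures, which cover the fictitious domain. Outside it the global
representatives are not determined. -/
theorem eqOn_of_isSmoothed {P : ℕ} {σ : ℝ} (hσ : 0 < σ) {ε : ℝ} (hε : 0 < ε)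
    {Ω : Set (Space d)} {C : ℝ}
    (hC : ∀ w : pufem d P σ,
      (∫ x in elementUnion σ (activeElements σ Ω), w.1 x ^ 2) ≤ C * bilinA P σ ε Ω w w)
    {uh : NegSobolev (P + 1) Ω} {u v : pufem d P σ} (hu : IsSmoothed hσ ε uh u)
    (hv : IsSmoothed hσ ε uh v) : Set.EqOn u.1 v.1 (fictitiousDomain σ Ω) := by
  have h0 : bilinA P σ ε Ω (u - v : pufem d P σ) (u - v : pufem d P σ) = 0 := by
    rw [bilinA_eq_inner_energyMap P hσ hε, map_sub, inner_sub_left, ← map_sub,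
      ← bilinA_eq_inner_energyMap P hσ hε, ← bilinA_eq_inner_energyMap P hσ hε, hu, hv, sub_self]
  have h1 := hC (u - v)
  rw [h0, mul_zero] at h1
  have hopen := isOpen_elementUnion σ (activeElements σ Ω)
  have h2 : derivL2 (elementUnion σ (activeElements σ Ω)) 0 (pufemIncl P hσ (u - v)) = 0 := by
    rw [← norm_eq_zero, ← sq_eq_zero_iff]
    refine le_antisymm ?_ (sq_nonneg _)
    rw [norm_sq_derivL2, multiDeriv_zero]
    exact h1
  rw [derivL2_eq_zero_iff hopen, multiDeriv_zero] at h2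
  have h3 : Set.EqOn u.1 v.1 (elementUnion σ (activeElements σ Ω)) := fun x hx =>
    sub_eq_zero.1 (h2 hx)
  refine (h3.closure (pufemIncl P hσ u).2.1.continuous (pufemIncl P hσ v).2.1.continuous).mono ?_
  refine interior_subset.trans (Set.iUnion₂_subset fun i hi => closure_mono ?_)
  exact Set.subset_biUnion_of_mem (u := fun i => element σ i) hi

theorem HasExtension.mono {k : ℕ} {Ω : Set (Space d)} {C C' : ℝ} (h : HasExtension k Ω C)
    (hC : C ≤ C') : HasExtension k Ω C' := by
  obtain ⟨T, hT, hTu⟩ := h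
  exact ⟨T, hT.trans hC, hTu⟩

theorem error_estimate (d P K : ℕ) {ε : ℝ} (hε : 0 < ε) (CE Cp : ℝ) :
    ∃ C : ℝ, 0 ≤ C ∧ ∀ Ω : Set (Space d), IsOpen Ω → HasExtension (P + 1) Ω CE →
      ∀ (σ : ℝ) (hσ : 0 < σ), σ ≤ 1 → ReachableFromUncut σ Ω K →
      ∀ (u : sobolev (P + 1) Ω) (uh : NegSobolev (P + 1) Ω),
        ‖uh - toNeg (P + 1) (toL2 (P + 1) Ω u)‖ ≤ Cp * (σ ^ 2) ^ (P + 1) * ‖u‖ →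
        ∀ uσ : pufem d P σ, IsSmoothed hσ ε uh uσ →
          ‖toNeg (P + 1) (toL2 (P + 1) Ω (pufemToSobolev hσ (P + 1) Ω uσ)) -
            toNeg (P + 1) (toL2 (P + 1) Ω u)‖ ≤ C * (σ ^ 2) ^ (P + 1) * ‖u‖ := by
  obtain ⟨C₁, hC₁, h₁⟩ := norm_sq_pufemToSobolev_le d P K hε
  obtain ⟨c₂, hc₂, h₂⟩ := exists_pufem_approx d P (abs_nonneg CE)
  -- The constant of `abstract_error_estimate` with `c₁ = √C₁`. Absolute values appear because `CE`
  -- and `Cp` have no prescribed sign.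
  refine ⟨(|Cp| * √C₁ + c₂ + √ε * c₂ + c₂) * c₂ + |Cp| * c₂ +
      √ε * (|Cp| * √C₁ + c₂ + √ε * c₂ + √ε * c₂) * c₂, by positivity,
    fun Ω hΩ hext σ hσ hσ1 hreach u uh hu x hx => ?_⟩
  have htt : (σ ^ 2) ^ (P + 1) = σ ^ (P + 1) * σ ^ (P + 1) := by ring
  refine ContinuousLinearMap.opNorm_le_bound _ (by positivity) fun φ => ?_
  rw [htt]
  have key := abstract_error_estimate (toL2 (P + 1) Ω) (derivL2 Ω 0 ∘ₗ pufemIncl P hσ)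
    (stabMap P σ Ω ∘ₗ pufemIncl P hσ) (pufemToSobolev hσ (P + 1) Ω) (t := σ ^ (P + 1))
    (c₁ := √C₁) (c₂ := c₂) (cp := |Cp|) hε (by positivity) (Real.sqrt_nonneg _) hc₂ (abs_nonneg _)
    (fun v => rfl) (fun v => ?_) (fun φ => ?_) u uh (fun φ => ?_) x (fun v => ?_) φ
  · have e : (toNeg (P + 1) (toL2 (P + 1) Ω (pufemToSobolev hσ (P + 1) Ω x)) -
        toNeg (P + 1) (toL2 (P + 1) Ω u)) φ = inner ℝ ((derivL2 Ω 0 ∘ₗ pufemIncl P hσ) x -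
          toL2 (P + 1) Ω u) (toL2 (P + 1) Ω φ) := by
      rw [inner_sub_left]; rfl
    rw [e]
    exact key
  · rw [← Real.sqrt_mul hC₁]
    refine Real.le_sqrt_of_sq_le ?_
    have h3 := (h₁ σ hσ hσ1 Ω hΩ hreach v).2
    have h4 : bilinA P σ ε Ω v v = ‖derivL2 Ω 0 (pufemIncl P hσ v)‖ ^ 2 +
        ε * ‖stabMap P σ Ω (pufemIncl P hσ v)‖ ^ 2 := by
      rw [← real_inner_self_eq_norm_sq, ← real_inner_self_eq_norm_sq]
      exact bilinA_eq_inner P hσ ε Ω (pufemIncl P hσ v) (pufemIncl P hσ v)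
    rw [h4] at h3
    refine le_trans (le_of_eq ?_) h3
    ring
  · obtain ⟨v, hv1, hv2, hv3⟩ := h₂ σ hσ hσ1 Ω (hext.mono (le_abs_self _)) φ
    refine ⟨v, hv1, hv2, ?_⟩
    refine le_of_sq_le_sq ?_ (by positivity)
    have h4 : stab P σ Ω v v = ‖stabMap P σ Ω (pufemIncl P hσ v)‖ ^ 2 := by
      rw [← real_inner_self_eq_norm_sq]
      exact stab_eq_inner P hσ Ω (pufemIncl P hσ v) (pufemIncl P hσ v)
    rwa [h4] at hv3
  · have h3 := ContinuousLinearMap.le_of_opNorm_le _ hu φ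
    refine (h3.trans ?_)
    rw [htt]
    gcongr
    exact le_abs_self _
  · rw [← hx v]
    exact (bilinA_eq_inner P hσ ε Ω (pufemIncl P hσ x) (pufemIncl P hσ v)).symm

end SmoothPUFEM

theorem mainTheorem2 (d P K : ℕ) (hd : 1 ≤ d) (ε CE Cp : ℝ) (hε : 0 < ε) :
    ∃ C > 0, ∃ σ₀ > 0, ∀ Ω : Set (Space d), IsOpen Ω → HasExtension (P + 1) Ω CE →
      ∀ (h σ : ℝ) (hσ : 0 < σ), σ ≤ σ₀ → h = σ ^ 2 → ReachableFromUncut σ Ω K →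
      ∀ (u : sobolev (P + 1) Ω) (uh : NegSobolev (P + 1) Ω),
        ‖uh - toNeg (P + 1) (toL2 (P + 1) Ω u)‖ ≤ Cp * h ^ (P + 1) * ‖u‖ →
        (∀ uσ : pufem d P σ, IsSmoothed hσ ε uh uσ →
          ‖toNeg (P + 1) (toL2 (P + 1) Ω (pufemToSobolev hσ (P + 1) Ω uσ)) -
            toNeg (P + 1) (toL2 (P + 1) Ω u)‖ ≤ C * h ^ (P + 1) * ‖u‖) ∧
        (∀ uσ uσ' : pufem d P σ, IsSmoothed hσ ε uh uσ → IsSmoothed hσ ε uh uσ' →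
          Set.EqOn uσ.1 uσ'.1 (fictitiousDomain σ Ω)) ∧
        (Bornology.IsBounded Ω → ∃ uσ : pufem d P σ, IsSmoothed hσ ε uh uσ) := by
  obtain ⟨C, hC, herr⟩ := error_estimate d P K hε CE Cp
  obtain ⟨C₁, -, h₁⟩ := norm_sq_pufemToSobolev_le d P K hε
  -- The threshold `1` is needed only to compare powers of `σ`; adding one makes the constant
  -- positive.
  refine ⟨C + 1, by positivity, 1, one_pos, ?_⟩
  rintro Ω hΩ hext h σ hσ hσ1 rfl hreach u uh hu
  refine ⟨fun x hx => (herr Ω hΩ hext σ hσ hσ1 hreach u uh hu x hx).trans ?_,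
    fun x y hx hy => eqOn_of_isSmoothed hσ hε (fun w => (h₁ σ hσ hσ1 Ω hΩ hreach w).1) hx hy,
    fun hb => exists_isSmoothed hσ hε hΩ hb (fun v hv => ?_) uh⟩
  · gcongr
    linarith
  · have h2 := (h₁ σ hσ hσ1 Ω hΩ hreach v).2
    rw [bilinA_eq_inner_energyMap P hσ hε, hv, inner_zero_left, mul_zero] at h2
    have h3 : 0 < σ ^ (2 * (P + 1)) := by positivity
    have h4 : ‖pufemToSobolev hσ (P + 1) Ω v‖ ^ 2 ≤ 0 := by
      by_contra! h5
      exact absurd (mul_pos h3 h5) (not_lt.2 h2)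
    exact norm_eq_zero.1 (sq_eq_zero_iff.1 (le_antisymm h4 (sq_nonneg _)))
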